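/- **Corollary 3.2.** Let $$\mathbb F_1=\{([s_0:s_1],[t_0:t_1:t_2])\mid s_0t_0=s_1t_1\}\subset\mathbb{C}P^1\times\mathbb{C}P^2$$ be the first Hirzebruch surface, $D_{24}=(s_0=t_1=0)$, $D_{12}=(t_2=0)$ and $\mathcal O(a,b)=\mathcal O(aD_{24}+bD_{12})$ for $a,b\in\mathbb Z$. Fix an integer $c\ge 0$ and let $\mathcal E=\big((0,0),(1,0),(c,1),(1+c,1)\big)$. *The DG category $DG_{\mathcal E}(\mathbb F_1)$.* Its objects are the line bundles $\mathcal O(a,b)$, $(a,b)\in\mathcal E$. The morphisms of degree $r$ from $\mathcal O(a_1,b_1)$ to $\mathcal O(a_2,b_2)$ are the smooth $(0,r)$-forms on $\mathbb F_1$ with values in $\mathcal O(a_2-a_1,b_2-b_1)$. The differential is $2\bar\partial$, and the composition of $\psi$ and $\chi$ is $\psi\wedge\chi$. *The Morse homotopy category $Mo_{\mathcal E}(P)$.* Let $P=\{(x^1,x^2)\in\mathbb R^2\mid 0\le x^1\le 4-x^2,\ 0\le x^2\le 2\}$ be the moment polytope of $\mathbb F_1$, with the metric $g_{ij}=\partial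 x_i/\partial x^j$ in its interior, where $x_1=\frac12\log\frac{x^1}{4-x^1-x^2}$ and $x_2=\frac12\log\frac{x^2(4-x^2)}{(2-x^2)(4-x^1-x^2)}$, restricted to tangent directions on the sides. The objects are the sections $L(a,b)$, $(a,b)\in\mathcal E$, of the torus fibration with fibre $\mathbb R^2/\mathbb Z^2$ given by $$y_{(a,b)}(x)=\Big(\tfrac{(2a+(2-x^2)b)\,x^1}{2(4-x^2)},\ \tfrac{b\,x^2}{2}\Big),\qquad x^2<4 .$$ For $L=L(a,b)$, $L'=L(a',b')$ put $\Delta_{LL'}=y_{(a',b')}-y_{(a,b)}$; for a point $v\in P$ with $\Delta_{LL'}(v)\in\mathbb Z^2$ let $S_v\subset\{x^2<4\}$ be the stable manifold of $v$ for the vector field $\Delta_{LL'}-\Delta_{LL'}(v)$ (this is $-\mathrm{grad}(f_L-f_{L'})$ for local potentials of the two sections). The space of morphisms from $L$ to $L'$ is the complex vector space spanned by those connected components $V$ of $\{x\in P\mid\Delta_{LL'}(x)\in\mathbb Z^2\}$ that contain a point $v$ which is an interior point of $S_v\cap P$ in $S_v$; the degree $|V|$ is $\dim S_v$, $v\in V$.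 The composition is $$\mathfrak m_2(V_{12},V_{23})=\sum_{|V_{13}|=|V_{12}|+|V_{23}|}\ \sum_{[\gamma]}e^{-A(\gamma)}\,V_{13},$$ where $[\gamma]$ runs over the smooth homotopy classes of trivalent gradient trees in $P$ starting at points $v_{12}\in V_{12}$, $v_{23}\in V_{23}$ and ending at a point $v_{13}\in V_{13}$: the two leaf edges $(-\infty,0]\to P$ and the root edge $[0,\infty)\to P$ are (possibly constant) trajectories of the vector fields above, with limits $v_{12}$, $v_{23}$, $v_{13}$ at infinity and a common value at $0$, and $\Delta_{12}(v_{12})+\Delta_{23}(v_{23})=\Delta_{13}(v_{13})$. Here $A(\gamma)$ is the symplectic area of the disk obtained by lifting $\gamma$, that is, the sum over the edges of $\int g(\dot\gamma,\Delta-\Delta(v))\,dt$. The differential $\mathfrak m_1$ and the products $\mathfrak m_k$, $k\ge 3$, are zero. *Claim.* $Mo_{\mathcal E}(P)$ and $DG_{\mathcal E}(\mathbb F_1)$ are strictly unital $A_\infty$-categories; the operations $\mathfrak m_k$, $k\ne 2$, of $Mo_{\mathcal E}(P)$ are the only ones, on these graded morphism spaces, that form a strictly unital $A_\infty$-category together with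 $\mathfrak m_2$. There is a linear $A_\infty$-equivalence $$Mo_{\mathcal E}(P)\simeq DG_{\mathcal E}(\mathbb F_1),\qquad L(a,b)\mapsto\mathcal O(a,b),$$ that is, a bijection on objects together with degree-preserving linear maps of the morphism spaces that commute strictly with all operations $\mathfrak m_k$, preserve the identities, and induce isomorphisms on the cohomology of all morphism spaces. -/

import Mathlib

open Complex Set Filter Topology MeasureTheory
open scoped ContDiff ComplexConjugate

noncomputable section

namespace HMS

/-! ### A∞-categories -/

/-- Composable sequences of morphisms `x → ⋯ → y`. -/
inductive Chain {Obj : Type} (H : Obj → Obj → Type) : Obj → Obj → Type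
  | nil (x : Obj) : Chain H x x
  | cons {x y z : Obj} (f : H x y) (p : Chain H y z) : Chain H x z

namespace Chain

variable {Obj Obj' : Type} {H : Obj → Obj → Type} {H' : Obj' → Obj' → Type}

/-- Number of morphisms in a composable sequence. -/
def length : {x y : Obj} → Chain H x y → ℕ
  | _, _, nil _ => 0
  | _, _, cons _ p => p.length + 1

/-- Concatenation. -/
def append : {x y z : Obj} → Chain H x y → Chain H y z → Chain H x z
  | _, _, _, nil _, q => q
  | _, _, _, cons f p, q => cons f (p.append q)

/-- Image of a composable sequence under a map of objects and morphisms. -/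
def map (F : Obj → Obj') (φ : ∀ x y, H x y → H' (F x) (F y)) :
    {x y : Obj} → Chain H x y → Chain H' (F x) (F y)
  | _, _, nil x => nil (F x)
  | _, _, cons f p => cons (φ _ _ f) (p.map F φ)

/-- The sum of `F p₁ p₂` over all ways to write a sequence as `p₁` followed by `p₂`. -/
def sumSplit {M : Type} [AddCommMonoid M] :
    {x z : Obj} → Chain H x z → (∀ y, Chain H x y → Chain H y z → M) → M
  | _, _, nil x, F => F x (nil x) (nil x)
  | _, _, cons f p, F =>
      F _ (nil _) (cons f p) + p.sumSplit fun y q r => F y (cons f q) r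

/-- All entries are homogeneous, of the listed degrees. -/
def IsHomog (deg : ∀ x y, ℤ → Set (H x y)) : {x y : Obj} → Chain H x y → List ℤ → Prop
  | _, _, nil _, [] => True
  | _, _, cons f p, r :: rs => f ∈ deg _ _ r ∧ p.IsHomog deg rs
  | _, _, nil _, _ :: _ => False
  | _, _, cons _ _, [] => False

end Chain

/-- The data underlying a `ℤ`-graded A∞-category over `ℂ`: morphism spaces with their graded
pieces, and the operations `m_k`, put together into one operation on composable sequences. -/
structure AInfData (Obj : Type) where
  Hom : Obj → Obj → Type
  addCommGroup : ∀ x y, AddCommGroup (Hom x y)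
  module : ∀ x y, Module ℂ (Hom x y)
  deg : ∀ x y, ℤ → Submodule ℂ (Hom x y)
  m : ∀ {x y}, Chain Hom x y → Hom x y

attribute [instance] AInfData.addCommGroup AInfData.module

namespace AInfData

variable {Obj Obj' : Type}

/-- The differential `m₁`. -/
def m₁ (A : AInfData Obj) {x y : Obj} (f : A.Hom x y) : A.Hom x y :=
  A.m (.cons f (.nil y))

/-- The composition `m₂`, for `f : x → y` and `g : y → z` in this order. -/
def m₂ (A : AInfData Obj) {x y z : Obj} (f : A.Hom x y) (g : A.Hom y z) : A.Hom x z :=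
  A.m (.cons f (.cons g (.nil z)))

/-- The same graded morphism spaces with other operations. -/
def withOp (A : AInfData Obj) (m' : ∀ x y, Chain A.Hom x y → A.Hom x y) : AInfData Obj where
  Hom := A.Hom
  addCommGroup := A.addCommGroup
  module := A.module
  deg := A.deg
  m := fun {x y} => m' x y

/-- `e` is a strict identity of `x`. -/
structure IsStrictUnit (A : AInfData Obj) {x : Obj} (e : A.Hom x x) : Prop where
  mem_deg : e ∈ A.deg x x 0
  m₁_eq : A.m₁ e = 0
  m₂_left : ∀ {y} (f : A.Hom x y), A.m₂ e f = f
  m₂_right : ∀ {y} (f : A.Hom y x), A.m₂ f e = f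
  m_eq : ∀ {y z} (p : Chain A.Hom y x) (q : Chain A.Hom x z), 2 ≤ p.length + q.length →
    A.m (p.append (.cons e q)) = 0

/-- The axioms of a strictly unital A∞-category: `m_k` is multilinear of degree `2 - k`, `m₀ = 0`,
and `∑ (-1)^(r + s t) m_{r+1+t} (1^{⊗ r} ⊗ m_s ⊗ 1^{⊗ t}) = 0`, where evaluation on elements
produces the Koszul sign `(-1)^(s (|a₁| + ⋯ + |a_r|))`. -/
structure IsAInfCategory (A : AInfData Obj) : Prop where
  grading : ∀ x y, DirectSum.IsInternal (A.deg x y)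
  m_nil : ∀ x, A.m (.nil x) = 0
  m_add : ∀ {x y z w} (p : Chain A.Hom x y) (f g : A.Hom y z) (q : Chain A.Hom z w),
    A.m (p.append (.cons (f + g) q)) = A.m (p.append (.cons f q)) + A.m (p.append (.cons g q))
  m_smul : ∀ {x y z w} (p : Chain A.Hom x y) (c : ℂ) (f : A.Hom y z) (q : Chain A.Hom z w),
    A.m (p.append (.cons (c • f) q)) = c • A.m (p.append (.cons f q))
  m_deg : ∀ {x y} (p : Chain A.Hom x y) (ds : List ℤ),
    p.IsHomog (fun x y r => (A.deg x y r : Set (A.Hom x y))) ds →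
      A.m p ∈ A.deg x y (ds.sum + 2 - ds.length)
  relation : ∀ {x y} (p : Chain A.Hom x y) (ds : List ℤ),
    p.IsHomog (fun x y r => (A.deg x y r : Set (A.Hom x y))) ds →
      (p.sumSplit fun _ p₁ q => q.sumSplit fun _ p₂ p₃ =>
        (-1 : ℂ) ^ ((p₁.length : ℤ) + p₂.length * p₃.length
            + p₂.length * (ds.take p₁.length).sum) •
          A.m (p₁.append (.cons (A.m p₂) p₃))) = 0
  unit : ∀ x, ∃ e : A.Hom x x, A.IsStrictUnit e

/-- A linear A∞-functor: its only component is the linear one, so it commutes strictly with all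
the operations `m_k`. -/
structure LinearFunctor (A : AInfData Obj) (B : AInfData Obj') where
  obj : Obj → Obj'
  map : ∀ x y, A.Hom x y →ₗ[ℂ] B.Hom (obj x) (obj y)
  map_deg : ∀ x y r, ∀ f ∈ A.deg x y r, map x y f ∈ B.deg (obj x) (obj y) r
  map_m : ∀ {x y} (p : Chain A.Hom x y),
    B.m (p.map obj fun x y => map x y) = map x y (A.m p)
  map_unit : ∀ {x} (e : A.Hom x x), A.IsStrictUnit e → B.IsStrictUnit (map x x e)

/-- A linear A∞-functor is an equivalence if it is bijective on objects and induces isomorphisms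
on the cohomology (with respect to `m₁`) of all morphism complexes, in every degree. -/
structure LinearFunctor.IsEquivalence {A : AInfData Obj} {B : AInfData Obj'}
    (F : A.LinearFunctor B) : Prop where
  obj_bijective : Function.Bijective F.obj
  cohomology_injective : ∀ x y r, ∀ f ∈ A.deg x y r, A.m₁ f = 0 →
    (∃ h ∈ B.deg (F.obj x) (F.obj y) (r - 1), F.map x y f = B.m₁ h) →
      ∃ h ∈ A.deg x y (r - 1), f = A.m₁ h
  cohomology_surjective : ∀ x y r, ∀ g ∈ B.deg (F.obj x) (F.obj y) r, B.m₁ g = 0 →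
    ∃ f ∈ A.deg x y r, A.m₁ f = 0 ∧
      ∃ h ∈ B.deg (F.obj x) (F.obj y) (r - 1), F.map x y f - g = B.m₁ h

end AInfData

/-- The exceptional collection `(0,0), (1,0), (c,1), (1+c,1)`: the pair `(a, b)` stands for the
line bundle `𝒪(a,b) = 𝒪(a D₂₄ + b D₁₂)` and for its mirror Lagrangian section `L(a,b)`. -/
def collection (c : ℕ) : Fin 4 → ℤ × ℤ := ![(0, 0), (1, 0), (c, 1), (1 + c, 1)]

/-! ### The Dolbeault DG category of line bundles on the Hirzebruch surface -/

/-- Labels of the components of a form `f + f_u dū + f_v dv̄ + f_uv dū ∧ dv̄` on `ℂ²`. -/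
inductive Comp : Type
  | one | du | dv | dudv

/-- The form degree of a component. -/
def Comp.degree : Comp → ℤ
  | .one => 0
  | .du => 1
  | .dv => 1
  | .dudv => 2

/-- Forms of type `(0,*)` on `ℂ²`, with coordinates `(u, v)`, given by their components. -/
abbrev LocalForm : Type := Comp → ℂ × ℂ → ℂ

/-- The antiholomorphic part of the derivative of `f` in direction `w`: for `w = (1, 0)` this is
`∂f/∂ū = (∂f/∂(re u) + i ∂f/∂(im u)) / 2`, for `w = (0, 1)` it is `∂f/∂v̄`. -/
def dbarDir (w : ℂ × ℂ) (f : ℂ × ℂ → ℂ) (p : ℂ × ℂ) : ℂ :=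
  (fderiv ℝ f p w + I * fderiv ℝ f p (I • w)) / 2

/-- The Dolbeault operator `∂̄`. -/
def LocalForm.dbar (ψ : LocalForm) : LocalForm
  | .one => 0
  | .du => dbarDir (1, 0) (ψ .one)
  | .dv => dbarDir (0, 1) (ψ .one)
  | .dudv => dbarDir (1, 0) (ψ .dv) - dbarDir (0, 1) (ψ .du)

/-- The wedge product. -/
def LocalForm.wedge (ψ χ : LocalForm) : LocalForm
  | .one => ψ .one * χ .one
  | .du => ψ .one * χ .du + ψ .du * χ .one
  | .dv => ψ .one * χ .dv + ψ .dv * χ .one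
  | .dudv => ψ .one * χ .dudv + ψ .du * χ .dv - ψ .dv * χ .du + ψ .dudv * χ .one

/-- The pullback along a holomorphic map `κ`. -/
def LocalForm.pullback (κ : ℂ × ℂ → ℂ × ℂ) (ψ : LocalForm) : LocalForm
  | .one => fun p => ψ .one (κ p)
  | .du => fun p =>
      conj (fderiv ℂ κ p (1, 0)).1 * ψ .du (κ p) + conj (fderiv ℂ κ p (1, 0)).2 * ψ .dv (κ p)
  | .dv => fun p =>
      conj (fderiv ℂ κ p (0, 1)).1 * ψ .du (κ p) + conj (fderiv ℂ κ p (0, 1)).2 * ψ .dv (κ p)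
  | .dudv => fun p =>
      conj ((fderiv ℂ κ p (1, 0)).1 * (fderiv ℂ κ p (0, 1)).2
        - (fderiv ℂ κ p (0, 1)).1 * (fderiv ℂ κ p (1, 0)).2) * ψ .dudv (κ p)

/-- The four standard affine charts, each a copy of `ℂ²` with coordinates `(u, v)`, of
`𝔽₁ = {([s₀:s₁], [t₀:t₁:t₂]) | s₀ t₀ = s₁ t₁} ⊂ ℂP¹ × ℂP²`. -/
inductive Chart : Type
  | U₁ | U₂ | U₃ | U₄

/-- Homogeneous coordinates `((s₀, s₁), (t₀, t₁, t₂))` of the point of `𝔽₁` with coordinates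
`(u, v)` in a chart. -/
def Chart.homog : Chart → ℂ × ℂ → (Fin 2 → ℂ) × (Fin 3 → ℂ)
  | .U₁ => fun p => (![1, p.1], ![p.1, 1, p.2])
  | .U₂ => fun p => (![p.1, 1], ![1, p.1, p.2])
  | .U₃ => fun p => (![1, p.1], ![p.1 * p.2, p.2, 1])
  | .U₄ => fun p => (![p.1, 1], ![p.2, p.1 * p.2, 1])

/-- The coordinates in a chart of the point with coordinates `(u₂, v₂)` in the chart `U₂`. -/
def Chart.coord : Chart → ℂ × ℂ → ℂ × ℂ
  | .U₁ => fun p => (p.1⁻¹, p.2 * p.1⁻¹)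
  | .U₂ => fun p => p
  | .U₃ => fun p => (p.1⁻¹, p.1 * p.2⁻¹)
  | .U₄ => fun p => (p.1, p.2⁻¹)

/-- The transition function `φ₂ᵢ` of `𝒪(a,b)`, `D = (a, b)`, in the coordinates of `U₂`: local
expressions of a section satisfy `sᵢ = φ₂ᵢ s₂`. -/
def Chart.trans (D : ℤ × ℤ) : Chart → ℂ × ℂ → ℂ
  | .U₁ => fun p => p.1 ^ (-D.1) * p.1 ^ (-D.2)
  | .U₂ => fun _ => 1
  | .U₃ => fun p => p.1 ^ (-D.1) * p.2 ^ (-D.2)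
  | .U₄ => fun p => p.2 ^ (-D.2)

/-- The intersection of the four charts in the coordinates of `U₂`; it is dense in `𝔽₁`. -/
def torus : Set (ℂ × ℂ) := {p | p.1 ≠ 0 ∧ p.2 ≠ 0}

/-- `Chart.coord` is the coordinate change of `𝔽₁`: both coordinates give the same point of
`ℂP¹ × ℂP²`. -/
lemma Chart.homog_coord (i : Chart) {p : ℂ × ℂ} (hp : p ∈ torus) :
    ∃ a b : ℂ, a ≠ 0 ∧ b ≠ 0 ∧
      i.homog (i.coord p) = (a • (Chart.U₂.homog p).1, b • (Chart.U₂.homog p).2) := by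
  obtain ⟨h1, h2⟩ := hp
  cases i
  · refine ⟨p.1⁻¹, p.1⁻¹, inv_ne_zero h1, inv_ne_zero h1, ?_⟩
    simp [Chart.homog, Chart.coord, h1, mul_comm]
  · exact ⟨1, 1, one_ne_zero, one_ne_zero, by simp [Chart.homog, Chart.coord]⟩
  · refine ⟨p.1⁻¹, p.2⁻¹, inv_ne_zero h1, inv_ne_zero h2, ?_⟩
    simp [Chart.homog, Chart.coord, h1, h2, mul_comm]
  · refine ⟨1, p.2⁻¹, one_ne_zero, inv_ne_zero h2, ?_⟩
    simp [Chart.homog, Chart.coord, h2, mul_comm]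

lemma LocalForm.pullback_add (κ : ℂ × ℂ → ℂ × ℂ) (ψ χ : LocalForm) (k : Comp) (p : ℂ × ℂ) :
    (ψ + χ).pullback κ k p = ψ.pullback κ k p + χ.pullback κ k p := by
  cases k <;> simp only [LocalForm.pullback, Pi.add_apply] <;> ring

lemma LocalForm.pullback_smul (κ : ℂ × ℂ → ℂ × ℂ) (c : ℂ) (ψ : LocalForm) (k : Comp)
    (p : ℂ × ℂ) : (c • ψ).pullback κ k p = c * ψ.pullback κ k p := by
  cases k <;> simp only [LocalForm.pullback, Pi.smul_apply, smul_eq_mul] <;> ring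

lemma LocalForm.pullback_wedge (κ : ℂ × ℂ → ℂ × ℂ) (ψ χ : LocalForm) (k : Comp)
    (p : ℂ × ℂ) :
    (ψ.wedge χ).pullback κ k p = (ψ.pullback κ).wedge (χ.pullback κ) k p := by
  cases k <;> simp only [LocalForm.pullback, LocalForm.wedge, Pi.add_apply, Pi.sub_apply,
    Pi.mul_apply, map_sub, map_mul] <;> ring

/-- The smooth `(0,*)`-forms on `𝔽₁` with values in `𝒪(a,b)`, `D = (a, b)`: families of smooth
local expressions, with respect to the holomorphic frames of `𝒪(a,b)` over the four charts, which
match under the coordinate changes and transition functions. By continuity it is enough to compare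
them on the dense set `torus`, where every chart overlaps with `U₂`. -/
def DGHom (D : ℤ × ℤ) : Submodule ℂ (Chart → LocalForm) where
  carrier := {ψ | (∀ i k, ContDiff ℝ ∞ (ψ i k)) ∧
    ∀ i k, ∀ p ∈ torus, (ψ i).pullback i.coord k p = i.trans D p * ψ .U₂ k p}
  zero_mem' := by
    refine ⟨fun i k => contDiff_const, fun i k p _ => ?_⟩
    cases k <;> simp [LocalForm.pullback]
  add_mem' := by
    rintro ψ χ ⟨h1, h2⟩ ⟨h3, h4⟩
    refine ⟨fun i k => (h1 i k).add (h3 i k), fun i k p hp => ?_⟩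
    rw [Pi.add_apply, LocalForm.pullback_add, h2 i k p hp, h4 i k p hp]
    simp only [Pi.add_apply]; ring
  smul_mem' := by
    rintro c ψ ⟨h1, h2⟩
    refine ⟨fun i k => (h1 i k).const_smul c, fun i k p hp => ?_⟩
    rw [Pi.smul_apply, LocalForm.pullback_smul, h2 i k p hp]
    simp only [Pi.smul_apply, smul_eq_mul]; ring

lemma torus_mem_nhds {p : ℂ × ℂ} (hp : p ∈ torus) : torus ∈ 𝓝 p :=
  ((isOpen_ne_fun continuous_fst continuous_const).inter
    (isOpen_ne_fun continuous_snd continuous_const)).mem_nhds hp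

lemma coord_contDiffAt (i : Chart) {p : ℂ × ℂ} (hp : p ∈ torus) :
    ContDiffAt ℂ 2 i.coord p := by
  obtain ⟨h1, h2⟩ := hp
  have e1 : ContDiffAt ℂ 2 (fun p : ℂ × ℂ => p.1⁻¹) p := contDiffAt_fst.inv h1
  have e2 : ContDiffAt ℂ 2 (fun p : ℂ × ℂ => p.2⁻¹) p := contDiffAt_snd.inv h2
  cases i
  · exact e1.prodMk (contDiffAt_snd.mul e1)
  · exact contDiffAt_id
  · exact e1.prodMk (contDiffAt_fst.mul e2)
  · exact contDiffAt_fst.prodMk e2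

lemma trans_differentiableAt (D : ℤ × ℤ) (i : Chart) {p : ℂ × ℂ} (hp : p ∈ torus) :
    DifferentiableAt ℂ (i.trans D) p := by
  obtain ⟨h1, h2⟩ := hp
  have e1 : ∀ n : ℤ, DifferentiableAt ℂ (fun p : ℂ × ℂ => p.1 ^ n) p :=
    fun n => differentiableAt_fst.zpow (Or.inl h1)
  have e2 : ∀ n : ℤ, DifferentiableAt ℂ (fun p : ℂ × ℂ => p.2 ^ n) p :=
    fun n => differentiableAt_snd.zpow (Or.inl h2)
  cases i
  · exact (e1 _).mul (e1 _)
  · exact differentiableAt_const _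
  · exact (e1 _).mul (e2 _)
  · exact e2 _

lemma dbarDir_congr {f g : ℂ × ℂ → ℂ} {p : ℂ × ℂ} (w : ℂ × ℂ) (h : f =ᶠ[𝓝 p] g) :
    dbarDir w f p = dbarDir w g p := by
  simp only [dbarDir, h.fderiv_eq]

lemma dbarDir_mul {f g : ℂ × ℂ → ℂ} {p : ℂ × ℂ} (w : ℂ × ℂ) (hf : DifferentiableAt ℝ f p)
    (hg : DifferentiableAt ℝ g p) :
    dbarDir w (fun q => f q * g q) p = f p * dbarDir w g p + dbarDir w f p * g p := by
  simp only [dbarDir, fderiv_fun_mul hf hg, _root_.add_apply,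
    _root_.smul_apply, smul_eq_mul]
  ring

lemma dbarDir_add {f g : ℂ × ℂ → ℂ} {p : ℂ × ℂ} (w : ℂ × ℂ) (hf : DifferentiableAt ℝ f p)
    (hg : DifferentiableAt ℝ g p) :
    dbarDir w (fun q => f q + g q) p = dbarDir w f p + dbarDir w g p := by
  simp only [dbarDir, fderiv_fun_add hf hg, _root_.add_apply]
  ring

lemma dbarDir_holo {f : ℂ × ℂ → ℂ} {p : ℂ × ℂ} (w : ℂ × ℂ) (hf : DifferentiableAt ℂ f p) :
    dbarDir w f p = 0 := by
  simp only [dbarDir, hf.fderiv_restrictScalars ℝ, ContinuousLinearMap.coe_restrictScalars',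
    map_smul, smul_eq_mul]
  linear_combination (fderiv ℂ f p w / 2) * I_mul_I

lemma dbarDir_conj {f : ℂ × ℂ → ℂ} {p : ℂ × ℂ} (w : ℂ × ℂ) (hf : DifferentiableAt ℂ f p) :
    dbarDir w (fun q => conj (f q)) p = conj (fderiv ℂ f p w) := by
  have h := (conjCLE.toContinuousLinearMap.hasFDerivAt (x := f p)).comp p
    (hf.hasFDerivAt.restrictScalars ℝ)
  have h' : HasFDerivAt (fun q => conj (f q)) _ p := h
  simp only [dbarDir, h'.fderiv]
  simp
  linear_combination (-conj (fderiv ℂ f p w) / 2) * I_mul_I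

lemma dbarDir_comp {f : ℂ × ℂ → ℂ} {κ : ℂ × ℂ → ℂ × ℂ} {p : ℂ × ℂ} (w : ℂ × ℂ)
    (hf : DifferentiableAt ℝ f (κ p)) (hκ : DifferentiableAt ℂ κ p) :
    dbarDir w (fun q => f (κ q)) p
      = conj (fderiv ℂ κ p w).1 * dbarDir (1, 0) f (κ p)
        + conj (fderiv ℂ κ p w).2 * dbarDir (0, 1) f (κ p) := by
  have h : HasFDerivAt (fun q => f (κ q)) _ p :=
    hf.hasFDerivAt.comp p (hκ.hasFDerivAt.restrictScalars ℝ)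
  have key : ∀ z : ℂ × ℂ, fderiv ℝ f (κ p) z
      = z.1.re * fderiv ℝ f (κ p) (1, 0) + z.1.im * fderiv ℝ f (κ p) (I, 0)
        + z.2.re * fderiv ℝ f (κ p) (0, 1) + z.2.im * fderiv ℝ f (κ p) (0, I) := by
    intro z
    have hz : z = z.1.re • ((1, 0) : ℂ × ℂ) + z.1.im • ((I, 0) : ℂ × ℂ)
        + z.2.re • ((0, 1) : ℂ × ℂ) + z.2.im • ((0, I) : ℂ × ℂ) := by
      ext <;> simp
    conv_lhs => rw [hz]
    simp only [map_add, map_smul, Complex.real_smul]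
  simp only [dbarDir, h.fderiv, ContinuousLinearMap.comp_apply,
    ContinuousLinearMap.coe_restrictScalars', map_smul]
  generalize fderiv ℂ κ p w = z
  rw [key z, key (I • z)]
  have c1 : ∀ z : ℂ, conj z = z.re - z.im * I := fun z => by
    apply Complex.ext <;> simp
  simp only [c1, Prod.smul_fst, Prod.smul_snd, smul_eq_mul, mul_re, mul_im, I_re, I_im,
    Prod.smul_mk, mul_one, mul_zero, zero_mul, one_mul, zero_sub, zero_add, ofReal_neg]
  linear_combination ((z.1.im : ℂ) * fderiv ℝ f (κ p) (I, 0) / 2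
    + (z.2.im : ℂ) * fderiv ℝ f (κ p) (0, I) / 2) * I_mul_I

lemma contDiff_dbarDir {f : ℂ × ℂ → ℂ} (hf : ContDiff ℝ ∞ f) (w : ℂ × ℂ) :
    ContDiff ℝ ∞ (dbarDir w f) := by
  have h : ContDiff ℝ ∞ (fderiv ℝ f) := hf.fderiv_right (by simp)
  have h1 : ∀ z : ℂ × ℂ, ContDiff ℝ ∞ (fun p => fderiv ℝ f p z) :=
    fun z => h.clm_apply contDiff_const
  exact ((h1 w).add (contDiff_const.mul (h1 (I • w)))).div_const 2

lemma dbar_mem {D : ℤ × ℤ} {ψ : Chart → LocalForm} (h : ψ ∈ DGHom D) :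
    (fun i => (ψ i).dbar) ∈ DGHom D := by
  obtain ⟨hs, hc⟩ := h
  have hd : ∀ i k p, DifferentiableAt ℝ (ψ i k) p :=
    fun i k p => (hs i k).differentiable (by simp) p
  refine ⟨fun i k => ?_, fun i k p hp => ?_⟩
  · cases k
    · exact contDiff_const
    · exact contDiff_dbarDir (hs i _) _
    · exact contDiff_dbarDir (hs i _) _
    · exact (contDiff_dbarDir (hs i _) _).sub (contDiff_dbarDir (hs i _) _)
  have hκ2 := coord_contDiffAt i hp
  have hκ : DifferentiableAt ℂ i.coord p := hκ2.differentiableAt (by simp)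
  have hφ := trans_differentiableAt D i hp
  have hφr : DifferentiableAt ℝ (i.trans D) p := hφ.restrictScalars ℝ
  have hev : ∀ k, (ψ i).pullback i.coord k =ᶠ[𝓝 p] fun q => i.trans D q * ψ .U₂ k q :=
    fun k => (eventually_of_mem (torus_mem_nhds hp) fun q hq => hc i k q hq)
  have hder : ∀ k w, dbarDir w ((ψ i).pullback i.coord k) p
      = i.trans D p * dbarDir w (ψ .U₂ k) p := by
    intro k w
    rw [dbarDir_congr w (hev k), dbarDir_mul w hφr (hd _ _ _), dbarDir_holo w hφ, zero_mul,
      add_zero]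
  cases k
  · simp [LocalForm.pullback, LocalForm.dbar]
  · exact (dbarDir_comp _ (hd _ _ _) hκ).symm.trans (hder .one (1, 0))
  · exact (dbarDir_comp _ (hd _ _ _) hκ).symm.trans (hder .one (0, 1))
  · have hJ : DifferentiableAt ℂ (fderiv ℂ i.coord) p :=
      (hκ2.fderiv_right (m := 1) (by norm_num)).differentiableAt (by simp)
    have hJw : ∀ w, DifferentiableAt ℂ (fun q => fderiv ℂ i.coord q w) p :=
      fun w => hJ.clm_apply (differentiableAt_const w)
    have hJ1 : ∀ w, DifferentiableAt ℂ (fun q => (fderiv ℂ i.coord q w).1) p :=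
      fun w => (hJw w).fst
    have hJ2 : ∀ w, DifferentiableAt ℂ (fun q => (fderiv ℂ i.coord q w).2) p :=
      fun w => (hJw w).snd
    have d1 : ∀ w z, fderiv ℂ (fun q => (fderiv ℂ i.coord q w).1) p z
        = (fderiv ℂ (fderiv ℂ i.coord) p z w).1 := by
      intro w z
      have := ((hJ.hasFDerivAt.clm_apply (hasFDerivAt_const w p))).fst
      rw [this.fderiv]; simp
    have d2 : ∀ w z, fderiv ℂ (fun q => (fderiv ℂ i.coord q w).2) p z
        = (fderiv ℂ (fderiv ℂ i.coord) p z w).2 := by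
      intro w z
      have := ((hJ.hasFDerivAt.clm_apply (hasFDerivAt_const w p))).snd
      rw [this.fderiv]; simp
    have hsym : fderiv ℂ (fderiv ℂ i.coord) p (1, 0) (0, 1)
        = fderiv ℂ (fderiv ℂ i.coord) p (0, 1) (1, 0) :=
      (hκ2.isSymmSndFDerivAt (by simp)) _ _
    have cd : ∀ {g : ℂ × ℂ → ℂ}, DifferentiableAt ℂ g p →
        DifferentiableAt ℝ (fun q => conj (g q)) p := fun hg =>
      (conjCLE.toContinuousLinearMap.differentiableAt).comp p (hg.restrictScalars ℝ)
    have pc : ∀ k, DifferentiableAt ℝ (fun q => ψ i k (i.coord q)) p := fun k =>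
      (hd i k _).comp p (hκ.restrictScalars ℝ)
    have hu := hder .du (0, 1)
    have hv := hder .dv (1, 0)
    simp only [LocalForm.pullback] at hu hv
    rw [dbarDir_add _ ((cd (hJ1 _)).fun_mul (pc _)) ((cd (hJ2 _)).fun_mul (pc _)),
      dbarDir_mul _ (cd (hJ1 _)) (pc _), dbarDir_mul _ (cd (hJ2 _)) (pc _),
      dbarDir_conj _ (hJ1 _), dbarDir_conj _ (hJ2 _),
      dbarDir_comp _ (hd _ _ _) hκ, dbarDir_comp _ (hd _ _ _) hκ, d1, d2] at hu hv
    rw [hsym] at hv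
    simp only [LocalForm.dbar, LocalForm.pullback, Pi.sub_apply, mul_sub, ← hu, ← hv, map_sub,
      map_mul]
    ring

lemma wedge_mem {D D' D'' : ℤ × ℤ} (hD : D + D' = D'') {ψ χ : Chart → LocalForm}
    (h : ψ ∈ DGHom D) (h' : χ ∈ DGHom D') : (fun i => (ψ i).wedge (χ i)) ∈ DGHom D'' := by
  obtain ⟨hs, hc⟩ := h
  obtain ⟨hs', hc'⟩ := h'
  refine ⟨fun i k => ?_, fun i k p hp => ?_⟩
  · have hm : ∀ k l, ContDiff ℝ ∞ (ψ i k * χ i l) := fun k l => (hs i k).mul (hs' i l)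
    cases k
    · exact hm _ _
    · exact (hm _ _).add (hm _ _)
    · exact (hm _ _).add (hm _ _)
    · exact (((hm _ _).add (hm _ _)).sub (hm _ _)).add (hm _ _)
  · have ht : i.trans D'' p = i.trans D p * i.trans D' p := by
      obtain ⟨h1, h2⟩ := hp
      subst hD
      cases i <;> simp only [Chart.trans, Prod.fst_add, Prod.snd_add, neg_add, zpow_add₀ h1,
        zpow_add₀ h2] <;> ring
    rw [LocalForm.pullback_wedge, ht]
    cases k <;> simp only [LocalForm.wedge, Pi.add_apply, Pi.sub_apply, Pi.mul_apply,
      hc i _ p hp, hc' i _ p hp] <;> ring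

/-- Forms of type `(0, r)`. -/
def dgDeg (D : ℤ × ℤ) (r : ℤ) : Submodule ℂ (DGHom D) where
  carrier := {ψ | ∀ i k, k.degree ≠ r → ψ.1 i k = 0}
  zero_mem' := fun _ _ _ => rfl
  add_mem' := by
    intro ψ χ h h' i k hk
    change ψ.1 i k + χ.1 i k = 0
    rw [h i k hk, h' i k hk, add_zero]
  smul_mem' := by
    intro c ψ h i k hk
    change c • ψ.1 i k = 0
    rw [h i k hk, smul_zero]

/-- The differential `ψ ↦ 2 (D_b^{0,1} ψ - (-1)^r ψ D_a^{0,1})`. The connection forms of the line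
bundles `𝒪(a,b)` are of type `(1,0)` in the holomorphic frames, so that this is `2 ∂̄ ψ`. -/
def dgDiff {D : ℤ × ℤ} (ψ : DGHom D) : DGHom D :=
  (2 : ℂ) • ⟨fun i => (ψ.1 i).dbar, dbar_mem ψ.2⟩

/-- The composition of `ψ : 𝒪(D₁) → 𝒪(D₂)` and `χ : 𝒪(D₂) → 𝒪(D₃)`, which is
`(-1)^{|ψ||χ|} χ ∧ ψ = ψ ∧ χ`. -/
def dgComp {D₁ D₂ D₃ : ℤ × ℤ} (ψ : DGHom (D₂ - D₁)) (χ : DGHom (D₃ - D₂)) : DGHom (D₃ - D₁) :=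
  ⟨fun i => (ψ.1 i).wedge (χ.1 i), wedge_mem (by abel) ψ.2 χ.2⟩

/-- The operations of the DG category: `m₁` is the differential, `m₂` the composition, all others
vanish. -/
def dgOp {ι : Type} (E : ι → ℤ × ℤ) :
    {x y : ι} → Chain (fun x y => DGHom (E y - E x)) x y → DGHom (E y - E x)
  | _, _, .nil _ => 0
  | _, _, .cons f (.nil _) => dgDiff f
  | _, _, .cons f (.cons g (.nil _)) => dgComp f g
  | _, _, .cons _ (.cons _ (.cons _ _)) => 0

/-- The full DG subcategory of `DG(𝔽₁)` on the line bundles `𝒪(E x)`, `x : ι`. -/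
def DGCat {ι : Type} (E : ι → ℤ × ℤ) : AInfData ι where
  Hom x y := DGHom (E y - E x)
  addCommGroup _ _ := inferInstance
  module _ _ := inferInstance
  deg x y := dgDeg (E y - E x)
  m := dgOp E

/-! ### The Morse homotopy category of the moment polytope -/

/-- The moment polytope of `𝔽₁`. -/
def polytope : Set (ℝ × ℝ) := {x | 0 ≤ x.1 ∧ x.1 ≤ 4 - x.2 ∧ 0 ≤ x.2 ∧ x.2 ≤ 2}

/-- The open neighbourhood of the polytope over which all the Lagrangian sections extend. -/
def ambient : Set (ℝ × ℝ) := {x | x.2 < 4}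

/-- The Lagrangian section `L(a,b)`, `D = (a, b)`, lifted to the universal covering of the torus
fibration. Fibre coordinates `(y¹, y²)` are in units of `2π`, so the fibre is `ℝ²/ℤ²`. -/
def lagSection (D : ℤ × ℤ) (x : ℝ × ℝ) : ℝ × ℝ :=
  ((2 * D.1 + (2 - x.2) * D.2) * x.1 / (2 * (4 - x.2)), D.2 * x.2 / 2)

/-- The difference of the lifted sections `L(D')` and `L(D)`. -/
def lagDiff (D D' : ℤ × ℤ) (x : ℝ × ℝ) : ℝ × ℝ := lagSection D' x - lagSection D x

/-- The projection to the polytope of the intersection of `L(D)` and `L(D')`. -/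
def intersection (D D' : ℤ × ℤ) : Set (ℝ × ℝ) :=
  {x ∈ polytope | ∃ i j : ℤ, lagDiff D D' x = ((i : ℝ), (j : ℝ))}

/-- The vector field `-grad (f_L - f_L')` for `L = L(D)`, `L' = L(D')`, with those local potentials
for which it vanishes at the intersection point `v`. If `(x₁, x₂)` are the dual coordinates, the
differential of `f_L' - f_L` is `∑ⱼ wʲ dxⱼ` with `w = lagDiff D D' - lagDiff D D' v`, hence its
gradient is `∑ⱼ wʲ ∂/∂xʲ`. -/
def gradField (D D' : ℤ × ℤ) (v x : ℝ × ℝ) : ℝ × ℝ := lagDiff D D' x - lagDiff D D' v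

/-- The stable manifold of the point `v`. -/
def stableManifold (D D' : ℤ × ℤ) (v : ℝ × ℝ) : Set (ℝ × ℝ) :=
  {x | ∃ γ : ℝ → ℝ × ℝ, γ 0 = x ∧
    (∀ t ∈ Ici (0 : ℝ), γ t ∈ ambient ∧
      HasDerivWithinAt γ (gradField D D' v (γ t)) (Ici 0) t) ∧
    Tendsto γ atTop (𝓝 v)}

/-- The generators of the morphism space from `L(D)` to `L(D')`: connected components `V` of the
intersection for which some `v ∈ V` is an interior point of `S_v ∩ P` in the stable manifold
`S_v`. -/
def MoGen (D D' : ℤ × ℤ) : Type :=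
  {V : Set (ℝ × ℝ) //
    (∃ v ∈ intersection D D', V = connectedComponentIn (intersection D D') v) ∧
    ∃ v ∈ V, stableManifold D D' v ∩ polytope ∈ 𝓝[stableManifold D D' v] v}

/-- The degree of a generator, the dimension of the stable manifold `S_v` of a point `v ∈ V` (it
does not depend on `v`). -/
def MoGen.dim {D D' : ℤ × ℤ} (V : MoGen D D') : ENNReal :=
  ⨆ v ∈ V.1, dimH (stableManifold D D' v)

/-- The vector space spanned by the generators. -/
abbrev MoHom (D D' : ℤ × ℤ) : Type := MoGen D D' →₀ ℂ

/-- The part of degree `r`. -/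
def moDeg (D D' : ℤ × ℤ) (r : ℤ) : Submodule ℂ (MoHom D D') :=
  Finsupp.supported ℂ ℂ {V | ∃ n : ℕ, (n : ℤ) = r ∧ V.dim = n}

/-- The metric `g = ∑ g_ij dxⁱ dxʲ` of the base at `x`, where `g_ij = ∂x_i/∂xʲ` for the dual
coordinates `x₁ = log (x¹ / (4 - x¹ - x²)) / 2` and
`x₂ = log (x² (4 - x²) / ((2 - x²) (4 - x¹ - x²))) / 2`. On a side of the polytope one of the
denominators vanishes, and the corresponding term is dropped: its numerator vanishes on vectors
tangent to that side. -/
def baseMetric (x ξ η : ℝ × ℝ) : ℝ :=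
  (ξ.1 * η.1 / x.1 + ξ.2 * η.2 / x.2 + ξ.2 * η.2 / (2 - x.2)
    + (ξ.1 + ξ.2) * (η.1 + η.2) / (4 - x.1 - x.2) - ξ.2 * η.2 / (4 - x.2)) / 2

/-- Trivalent gradient trees in the polytope starting at `V₁₂` and `V₂₃` and ending at `V₁₃`. The
two leaf edges are parametrized by `(-∞, 0]`, the root edge by `[0, ∞)`, and the trivalent vertex is
their common value at `0`. Edges may be constant. The last condition says that the lifts of the
three Lagrangian sections along the edges fit together, so that the tree lifts to a disk. -/
structure GradientTree {D₁ D₂ D₃ : ℤ × ℤ} (V₁₂ : MoGen D₁ D₂) (V₂₃ : MoGen D₂ D₃)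
    (V₁₃ : MoGen D₁ D₃) where
  v₁₂ : ℝ × ℝ
  v₂₃ : ℝ × ℝ
  v₁₃ : ℝ × ℝ
  γ₁₂ : ℝ → ℝ × ℝ
  γ₂₃ : ℝ → ℝ × ℝ
  γ₁₃ : ℝ → ℝ × ℝ
  v₁₂_mem : v₁₂ ∈ V₁₂.1
  v₂₃_mem : v₂₃ ∈ V₂₃.1
  v₁₃_mem : v₁₃ ∈ V₁₃.1
  flow₁₂ : ∀ t ∈ Iic (0 : ℝ), γ₁₂ t ∈ polytope ∧
    HasDerivWithinAt γ₁₂ (gradField D₁ D₂ v₁₂ (γ₁₂ t)) (Iic 0) t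
  flow₂₃ : ∀ t ∈ Iic (0 : ℝ), γ₂₃ t ∈ polytope ∧
    HasDerivWithinAt γ₂₃ (gradField D₂ D₃ v₂₃ (γ₂₃ t)) (Iic 0) t
  flow₁₃ : ∀ t ∈ Ici (0 : ℝ), γ₁₃ t ∈ polytope ∧
    HasDerivWithinAt γ₁₃ (gradField D₁ D₃ v₁₃ (γ₁₃ t)) (Ici 0) t
  start₁₂ : Tendsto γ₁₂ atBot (𝓝 v₁₂)
  start₂₃ : Tendsto γ₂₃ atBot (𝓝 v₂₃)
  end₁₃ : Tendsto γ₁₃ atTop (𝓝 v₁₃)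
  vertex₁₂ : γ₁₂ 0 = γ₁₃ 0
  vertex₂₃ : γ₂₃ 0 = γ₁₃ 0
  lift : lagDiff D₁ D₂ v₁₂ + lagDiff D₂ D₃ v₂₃ = lagDiff D₁ D₃ v₁₃

namespace GradientTree

variable {D₁ D₂ D₃ : ℤ × ℤ} {V₁₂ : MoGen D₁ D₂} {V₂₃ : MoGen D₂ D₃} {V₁₃ : MoGen D₁ D₃}

/-- The trees agree on their edges. -/
def Same (γ γ' : GradientTree V₁₂ V₂₃ V₁₃) : Prop :=
  EqOn γ.γ₁₂ γ'.γ₁₂ (Iic 0) ∧ EqOn γ.γ₂₃ γ'.γ₂₃ (Iic 0) ∧ EqOn γ.γ₁₃ γ'.γ₁₃ (Ici 0)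

/-- Smooth homotopy through gradient trees. -/
def Homotopic (γ γ' : GradientTree V₁₂ V₂₃ V₁₃) : Prop :=
  ∃ Γ : ℝ → GradientTree V₁₂ V₂₃ V₁₃, (Γ 0).Same γ ∧ (Γ 1).Same γ' ∧
    ContDiffOn ℝ ∞ (fun τ => (Γ τ).v₁₂) (Icc 0 1) ∧
    ContDiffOn ℝ ∞ (fun τ => (Γ τ).v₂₃) (Icc 0 1) ∧
    ContDiffOn ℝ ∞ (fun τ => (Γ τ).v₁₃) (Icc 0 1) ∧
    ContDiffOn ℝ ∞ (fun q : ℝ × ℝ => (Γ q.1).γ₁₂ q.2) (Icc 0 1 ×ˢ Iic 0) ∧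
    ContDiffOn ℝ ∞ (fun q : ℝ × ℝ => (Γ q.1).γ₂₃ q.2) (Icc 0 1 ×ˢ Iic 0) ∧
    ContDiffOn ℝ ∞ (fun q : ℝ × ℝ => (Γ q.1).γ₁₃ q.2) (Icc 0 1 ×ˢ Ici 0)

/-- The symplectic area (in units of `2π`) of the disk over the tree. Over each edge it is the strip
`(t, σ) ↦ (γ t, y(γ t) + σ w(γ t))`, `0 ≤ σ ≤ 1`, between the two lifted sections, `w` being their
difference; the pullback of the symplectic form `∑ g_ij dxⁱ ∧ dyʲ` to this strip is
`g(γ', w) dt ∧ dσ`. -/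
def area (γ : GradientTree V₁₂ V₂₃ V₁₃) : ℝ :=
  (∫ t in Iic (0 : ℝ),
      baseMetric (γ.γ₁₂ t) (deriv γ.γ₁₂ t) (gradField D₁ D₂ γ.v₁₂ (γ.γ₁₂ t)))
    + (∫ t in Iic (0 : ℝ),
      baseMetric (γ.γ₂₃ t) (deriv γ.γ₂₃ t) (gradField D₂ D₃ γ.v₂₃ (γ.γ₂₃ t)))
    + ∫ t in Ici (0 : ℝ),
      baseMetric (γ.γ₁₃ t) (deriv γ.γ₁₃ t) (gradField D₁ D₃ γ.v₁₃ (γ.γ₁₃ t))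

end GradientTree

/-- The number of homotopy classes of gradient trees, weighted by `exp (-area)`. The area is the
same for all trees of a class. -/
def treeCount {D₁ D₂ D₃ : ℤ × ℤ} (V₁₂ : MoGen D₁ D₂) (V₂₃ : MoGen D₂ D₃) (V₁₃ : MoGen D₁ D₃) : ℝ :=
  ∑ᶠ C : Quot (GradientTree.Homotopic (V₁₂ := V₁₂) (V₂₃ := V₂₃) (V₁₃ := V₁₃)),
    Real.exp (-C.out.area)

/-- The composition, the bilinear extension of
`(V₁₂, V₂₃) ↦ ∑_{|V₁₃| = |V₁₂| + |V₂₃|} ∑_[γ] exp (-A(γ)) V₁₃`. -/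
def moComp {D₁ D₂ D₃ : ℤ × ℤ} (f : MoHom D₁ D₂) (g : MoHom D₂ D₃) : MoHom D₁ D₃ :=
  f.sum fun V₁₂ a => g.sum fun V₂₃ b =>
    ∑ᶠ (V₁₃ : MoGen D₁ D₃) (_ : V₁₃.dim = V₁₂.dim + V₂₃.dim),
      Finsupp.single V₁₃ (a * b * (treeCount V₁₂ V₂₃ V₁₃ : ℂ))

/-- The operations of the Morse homotopy category on a collection of sections for which it is
minimal and has morphisms in degree zero only: `m₂` counts gradient trees, and the other `m_k`, being
of degree `2 - k`, are zero. -/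
def moOp {ι : Type} (E : ι → ℤ × ℤ) :
    {x y : ι} → Chain (fun x y => MoHom (E x) (E y)) x y → MoHom (E x) (E y)
  | _, _, .nil _ => 0
  | _, _, .cons _ (.nil _) => 0
  | _, _, .cons f (.cons g (.nil _)) => moComp f g
  | _, _, .cons _ (.cons _ (.cons _ _)) => 0

/-- The full subcategory of the Morse homotopy category of the polytope on the Lagrangian sections
`L(E x)`, `x : ι`. -/
def MoCat {ι : Type} (E : ι → ℤ × ℤ) : AInfData ι where
  Hom x y := MoHom (E x) (E y)
  addCommGroup _ _ := inferInstance
  module _ _ := inferInstance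
  deg x y := moDeg (E x) (E y)
  m := moOp E

end HMS

end

noncomputable section

namespace HMS

/-! ### DG categories as A∞-categories -/

namespace Chain

variable {Obj : Type} {H : Obj → Obj → Type}

/-! Both categories are DG categories, so `IsDG.isAInfCategory` reduces the A∞ axioms to d² = 0, the
Leibniz rule, associativity and units. The only differences δ = (a, b) that occur are the
`Effective` ones, those with b = -1, and (-1, 0) (`isStrongCollection_collection`).

Morse side. The coordinates k = x¹ / (4 - x²), l = x² / 2 turn the polytope into the unit square.
For an intersection component where the sections differ by (i, j), put m = a + b - j; the vector
field becomes l' = (b l - j) / 2, k' = (m k - i) / (4 - 2 l), two linear equations up to a time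
change. If δ is effective, every generator has b, m ≥ 0. The flow is then expanding, stable
manifolds are points (`stableManifold_eq`), and the generators sit in degree 0 and correspond to the
pairs 0 ≤ j ≤ b, 0 ≤ i ≤ m. If δ is not effective, each intersection point lies on a side of the
polytope and its stable manifold sticks out there, so there are no generators (`MoGen.isEmpty`).

The root edge of a gradient tree is therefore constant and the tree is determined by its end. The
lifting condition forces the values (i, j) to add up, and the possible ends are given by linear
equations in (k, l), so there is exactly one homotopy class (`GradientTree.homotopic`). The field on
a leaf is the gradient of -log (k^i (1-k)^(m-i) l^j (1-l)^(b-j)) / 2, so the area of the leaf is a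
difference of potentials. Potentials are additive in the exponents, whence exp (-A) = w₁₃ / (w₁₂
w₂₃), with w the `weight` of a generator. Sending a generator to w⁻¹ u^i v^j thus turns tree
counting into multiplication of monomials (`moMap_moComp`). This map is injective, so associativity
and units on the Morse side are inherited from the DG side.

Dolbeault side. The closed forms of degree 0 must be the span of the monomials, and the higher
cohomology must vanish. Both follow from the projection of 𝔽₁ to ℂP¹ with fibre coordinate v. The
∂̄-equation along the fibres is solved by Cauchy transforms depending smoothly on the base point
(`exists_dbar_eq`), and normalizing the solutions at v = 0 and v = ∞ makes them unique, so that they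
glue (`exists_fibre_solution`). This settles degree 2 and removes the dv̄-component in degree 1.
What is left is holomorphic on fibres, hence by Liouville a polynomial in v whose coefficients are
forms with values in 𝒪(a + b - j) on ℂP¹. These degrees are at least -1, so the equation is solvable
on the base as well. Liouville in both directions computes degree 0. -/

lemma length_append {x y z : Obj} (p : Chain H x y) (q : Chain H y z) :
    (p.append q).length = p.length + q.length := by
  induction p with
  | nil x => simp [append, length]
  | cons f p ih => simp only [append, length, ih]; omega

lemma sumSplit_eq_zero {M : Type} [AddCommMonoid M] {x z : Obj} (p : Chain H x z)
    (F : ∀ y, Chain H x y → Chain H y z → M)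
    (hF : ∀ y q r, q.length + r.length = p.length → F y q r = 0) : p.sumSplit F = 0 := by
  induction p with
  | nil x => exact hF _ _ _ rfl
  | cons f p ih =>
    simp only [sumSplit]
    rw [hF _ _ _ (by simp [length]), zero_add]
    refine ih _ fun y q r h => hF _ _ _ ?_
    simp only [length]; omega

end Chain

namespace AInfData

variable {Obj : Type}

/-- `A` is a DG category: its only operations are a differential and an associative composition,
subject to the Leibniz rule. -/
structure IsDG (A : AInfData Obj) : Prop where
  grading : ∀ x y, DirectSum.IsInternal (A.deg x y)
  m_nil : ∀ x, A.m (.nil x) = 0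
  m_three : ∀ {x y z w v} (f : A.Hom x y) (g : A.Hom y z) (h : A.Hom z w) (p : Chain A.Hom w v),
    A.m (.cons f (.cons g (.cons h p))) = 0
  d_add : ∀ {x y} (f g : A.Hom x y), A.m₁ (f + g) = A.m₁ f + A.m₁ g
  d_smul : ∀ {x y} (c : ℂ) (f : A.Hom x y), A.m₁ (c • f) = c • A.m₁ f
  add_comp : ∀ {x y z} (f g : A.Hom x y) (h : A.Hom y z),
    A.m₂ (f + g) h = A.m₂ f h + A.m₂ g h
  smul_comp : ∀ {x y z} (c : ℂ) (f : A.Hom x y) (h : A.Hom y z),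
    A.m₂ (c • f) h = c • A.m₂ f h
  comp_add : ∀ {x y z} (f : A.Hom x y) (g h : A.Hom y z),
    A.m₂ f (g + h) = A.m₂ f g + A.m₂ f h
  comp_smul : ∀ {x y z} (c : ℂ) (f : A.Hom x y) (h : A.Hom y z),
    A.m₂ f (c • h) = c • A.m₂ f h
  d_deg : ∀ {x y} (r : ℤ) (f : A.Hom x y), f ∈ A.deg x y r → A.m₁ f ∈ A.deg x y (r + 1)
  comp_deg : ∀ {x y z} (r s : ℤ) (f : A.Hom x y) (g : A.Hom y z), f ∈ A.deg x y r →
    g ∈ A.deg y z s → A.m₂ f g ∈ A.deg x z (r + s)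
  d_d : ∀ {x y} (f : A.Hom x y), A.m₁ (A.m₁ f) = 0
  leibniz : ∀ {x y z} (r : ℤ) (f : A.Hom x y) (g : A.Hom y z), f ∈ A.deg x y r →
    A.m₁ (A.m₂ f g) = A.m₂ (A.m₁ f) g + (-1 : ℂ) ^ r • A.m₂ f (A.m₁ g)
  assoc : ∀ {x y z w} (f : A.Hom x y) (g : A.Hom y z) (h : A.Hom z w),
    A.m₂ (A.m₂ f g) h = A.m₂ f (A.m₂ g h)
  unit : ∀ x, ∃ e : A.Hom x x, e ∈ A.deg x x 0 ∧ A.m₁ e = 0 ∧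
    (∀ y (f : A.Hom x y), A.m₂ e f = f) ∧ ∀ y (f : A.Hom y x), A.m₂ f e = f

namespace IsDG

variable {A : AInfData Obj}

lemma m_eq_zero_of_length (hA : A.IsDG) {x y : Obj} (p : Chain A.Hom x y) (hp : 3 ≤ p.length) :
    A.m p = 0 := by
  cases p with
  | nil => simp [Chain.length] at hp
  | cons f p => cases p with
    | nil => simp [Chain.length] at hp
    | cons g p => cases p with
      | nil => simp [Chain.length] at hp
      | cons h p => exact hA.m_three f g h p

lemma m_add (hA : A.IsDG) {x y z w : Obj} (p : Chain A.Hom x y) (f g : A.Hom y z)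
    (q : Chain A.Hom z w) :
    A.m (p.append (.cons (f + g) q)) = A.m (p.append (.cons f q)) + A.m (p.append (.cons g q)) := by
  by_cases h : 2 ≤ p.length + q.length
  · rw [hA.m_eq_zero_of_length, hA.m_eq_zero_of_length, hA.m_eq_zero_of_length, add_zero] <;>
      rw [Chain.length_append] <;> simp only [Chain.length] <;> omega
  · cases p with
    | nil => cases q with
      | nil => exact hA.d_add f g
      | cons k q => cases q with
        | nil => exact hA.add_comp f g k
        | cons => simp [Chain.length] at h
    | cons k p => cases p with
      | nil => cases q with
        | nil => exact hA.comp_add k f g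
        | cons => simp only [Chain.length] at h; omega
      | cons => simp only [Chain.length] at h; omega

lemma m_smul (hA : A.IsDG) {x y z w : Obj} (p : Chain A.Hom x y) (c : ℂ) (f : A.Hom y z)
    (q : Chain A.Hom z w) :
    A.m (p.append (.cons (c • f) q)) = c • A.m (p.append (.cons f q)) := by
  by_cases h : 2 ≤ p.length + q.length
  · rw [hA.m_eq_zero_of_length, hA.m_eq_zero_of_length, smul_zero] <;>
      rw [Chain.length_append] <;> simp only [Chain.length] <;> omega
  · cases p with
    | nil => cases q with
      | nil => exact hA.d_smul c f
      | cons k q => cases q with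
        | nil => exact hA.smul_comp c f k
        | cons => simp [Chain.length] at h
    | cons k p => cases p with
      | nil => cases q with
        | nil => exact hA.comp_smul c k f
        | cons => simp only [Chain.length] at h; omega
      | cons => simp only [Chain.length] at h; omega

lemma m_zero (hA : A.IsDG) {x y z w : Obj} (p : Chain A.Hom x y) (q : Chain A.Hom z w) :
    A.m (p.append (.cons (0 : A.Hom y z) q)) = 0 := by
  simpa using hA.m_smul p 0 (0 : A.Hom y z) q

/-- The inner and the outer operation of each term together take at least five inputs, so one of
them takes at least three and vanishes. -/
lemma relation_of_length (hA : A.IsDG) {x y : Obj} (p : Chain A.Hom x y) (hp : 4 ≤ p.length)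
    (ds : List ℤ) :
    (p.sumSplit fun _ p₁ q => q.sumSplit fun _ p₂ p₃ =>
      (-1 : ℂ) ^ ((p₁.length : ℤ) + p₂.length * p₃.length
          + p₂.length * (ds.take p₁.length).sum) •
        A.m (p₁.append (.cons (A.m p₂) p₃))) = 0 := by
  refine Chain.sumSplit_eq_zero _ _ fun y p₁ q h₁ => Chain.sumSplit_eq_zero _ _ fun z p₂ p₃ h₂ => ?_
  by_cases h : 3 ≤ p₂.length
  · rw [hA.m_eq_zero_of_length p₂ h, hA.m_zero, smul_zero]
  · rw [hA.m_eq_zero_of_length (p₁.append _), smul_zero]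
    rw [Chain.length_append, Chain.length]
    omega

theorem isAInfCategory (hA : A.IsDG) : A.IsAInfCategory where
  grading := hA.grading
  m_nil := hA.m_nil
  m_add := hA.m_add
  m_smul := hA.m_smul
  m_deg := by
    intro x y p ds hp
    cases p with
    | nil => rw [hA.m_nil]; exact zero_mem _
    | cons f p =>
      rcases ds with _ | ⟨r, ds⟩
      · exact hp.elim
      obtain ⟨hf, hp⟩ := hp
      cases p with
      | nil =>
        rcases ds with _ | ⟨s, ds⟩
        · rw [show [r].sum + 2 - ([r].length : ℤ) = r + 1 by simp; ring]
          exact hA.d_deg r f hf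
        · exact hp.elim
      | cons g p =>
        rcases ds with _ | ⟨s, ds⟩
        · exact hp.elim
        obtain ⟨hg, hp⟩ := hp
        cases p with
        | nil =>
          rcases ds with _ | ⟨t, ds⟩
          · rw [show [r, s].sum + 2 - ([r, s].length : ℤ) = r + s by simp]
            exact hA.comp_deg r s f g hf hg
          · exact hp.elim
        | cons h p => rw [hA.m_three]; exact zero_mem _
  relation := by
    intro x y p ds hp
    -- Sequences of length 1, 2 and 3 yield d² = 0, the Leibniz rule and associativity. Splittings
    -- with an empty middle block insert m₀ = 0 as an entry, which is why the values of the
    -- operations at zero are needed.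
    have z₁ : ∀ {x y}, A.m₁ (0 : A.Hom x y) = 0 := fun {x y} => hA.m_zero (.nil x) (.nil y)
    have z₂ : ∀ {x y z} (g : A.Hom y z), A.m₂ (0 : A.Hom x y) g = 0 :=
      fun {x y z} g => hA.m_zero (.nil x) (.cons g (.nil z))
    have z₃ : ∀ {x y z} (g : A.Hom x y), A.m₂ g (0 : A.Hom y z) = 0 :=
      fun {x y z} g => hA.m_zero (.cons g (.nil y)) (.nil z)
    simp only [m₁] at z₁
    simp only [m₂] at z₂ z₃
    cases p with
    | nil => simp [Chain.sumSplit, Chain.append, hA.m_nil, z₁]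
    | cons f p =>
      rcases ds with _ | ⟨r, ds⟩
      · exact hp.elim
      obtain ⟨hf, hp⟩ := hp
      cases p with
      | nil =>
        have := hA.d_d f
        simp only [m₁] at this
        simp [Chain.sumSplit, Chain.append, hA.m_nil, z₂, z₃, this]
      | cons g p =>
        rcases ds with _ | ⟨s, ds⟩
        · exact hp.elim
        obtain ⟨hg, hp⟩ := hp
        cases p with
        | nil =>
          have := hA.leibniz r f g hf
          simp only [m₁, m₂] at this
          simp [Chain.sumSplit, Chain.append, hA.m_nil, hA.m_three, Chain.length, this,
            zpow_add₀]
        | cons h p =>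
          rcases ds with _ | ⟨s, ds⟩
          · exact hp.elim
          obtain ⟨hh, hp⟩ := hp
          cases p with
          | nil =>
            have := hA.assoc f g h
            simp only [m₂] at this
            simp [Chain.sumSplit, Chain.append, hA.m_nil, hA.m_three, Chain.length, this,
              zpow_add₀, z₁, zpow_mul, zpow_ofNat]
          | cons k p =>
            exact hA.relation_of_length _ (by simp only [Chain.length]; omega) _
  unit := by
    intro x
    obtain ⟨e, h₀, h₁, h₂, h₃⟩ := hA.unit x
    refine ⟨e, h₀, h₁, fun f => h₂ _ f, fun f => h₃ _ f, fun p q h => ?_⟩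
    apply hA.m_eq_zero_of_length
    rw [Chain.length_append, Chain.length]
    omega

end IsDG

end AInfData

/-! ### The Dolbeault DG category -/

section Dolbeault

variable {f g : ℂ × ℂ → ℂ} {w w' : ℂ × ℂ}

lemma dbarDir_fun_mul (hf : ContDiff ℝ ∞ f) (hg : ContDiff ℝ ∞ g) :
    dbarDir w (f * g) = f * dbarDir w g + dbarDir w f * g :=
  funext fun p => dbarDir_mul w (hf.differentiable (by simp) p) (hg.differentiable (by simp) p)

lemma dbarDir_fun_add (hf : ContDiff ℝ ∞ f) (hg : ContDiff ℝ ∞ g) :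
    dbarDir w (f + g) = dbarDir w f + dbarDir w g :=
  funext fun p => dbarDir_add w (hf.differentiable (by simp) p) (hg.differentiable (by simp) p)

lemma dbarDir_fun_smul (c : ℂ) (hf : ContDiff ℝ ∞ f) :
    dbarDir w (c • f) = c • dbarDir w f := by
  funext p
  simp only [dbarDir, fderiv_const_smul (hf.differentiable (by simp) p) c,
    _root_.smul_apply, Pi.smul_apply, smul_eq_mul]
  ring

lemma dbarDir_fun_sub (hf : ContDiff ℝ ∞ f) (hg : ContDiff ℝ ∞ g) :
    dbarDir w (f - g) = dbarDir w f - dbarDir w g := by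
  have h := dbarDir_fun_add (w := w) hf (hg.const_smul (-1 : ℂ))
  have h' := dbarDir_fun_smul (w := w) (-1 : ℂ) hg
  have e : (fun x => (-1 : ℂ) • g x) = (-1 : ℂ) • g := rfl
  rw [e, h'] at h
  simpa [sub_eq_add_neg] using h

@[simp] lemma dbarDir_zero : dbarDir w (0 : ℂ × ℂ → ℂ) = 0 := by
  funext p
  have : (0 : ℂ × ℂ → ℂ) = fun _ => 0 := rfl
  simp [dbarDir, this]

lemma fderiv_dbarDir (hf : ContDiff ℝ ∞ f) (p z : ℂ × ℂ) :
    fderiv ℝ (dbarDir w f) p z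
      = (fderiv ℝ (fderiv ℝ f) p z w + I * fderiv ℝ (fderiv ℝ f) p z (I • w)) / 2 := by
  have h : ContDiff ℝ ∞ (fderiv ℝ f) := hf.fderiv_right (by simp)
  have hd := (h.differentiable (by simp) p).hasFDerivAt
  have h1 : ∀ w, HasFDerivAt (fun q => fderiv ℝ f q w)
      ((fderiv ℝ (fderiv ℝ f) p).flip w) p := fun w => by
    simpa using hd.clm_apply (hasFDerivAt_const w p)
  have h2 := (((h1 w).add ((h1 (I • w)).const_mul I)).mul_const ((2 : ℂ)⁻¹))
  have h3 : HasFDerivAt (dbarDir w f) _ p := h2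
  rw [h3.fderiv]
  simp
  ring

/-- Symmetry of the second real derivative. -/
lemma dbarDir_comm (hf : ContDiff ℝ ∞ f) :
    dbarDir w (dbarDir w' f) = dbarDir w' (dbarDir w f) := by
  funext p
  have hs : ∀ a b, fderiv ℝ (fderiv ℝ f) p a b = fderiv ℝ (fderiv ℝ f) p b a := fun a b =>
    (hf.contDiffAt.isSymmSndFDerivAt (by simpa using WithTop.coe_le_coe.2 (le_top : (2 : ℕ∞) ≤ ⊤))) a b
  rw [dbarDir, dbarDir]
  simp only [fderiv_dbarDir hf]
  rw [hs w w', hs w (I • w'), hs (I • w) w', hs (I • w) (I • w')]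
  ring

end Dolbeault

namespace LocalForm

/-- All components are smooth. -/
def Smooth (ψ : LocalForm) : Prop := ∀ k, ContDiff ℝ ∞ (ψ k)

/-- The grading involution, `(-1)^r` on forms of degree `r`. -/
def sign (ψ : LocalForm) : LocalForm
  | .one => ψ .one
  | .du => -ψ .du
  | .dv => -ψ .dv
  | .dudv => ψ .dudv

variable {ψ χ : LocalForm}

lemma dbar_add (hψ : ψ.Smooth) (hχ : χ.Smooth) : (ψ + χ).dbar = ψ.dbar + χ.dbar := by
  funext k
  cases k <;> simp only [dbar, Pi.add_apply, dbarDir_fun_add (hψ _) (hχ _), add_zero]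
  abel

lemma dbar_smul (c : ℂ) (hψ : ψ.Smooth) : (c • ψ).dbar = c • ψ.dbar := by
  funext k
  cases k <;> simp only [dbar, Pi.smul_apply, dbarDir_fun_smul c (hψ _), smul_zero, smul_sub]

lemma dbar_dbar (hψ : ψ.Smooth) : ψ.dbar.dbar = 0 := by
  funext k
  cases k <;> simp only [dbar, dbarDir_zero, Pi.zero_apply]
  rw [dbarDir_comm (hψ _), sub_self]

/-- The graded Leibniz rule. Carrying the sign by the involution `sign` avoids splitting into
homogeneous parts. -/
lemma dbar_wedge (hψ : ψ.Smooth) (hχ : χ.Smooth) :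
    (ψ.wedge χ).dbar = ψ.dbar.wedge χ + ψ.sign.wedge χ.dbar := by
  have hm : ∀ k l, ContDiff ℝ ∞ (ψ k * χ l) := fun k l => (hψ k).mul (hχ l)
  funext k
  cases k <;> simp only [dbar, wedge, sign, Pi.add_apply, dbarDir_fun_mul (hψ _) (hχ _),
    dbarDir_fun_add (hm _ _) (hm _ _)] <;> ring

lemma wedge_assoc (ψ χ η : LocalForm) : (ψ.wedge χ).wedge η = ψ.wedge (χ.wedge η) := by
  funext k
  cases k <;> simp only [wedge] <;> ring

end LocalForm

/-! ### The grading by form degree and the DG axioms -/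

/-- The part of form degree `r`. -/
def formPart {D : ℤ × ℤ} (r : ℤ) (ψ : DGHom D) : DGHom D :=
  ⟨fun i k => if k.degree = r then ψ.1 i k else 0, by
    obtain ⟨h1, h2⟩ := ψ.2
    refine ⟨fun i k => ?_, fun i k p hp => ?_⟩
    · by_cases h : k.degree = r
      · simpa [h] using h1 i k
      · simp only [if_neg h]; exact (contDiff_const : ContDiff ℝ ∞ fun _ : ℂ × ℂ => (0 : ℂ))
    · have := h2 i k p hp
      by_cases h : k.degree = r
      · subst h
        cases k <;> simpa [LocalForm.pullback, Comp.degree] using this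
      · cases k
        · simp [LocalForm.pullback, h]
        · simp [LocalForm.pullback, show ¬Comp.du.degree = r from h,
            show ¬Comp.dv.degree = r from h]
        · simp [LocalForm.pullback, show ¬Comp.du.degree = r from h,
            show ¬Comp.dv.degree = r from h]
        · simp [LocalForm.pullback, h]⟩

lemma formPart_mem {D : ℤ × ℤ} (r : ℤ) (ψ : DGHom D) : formPart r ψ ∈ dgDeg D r :=
  fun _ _ hk => if_neg hk

lemma formPart_sum {D : ℤ × ℤ} (ψ : DGHom D) :
    formPart 0 ψ + formPart 1 ψ + formPart 2 ψ = ψ := by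
  ext i k p
  change (formPart 0 ψ).1 i k p + (formPart 1 ψ).1 i k p + (formPart 2 ψ).1 i k p = ψ.1 i k p
  cases k <;> simp [formPart, Comp.degree]

/-- A component of a form sees only the summand of its own degree, which gives injectivity; the
parts of degree 0, 1 and 2 already exhaust a form. -/
lemma dgDeg_isInternal (D : ℤ × ℤ) : DirectSum.IsInternal (dgDeg D) := by
  classical
  constructor
  · intro x y hxy
    have key : ∀ (x : DirectSum ℤ fun r => dgDeg D r) i k,
        (DirectSum.coeAddMonoidHom (dgDeg D) x).1 i k = (x k.degree).1.1 i k := by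
      intro x i k
      induction x using DirectSum.induction_on with
      | zero => simp
      | of r y =>
        rw [DirectSum.coeAddMonoidHom_of]
        by_cases h : r = k.degree
        · subst h; rw [DirectSum.of_eq_same]
        · rw [DirectSum.of_eq_of_ne _ _ _ (Ne.symm h)]
          exact y.2 i k (Ne.symm h)
      | add x y hx hy =>
        rw [map_add, DirectSum.add_apply]
        exact congrArg₂ (· + ·) hx hy
    ext r i k p
    by_cases h : k.degree = r
    · subst h
      rw [← key x i k, ← key y i k, hxy]
    · rw [(x r).2 i k h, (y r).2 i k h]
  · intro ψ
    refine ⟨DirectSum.of _ 0 ⟨_, formPart_mem 0 ψ⟩ + DirectSum.of _ 1 ⟨_, formPart_mem 1 ψ⟩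
      + DirectSum.of _ 2 ⟨_, formPart_mem 2 ψ⟩, ?_⟩
    simp only [map_add, DirectSum.coeAddMonoidHom_of]
    exact formPart_sum ψ

lemma DGHom.smooth {D : ℤ × ℤ} (ψ : DGHom D) (i : Chart) : (ψ.1 i).Smooth := fun k => ψ.2.1 i k

lemma dgDiff_apply {D : ℤ × ℤ} (ψ : DGHom D) (i : Chart) :
    (dgDiff ψ).1 i = (2 : ℂ) • (ψ.1 i).dbar := rfl

lemma dgComp_apply {D₁ D₂ D₃ : ℤ × ℤ} (ψ : DGHom (D₂ - D₁)) (χ : DGHom (D₃ - D₂)) (i : Chart) :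
    (dgComp ψ χ).1 i = (ψ.1 i).wedge (χ.1 i) := rfl

lemma DGHom.ext_chart {D : ℤ × ℤ} {ψ χ : DGHom D} (h : ∀ i, ψ.1 i = χ.1 i) : ψ = χ :=
  Subtype.ext (funext h)

lemma DGHom.add_apply {D : ℤ × ℤ} (ψ χ : DGHom D) (i : Chart) : (ψ + χ).1 i = ψ.1 i + χ.1 i := rfl

lemma DGHom.smul_apply {D : ℤ × ℤ} (c : ℂ) (ψ : DGHom D) (i : Chart) :
    (c • ψ).1 i = c • ψ.1 i := rfl

/-- The constant section `1` of the trivial line bundle. -/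
def dgOne {D : ℤ × ℤ} (hD : D = 0) : DGHom D :=
  ⟨fun _ k => match k with
    | .one => 1
    | _ => 0, by
    subst hD
    refine ⟨fun i k => ?_, fun i k p hp => ?_⟩
    · cases k <;> exact contDiff_const
    · cases k <;> cases i <;> simp [LocalForm.pullback, Chart.trans]⟩

lemma LocalForm.sign_of_mem {D : ℤ × ℤ} {r : ℤ} {ψ : DGHom D} (h : ψ ∈ dgDeg D r) (i : Chart) :
    (ψ.1 i).sign = (-1 : ℂ) ^ r • ψ.1 i := by
  funext k
  by_cases hk : k.degree = r
  · subst hk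
    cases k <;> simp [LocalForm.sign, Comp.degree]
  · have := h i k hk
    cases k <;> simp [LocalForm.sign, this]

lemma dgDiff_mem {D : ℤ × ℤ} {r : ℤ} {ψ : DGHom D} (h : ψ ∈ dgDeg D r) :
    dgDiff ψ ∈ dgDeg D (r + 1) := by
  intro i k hk
  rw [dgDiff_apply, Pi.smul_apply]
  cases k
  · simp [LocalForm.dbar]
  · rw [LocalForm.dbar, h i .one (by simp only [Comp.degree] at hk ⊢; omega), dbarDir_zero,
      smul_zero]
  · rw [LocalForm.dbar, h i .one (by simp only [Comp.degree] at hk ⊢; omega), dbarDir_zero,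
      smul_zero]
  · rw [LocalForm.dbar, h i .du (by simp only [Comp.degree] at hk ⊢; omega),
      h i .dv (by simp only [Comp.degree] at hk ⊢; omega), dbarDir_zero, dbarDir_zero,
      sub_self, smul_zero]

lemma dgComp_mem {D₁ D₂ D₃ : ℤ × ℤ} {r s : ℤ} {ψ : DGHom (D₂ - D₁)} {χ : DGHom (D₃ - D₂)}
    (hψ : ψ ∈ dgDeg _ r) (hχ : χ ∈ dgDeg _ s) : dgComp ψ χ ∈ dgDeg (D₃ - D₁) (r + s) := by
  intro i k hk
  have key : ∀ a b : Comp, a.degree + b.degree = k.degree → ψ.1 i a * χ.1 i b = 0 := by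
    intro a b hab
    by_cases ha : a.degree = r
    · rw [hχ i b (by omega), mul_zero]
    · rw [hψ i a ha, zero_mul]
  rw [dgComp_apply]
  cases k <;> simp only [LocalForm.wedge]
  · exact key _ _ rfl
  · rw [key _ _ rfl, key _ _ rfl, add_zero]
  · rw [key _ _ rfl, key _ _ rfl, add_zero]
  · rw [key _ _ rfl, key _ _ rfl, key _ _ rfl, key _ _ rfl]; simp

theorem DGCat_isDG {ι : Type} (E : ι → ℤ × ℤ) : (DGCat E).IsDG where
  grading x y := dgDeg_isInternal _
  m_nil _ := rfl
  m_three _ _ _ _ := rfl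
  d_add f g := DGHom.ext_chart fun i => by
    change (2 : ℂ) • (f.1 i + g.1 i).dbar = (2 : ℂ) • (f.1 i).dbar + (2 : ℂ) • (g.1 i).dbar
    rw [LocalForm.dbar_add (DGHom.smooth f i) (DGHom.smooth g i), smul_add]
  d_smul c f := DGHom.ext_chart fun i => by
    change (2 : ℂ) • (c • f.1 i).dbar = c • (2 : ℂ) • (f.1 i).dbar
    rw [LocalForm.dbar_smul c (DGHom.smooth f i), smul_comm]
  add_comp f g h := DGHom.ext_chart fun i => by
    change (f.1 i + g.1 i).wedge (h.1 i) = (f.1 i).wedge (h.1 i) + (g.1 i).wedge (h.1 i)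
    funext k
    cases k <;> simp only [LocalForm.wedge, Pi.add_apply] <;> ring
  smul_comp c f h := DGHom.ext_chart fun i => by
    change (c • f.1 i).wedge (h.1 i) = c • (f.1 i).wedge (h.1 i)
    funext k p
    cases k <;> simp [LocalForm.wedge] <;> ring
  comp_add f g h := DGHom.ext_chart fun i => by
    change (f.1 i).wedge (g.1 i + h.1 i) = (f.1 i).wedge (g.1 i) + (f.1 i).wedge (h.1 i)
    funext k
    cases k <;> simp only [LocalForm.wedge, Pi.add_apply] <;> ring
  comp_smul c f h := DGHom.ext_chart fun i => by
    change (f.1 i).wedge (c • h.1 i) = c • (f.1 i).wedge (h.1 i)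
    funext k p
    cases k <;> simp [LocalForm.wedge] <;> ring
  d_deg _ _ h := dgDiff_mem h
  comp_deg _ _ _ _ h h' := dgComp_mem h h'
  d_d f := DGHom.ext_chart fun i => by
    change (2 : ℂ) • ((2 : ℂ) • (f.1 i).dbar).dbar = 0
    have hs : (f.1 i).dbar.Smooth := DGHom.smooth ⟨_, dbar_mem f.2⟩ i
    rw [LocalForm.dbar_smul _ hs, LocalForm.dbar_dbar (DGHom.smooth f i), smul_zero, smul_zero]
  leibniz r f g hf := DGHom.ext_chart fun i => by
    change (2 : ℂ) • ((f.1 i).wedge (g.1 i)).dbar = ((2 : ℂ) • (f.1 i).dbar).wedge (g.1 i)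
      + (-1 : ℂ) ^ r • (f.1 i).wedge ((2 : ℂ) • (g.1 i).dbar)
    rw [LocalForm.dbar_wedge (DGHom.smooth f i) (DGHom.smooth g i), LocalForm.sign_of_mem hf]
    funext k p
    cases k <;> simp [LocalForm.wedge] <;> ring
  assoc f g h := DGHom.ext_chart fun i => LocalForm.wedge_assoc _ _ _
  unit x := by
    refine ⟨dgOne (sub_self _), ?_, ?_, fun y f => ?_, fun y f => ?_⟩
    · intro i k hk
      cases k <;> first | rfl | exact (hk rfl).elim
    · refine DGHom.ext_chart fun i => ?_
      change (2 : ℂ) • ((dgOne (sub_self (E x))).1 i).dbar = 0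
      have e : ∀ w, dbarDir w (1 : ℂ × ℂ → ℂ) = 0 := fun w => funext fun p =>
        dbarDir_holo w (differentiableAt_const (1 : ℂ))
      funext k
      cases k <;> simp [LocalForm.dbar, dgOne, e]
    · refine DGHom.ext_chart fun i => ?_
      change ((dgOne (sub_self (E x))).1 i).wedge (f.1 i) = f.1 i
      funext k
      cases k <;> simp [LocalForm.wedge, dgOne]
    · refine DGHom.ext_chart fun i => ?_
      change (f.1 i).wedge ((dgOne (sub_self (E x))).1 i) = f.1 i
      funext k
      cases k <;> simp [LocalForm.wedge, dgOne]

/-! ### The Cauchy transform -/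

/-- The antiholomorphic derivative of a function of one complex variable. -/
def dbarOne (h : ℂ → ℂ) (z : ℂ) : ℂ := (fderiv ℝ h z 1 + I * fderiv ℝ h z I) / 2

/-- The left side is twice the antilinear part of a real-linear map, hence `conj z` times its value
at 1. -/
lemma clm_conj_smul (L : ℂ →L[ℝ] ℂ) (z : ℂ) :
    L z + I * L (I * z) = conj z * (L 1 + I * L I) := by
  have key : ∀ z : ℂ, L z = z.re * L 1 + z.im * L I := by
    intro z
    conv_lhs => rw [show z = z.re • (1 : ℂ) + z.im • I by
      apply Complex.ext <;> simp]
    rw [map_add, map_smul, map_smul]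
    simp
  rw [key z, key (I * z)]
  have : conj z = z.re - z.im * I := by apply Complex.ext <;> simp
  rw [this]
  simp
  linear_combination (z.im * L I) * I_mul_I

/-- The Jacobian of polar coordinates cancels the pole. -/
lemma locallyIntegrable_inv : LocallyIntegrable (fun z : ℂ => z⁻¹) := by
  intro x
  refine ⟨Metric.ball 0 (‖x‖ + 1), Metric.isOpen_ball.mem_nhds (by simp), ?_⟩
  have h : IntegrableOn (fun z : ℂ => ‖z‖⁻¹) (Metric.ball 0 (‖x‖ + 1)) := by
    rw [integrableOn_fun_norm_addHaar volume (f := fun y => y⁻¹)]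
    refine IntegrableOn.congr_fun (f := fun _ => (1 : ℝ)) ?_ ?_ measurableSet_Ioo
    · exact integrableOn_const (by simp)
    · intro y hy
      have : y ≠ 0 := hy.1.ne'
      simp [this]
  refine Integrable.mono' h ?_ ?_
  · exact (measurable_id.inv).aestronglyMeasurable
  · simp

section Cauchy

variable {h : ℂ → ℂ}

/-- The unit vector of argument `θ`. -/
def cis (θ : ℝ) : ℂ := Real.cos θ + Real.sin θ * I

lemma hasDerivAt_cis (θ : ℝ) : HasDerivAt cis (I * cis θ) θ := by
  have h1 := (Real.hasDerivAt_cos θ).ofReal_comp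
  have h2 := ((Real.hasDerivAt_sin θ).ofReal_comp).mul_const I
  refine (h1.add h2).congr_deriv ?_
  simp only [cis, ofReal_neg]
  linear_combination (-(Real.sin θ : ℂ)) * I_mul_I

lemma continuous_cis : Continuous cis := by
  unfold cis; fun_prop

lemma norm_cis (θ : ℝ) : ‖cis θ‖ = 1 := by
  have : cis θ = exp (θ * I) := by rw [cis, exp_mul_I]; simp
  rw [this, norm_exp_ofReal_mul_I]

lemma cis_ne_zero (θ : ℝ) : cis θ ≠ 0 := by
  rw [← norm_ne_zero_iff, norm_cis]; exact one_ne_zero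

lemma conj_cis (θ : ℝ) : conj (cis θ) = (cis θ)⁻¹ := by
  rw [Complex.inv_def, normSq_eq_norm_sq, norm_cis]; simp

lemma integrableOn_polar {F : ℝ × ℝ → ℂ} (hF : Continuous F) (R : ℝ)
    (hR : ∀ r θ, R < r → F (r, θ) = 0) :
    IntegrableOn F (Ioi 0 ×ˢ Ioo (-Real.pi) Real.pi) := by
  have h1 : IntegrableOn F (Icc 0 R ×ˢ Icc (-Real.pi) Real.pi) :=
    hF.continuousOn.integrableOn_compact (isCompact_Icc.prod isCompact_Icc)
  refine h1.of_forall_sdiff_eq_zero (measurableSet_Ioi.prod measurableSet_Ioo) ?_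
  rintro ⟨r, θ⟩ ⟨⟨h1, h2⟩, h3⟩
  apply hR
  by_contra h4
  exact h3 ⟨⟨le_of_lt h1, not_lt.1 h4⟩, Ioo_subset_Icc_self h2⟩

/-- The Cauchy–Pompeiu formula. In polar coordinates around v the kernel cancels the Jacobian up to
a phase, and this phase turns ∂̄ into half of a radial plus half of an angular derivative. The
radial part `A` integrates to `h v` on each ray. The angular part `B` is a θ-derivative of a
periodic function and integrates to zero. -/
theorem integral_inv_mul_dbarOne (hh : ContDiff ℝ ∞ h) (hc : HasCompactSupport h) (v : ℂ) :
    ∫ t : ℂ, t⁻¹ * dbarOne h (v - t) = Real.pi * h v := by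
  have hd : ∀ z, HasFDerivAt h (fderiv ℝ h z) z := fun z =>
    (hh.differentiable (by simp) z).hasFDerivAt
  have hcont : Continuous (fderiv ℝ h) := hh.continuous_fderiv (by simp)
  obtain ⟨R, hR⟩ := hc.isCompact.isBounded.exists_norm_le
  have hz : ∀ z, R < ‖z‖ → z ∉ tsupport h := fun z hz hz' => (hR z hz').not_gt hz
  have hnorm : ∀ r θ, ‖v‖ + |R| < r → R < ‖v - (r : ℂ) * cis θ‖ := by
    intro r θ hr
    have h1 : ‖(r : ℂ) * cis θ‖ = r := by
      rw [norm_mul, norm_cis, mul_one, norm_real, Real.norm_eq_abs, abs_of_pos]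
      linarith [norm_nonneg v, abs_nonneg R]
    have h2 := norm_sub_norm_le ((r : ℂ) * cis θ) v
    rw [norm_sub_rev, h1] at h2
    linarith [le_abs_self R]
  have hzero : ∀ r θ, ‖v‖ + |R| < r → fderiv ℝ h (v - (r : ℂ) * cis θ) = 0 := fun r θ hr =>
    image_eq_zero_of_notMem_tsupport fun hm =>
      hz _ (hnorm r θ hr) (tsupport_fderiv_subset ℝ hm)
  have hcis : Continuous fun p : ℝ × ℝ => cis p.2 := continuous_cis.comp continuous_snd
  have harg : Continuous fun p : ℝ × ℝ => v - (p.1 : ℂ) * cis p.2 := by fun_prop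
  set A : ℝ × ℝ → ℂ := fun p => fderiv ℝ h (v - (p.1 : ℂ) * cis p.2) (cis p.2) with hA
  set B : ℝ × ℝ → ℂ := fun p => fderiv ℝ h (v - (p.1 : ℂ) * cis p.2) (I * cis p.2) with hB
  have hAc : Continuous A := (hcont.comp harg).clm_apply hcis
  have hBc : Continuous B := (hcont.comp harg).clm_apply (continuous_const.mul hcis)
  have hAi := integrableOn_polar hAc (‖v‖ + |R|) fun r θ hr => by simp [hA, hzero r θ hr]
  have hBi := integrableOn_polar hBc (‖v‖ + |R|) fun r θ hr => by simp [hB, hzero r θ hr]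
  have e1 : ∫ t : ℂ, t⁻¹ * dbarOne h (v - t)
      = ∫ p in Ioi (0 : ℝ) ×ˢ Ioo (-Real.pi) Real.pi, (A p / 2 + I / 2 * B p) := by
    rw [← Complex.integral_comp_polarCoord_symm]
    refine setIntegral_congr_fun (measurableSet_Ioi.prod measurableSet_Ioo) ?_
    rintro ⟨r, θ⟩ ⟨hr, -⟩
    have hr0 : (r : ℂ) ≠ 0 := ofReal_ne_zero.2 (ne_of_gt hr)
    have hk := clm_conj_smul (fderiv ℝ h (v - (r : ℂ) * cis θ)) (cis θ)
    have hcz := cis_ne_zero θ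
    rw [conj_cis] at hk
    simp only [Complex.polarCoord_symm_apply, real_smul, hA, hB, dbarOne]
    change (r : ℂ) * (((r : ℂ) * cis θ)⁻¹ * _) = _
    rw [show ((Real.cos θ : ℂ) + Real.sin θ * I) = cis θ from rfl]
    have hk' : (fderiv ℝ h (v - (r : ℂ) * cis θ)) (cis θ) / 2
        + I / 2 * (fderiv ℝ h (v - (r : ℂ) * cis θ)) (I * cis θ)
        = (cis θ)⁻¹ * (fderiv ℝ h (v - (r : ℂ) * cis θ) 1
          + I * fderiv ℝ h (v - (r : ℂ) * cis θ) I) / 2 := by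
      rw [← hk]; ring
    rw [hk']
    field_simp
  have eA : ∫ p in Ioi (0 : ℝ) ×ˢ Ioo (-Real.pi) Real.pi, A p = 2 * Real.pi * h v := by
    rw [Measure.volume_eq_prod] at hAi ⊢
    rw [← setIntegral_prod_swap, setIntegral_prod]
    · have inner : ∀ θ : ℝ, ∫ r in Ioi (0 : ℝ), A (r, θ) = h v := by
        intro θ
        have hder : ∀ r : ℝ, HasDerivAt (fun r : ℝ => h (v - (r : ℂ) * cis θ)) (-A (r, θ)) r := by
          intro r
          have h1 : HasDerivAt (fun r : ℝ => v - (r : ℂ) * cis θ) (-cis θ) r := by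
            simpa using ((hasDerivAt_id r).ofReal_comp.mul_const (cis θ)).const_sub v
          have := (hd (v - (r : ℂ) * cis θ)).comp_hasDerivAt r h1
          exact this.congr_deriv (by simp [hA])
        have hi : IntegrableOn (fun r => -A (r, θ)) (Ioi (0 : ℝ)) := by
          have h1 : IntegrableOn (fun r => -A (r, θ)) (Icc 0 (‖v‖ + |R|)) :=
            ((hAc.comp (Continuous.prodMk_left θ)).neg).continuousOn.integrableOn_compact
              isCompact_Icc
          refine h1.of_forall_sdiff_eq_zero measurableSet_Ioi ?_
          rintro r ⟨h1, h3⟩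
          have : ‖v‖ + |R| < r := by
            by_contra h4
            exact h3 ⟨le_of_lt h1, not_lt.1 h4⟩
          simp [hA, hzero r θ this]
        have ht : Tendsto (fun r : ℝ => h (v - (r : ℂ) * cis θ)) atTop (𝓝 0) := by
          refine tendsto_const_nhds.congr' ?_
          filter_upwards [eventually_gt_atTop (‖v‖ + |R|)] with r hr
          exact (image_eq_zero_of_notMem_tsupport (hz _ (hnorm r θ hr))).symm
        have := integral_Ioi_of_hasDerivAt_of_tendsto' (fun r _ => hder r) hi ht
        rw [integral_neg] at this
        simpa using this
      simp only [Prod.swap_prod_mk, inner]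
      rw [setIntegral_const, measureReal_def, Real.volume_Ioo]
      rw [ENNReal.toReal_ofReal (by linarith [Real.pi_pos]), real_smul]
      push_cast
      ring
    · exact hAi.swap
  have eB : ∫ p in Ioi (0 : ℝ) ×ˢ Ioo (-Real.pi) Real.pi, B p = 0 := by
    rw [Measure.volume_eq_prod] at hBi ⊢
    rw [setIntegral_prod _ hBi]
    refine setIntegral_eq_zero_of_forall_eq_zero fun r hr => ?_
    have hr0 : (r : ℂ) ≠ 0 := ofReal_ne_zero.2 (ne_of_gt hr)
    rw [← integral_Ioc_eq_integral_Ioo, ← intervalIntegral.integral_of_le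
      (by linarith [Real.pi_pos])]
    have hder : ∀ θ : ℝ, HasDerivAt (fun θ : ℝ => -(r : ℂ)⁻¹ * h (v - (r : ℂ) * cis θ))
        (B (r, θ)) θ := by
      intro θ
      have h1 : HasDerivAt (fun θ : ℝ => v - (r : ℂ) * cis θ) (-r • (I * cis θ)) θ := by
        simpa using ((hasDerivAt_cis θ).const_mul (r : ℂ)).const_sub v
      have h2 := ((hd (v - (r : ℂ) * cis θ)).comp_hasDerivAt θ h1).const_mul (-(r : ℂ)⁻¹)
      refine h2.congr_deriv ?_
      rw [map_smul]
      simp [hB]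
      field_simp
    rw [intervalIntegral.integral_eq_sub_of_hasDerivAt (fun θ _ => hder θ)
      ((hBc.comp (Continuous.prodMk_right r)).intervalIntegrable _ _)]
    simp [cis]
  rw [e1, integral_add (hAi.div_const 2) (hBi.const_mul (I / 2)), integral_div,
    integral_const_mul, eA, eB]
  ring

end Cauchy

lemma dbarDir_snd {f : ℂ × ℂ → ℂ} {p v : ℂ} (hf : DifferentiableAt ℝ f (p, v)) :
    dbarDir (0, 1) f (p, v) = dbarOne (fun z => f (p, z)) v := by
  have h : HasFDerivAt (fun z => f (p, z)) _ v :=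
    hf.hasFDerivAt.comp v (hasFDerivAt_prodMk_right p v)
  simp [dbarDir, dbarOne, h.fderiv]

lemma dbarDir_fst {f : ℂ × ℂ → ℂ} {p v : ℂ} (hf : DifferentiableAt ℝ f (p, v)) :
    dbarDir (1, 0) f (p, v) = dbarOne (fun z => f (z, v)) p := by
  have h : HasFDerivAt (fun z => f (z, v)) _ p :=
    hf.hasFDerivAt.comp p (hasFDerivAt_prodMk_left p v)
  simp [dbarDir, dbarOne, h.fderiv]

section CauchyTransform

variable {f : ℂ × ℂ → ℂ}

/-- The Cauchy transform in the second variable. -/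
def cauchyTransform (f : ℂ × ℂ → ℂ) (q : ℂ × ℂ) : ℂ :=
  (Real.pi : ℂ)⁻¹ * ∫ t : ℂ, t⁻¹ * f (q.1, q.2 - t)

/-- Convolution with a merely locally integrable kernel keeps the smoothness of the compactly
supported factor, jointly with the parameter. -/
lemma contDiff_cauchyTransform (hf : ContDiff ℝ ∞ f) (hs : ∀ p x, 2 < ‖x‖ → f (p, x) = 0) :
    ContDiff ℝ ∞ (cauchyTransform f) := by
  have h := contDiffOn_convolution_right_with_param (n := ⊤) (μ := volume)
    (ContinuousLinearMap.mul ℝ ℂ)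
    (f := fun z : ℂ => z⁻¹) (g := fun p x => f (p, x)) (s := univ) (k := Metric.closedBall 0 2)
    isOpen_univ (isCompact_closedBall _ _) (fun p x _ hx => hs p x (by simpa using hx))
    locallyIntegrable_inv hf.contDiffOn
  rw [univ_prod_univ, contDiffOn_univ] at h
  exact contDiff_const.mul h

/-- The derivative of a convolution falls on the smooth factor, and the Cauchy–Pompeiu formula
evaluates the result. -/
lemma dbarDir_cauchyTransform (hf : ContDiff ℝ ∞ f) (hs : ∀ p x, 2 < ‖x‖ → f (p, x) = 0) :
    dbarDir (0, 1) (cauchyTransform f) = f := by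
  funext ⟨p, v⟩
  rw [dbarDir_snd ((contDiff_cauchyTransform hf hs).differentiable (by simp) _)]
  set h : ℂ → ℂ := fun x => f (p, x) with hh
  have hsm : ContDiff ℝ ∞ h := hf.comp (contDiff_prodMk_right p)
  have hc : HasCompactSupport h := HasCompactSupport.intro (isCompact_closedBall (0 : ℂ) 2)
    fun x hx => hs p x (by simpa using hx)
  have hder := (hc.hasFDerivAt_convolution_right (ContinuousLinearMap.mul ℝ ℂ)
    locallyIntegrable_inv (hsm.of_le (by simp)) v).const_mul (Real.pi : ℂ)⁻¹
  have hder' : HasFDerivAt (fun z => cauchyTransform f (p, z)) _ v := hder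
  have hcd : HasCompactSupport (fderiv ℝ h) := hc.fderiv ℝ
  have hcont : Continuous (fderiv ℝ h) := hsm.continuous_fderiv (by simp)
  have hcz : ∀ z, HasCompactSupport fun a => fderiv ℝ h a z := fun z => hc.fderiv_apply ℝ z
  have hi : ∀ z, Integrable fun t : ℂ => t⁻¹ * fderiv ℝ h (v - t) z := fun z =>
    (hcz z).convolutionExists_right (ContinuousLinearMap.mul ℝ ℂ) locallyIntegrable_inv
      (hcont.clm_apply continuous_const) v
  have hval : ∀ z, (MeasureTheory.convolution (fun z : ℂ => z⁻¹) (fderiv ℝ h)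
      ((ContinuousLinearMap.mul ℝ ℂ).precompR ℂ) volume v) z
      = ∫ t : ℂ, t⁻¹ * fderiv ℝ h (v - t) z := fun z =>
    convolution_precompR_apply _ locallyIntegrable_inv hcd hcont v z
  have key := integral_inv_mul_dbarOne hsm hc v
  simp only [dbarOne, hder'.fderiv, _root_.smul_apply, smul_eq_mul, hval]
  have e : ∫ t : ℂ, t⁻¹ * dbarOne h (v - t)
      = ((∫ t : ℂ, t⁻¹ * fderiv ℝ h (v - t) 1)
        + I * ∫ t : ℂ, t⁻¹ * fderiv ℝ h (v - t) I) / 2 := by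
    rw [← integral_const_mul, ← integral_add (hi 1) ((hi I).const_mul I), ← integral_div]
    congr 1
    funext t
    simp only [dbarOne]
    ring
  rw [e] at key
  have hpi : (Real.pi : ℂ) ≠ 0 := ofReal_ne_zero.2 Real.pi_ne_zero
  change _ = h v
  rw [← inv_mul_cancel_left₀ hpi (h v), ← key]
  ring

/-- The Cauchy transform times `v` in the coordinate `w = v⁻¹` at infinity. -/
def cauchyInfty (f : ℂ × ℂ → ℂ) (q : ℂ × ℂ) : ℂ :=
  if q.2 = 0 then (Real.pi : ℂ)⁻¹ * ∫ x : ℂ, f (q.1, x)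
  else q.2⁻¹ * cauchyTransform f (q.1, q.2⁻¹)

/-- The substitution x = w⁻¹ - t turns the two cases of the definition into one formula, in which w
= 0 is no longer special. -/
lemma cauchyInfty_eq (q : ℂ × ℂ) :
    cauchyInfty f q = (Real.pi : ℂ)⁻¹ * ∫ x : ℂ, f (q.1, x) * (1 - q.2 * x)⁻¹ := by
  obtain ⟨p, w⟩ := q
  by_cases hw : w = 0
  · simp [cauchyInfty, hw]
  · simp only [cauchyInfty, hw, if_false, cauchyTransform]
    rw [← integral_sub_left_eq_self (fun x => f (p, x) * (1 - w * x)⁻¹) volume w⁻¹,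
      mul_left_comm, ← integral_const_mul]
    congr 2
    funext t
    have : 1 - w * (w⁻¹ - t) = w * t := by field_simp; ring
    rw [this, mul_inv]
    ring

lemma contDiff_cauchyInfty (hf : ContDiff ℝ ∞ f) (hs : ∀ p x, 2 < ‖x‖ → f (p, x) = 0) :
    ContDiff ℝ ∞ (cauchyInfty f) := by
  rw [contDiff_iff_contDiffAt]
  rintro ⟨p, w⟩
  by_cases hw : w = 0
  · subst hw
    -- On the support of `f` one has |x| ≤ 2, so |w x| < 1/2 and the denominator 1 - w x stays away
    -- from zero.
    set s : Set (ℂ × ℂ) := univ ×ˢ Metric.ball 0 (1 / 4) with hsdef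
    have hso : IsOpen s := isOpen_univ.prod Metric.isOpen_ball
    have hg : ContDiffOn ℝ ∞
        (fun z : (ℂ × ℂ) × ℂ => f (z.1.1, z.2) * (1 - z.1.2 * z.2)⁻¹) (s ×ˢ univ) := by
      rintro ⟨⟨a, b⟩, x⟩ ⟨⟨-, hb⟩, -⟩
      have hb' : ‖b‖ < 1 / 4 := by simpa using hb
      apply ContDiffAt.contDiffWithinAt
      have hfx : ContDiffAt ℝ ∞ (fun z : (ℂ × ℂ) × ℂ => f (z.1.1, z.2)) ((a, b), x) :=
        (hf.comp ((contDiff_fst.comp contDiff_fst).prodMk contDiff_snd)).contDiffAt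
      by_cases hx : ‖x‖ ≤ 2
      · refine hfx.mul (ContDiffAt.inv ?_ ?_)
        · exact contDiffAt_const.sub
            ((contDiff_snd.comp contDiff_fst).contDiffAt.mul contDiff_snd.contDiffAt)
        · intro h0
          have : ‖b * x‖ = 1 := by rw [← sub_eq_zero.1 h0, norm_one]
          rw [norm_mul] at this
          nlinarith [norm_nonneg b, norm_nonneg x]
      · refine (contDiffAt_const (c := (0 : ℂ))).congr_of_eventuallyEq ?_
        have ho : IsOpen {z : (ℂ × ℂ) × ℂ | 2 < ‖z.2‖} :=
          isOpen_lt continuous_const continuous_snd.norm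
        filter_upwards [ho.mem_nhds (not_le.1 hx)] with z hz
        rw [hs _ _ hz, zero_mul]
    -- The integral is a convolution with the constant 1 evaluated at 0; this form gives access to
    -- smooth dependence on parameters.
    have h := contDiffOn_convolution_right_with_param_comp (n := ⊤) (μ := volume)
      (ContinuousLinearMap.mul ℝ ℂ) (s := s) (v := fun _ => (0 : ℂ)) contDiffOn_const
      (f := fun _ : ℂ => (1 : ℂ)) (g := fun q x => f (q.1, x) * (1 - q.2 * x)⁻¹)
      (k := Metric.closedBall 0 2) hso (isCompact_closedBall _ _)
      (fun q x _ hx => by rw [hs q.1 x (by simpa using hx), zero_mul])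
      (locallyIntegrable_const 1) hg
    have hmem : s ∈ 𝓝 (p, (0 : ℂ)) := hso.mem_nhds ⟨mem_univ _, by simp⟩
    refine (contDiffAt_const.mul (h.contDiffAt hmem)).congr_of_eventuallyEq
      (f := fun q => (Real.pi : ℂ)⁻¹ * _) (Eventually.of_forall fun q => ?_)
    rw [cauchyInfty_eq]
    congr 1
    rw [← integral_sub_left_eq_self (fun x => f (q.1, x) * (1 - q.2 * x)⁻¹) volume 0]
    simp [MeasureTheory.convolution]
  · have h1 : ContDiffAt ℝ ∞ (fun q : ℂ × ℂ => q.2⁻¹) (p, w) := contDiffAt_snd.inv hw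
    have h2 : ContDiffAt ℝ ∞ (fun q : ℂ × ℂ => q.2⁻¹ * cauchyTransform f (q.1, q.2⁻¹)) (p, w) :=
      h1.mul ((contDiff_cauchyTransform hf hs).contDiffAt.comp (p, w) (contDiffAt_fst.prodMk h1))
    refine h2.congr_of_eventuallyEq ?_
    have ho : IsOpen {q : ℂ × ℂ | q.2 ≠ 0} := isOpen_ne_fun continuous_snd continuous_const
    filter_upwards [ho.mem_nhds hw] with q hq
    exact if_neg hq

lemma cauchyInfty_inv {p v : ℂ} (hv : v ≠ 0) :
    cauchyInfty f (p, v⁻¹) = v * cauchyTransform f (p, v) := by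
  simp [cauchyInfty, hv]

end CauchyTransform

/-! ### The `∂̄`-equation on the projective line with parameters -/

/-- A radial cutoff function on `ℂ` with `cutoff z + cutoff z⁻¹ = 1`. -/
def cutoff (z : ℂ) : ℝ :=
  Real.smoothTransition (1 / 2 + 3 / 2 * ((1 - normSq z) / (1 + normSq z)))

lemma contDiff_cutoff : ContDiff ℝ ∞ cutoff := by
  have h : ContDiff ℝ ∞ (fun z : ℂ => normSq z) := by
    have : (fun z : ℂ => normSq z) = fun z => ‖z‖ ^ 2 := by funext z; rw [normSq_eq_norm_sq]
    rw [this]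
    exact contDiff_norm_sq ℝ
  refine Real.smoothTransition.contDiff.comp (contDiff_const.add (contDiff_const.mul
    ((contDiff_const.sub h).div (contDiff_const.add h) fun z => ?_)))
  have := normSq_nonneg z
  positivity

lemma cutoff_eq_zero {z : ℂ} (hz : 2 < ‖z‖) : cutoff z = 0 := by
  apply Real.smoothTransition.zero_of_nonpos
  have h : 4 < normSq z := by rw [normSq_eq_norm_sq]; nlinarith
  have h1 : (1 - normSq z) / (1 + normSq z) ≤ -1 / 3 := by
    rw [div_le_iff₀ (by linarith)]; linarith
  linarith

lemma smoothTransition_add (x : ℝ) :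
    Real.smoothTransition x + Real.smoothTransition (1 - x) = 1 := by
  have h := Real.smoothTransition.pos_denom x
  simp only [Real.smoothTransition, sub_sub_cancel]
  rw [add_comm (expNegInvGlue (1 - x)), ← add_div, div_self h.ne']

/-- The quotient (1 - |z|²) / (1 + |z|²) changes sign under inversion, so the argument of the
transition function is reflected at 1/2. -/
lemma cutoff_add_inv {z : ℂ} (hz : z ≠ 0) : cutoff z + cutoff z⁻¹ = 1 := by
  have h := normSq_pos.2 hz
  have e : 1 / 2 + 3 / 2 * ((1 - normSq z⁻¹) / (1 + normSq z⁻¹))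
      = 1 - (1 / 2 + 3 / 2 * ((1 - normSq z) / (1 + normSq z))) := by
    rw [map_inv₀]
    field_simp
    ring
  rw [cutoff, cutoff, e, smoothTransition_add]

lemma dense_torus : Dense torus := by
  have h : torus = {(0 : ℂ)}ᶜ ×ˢ {(0 : ℂ)}ᶜ := by
    ext p; simp [torus]
  rw [h]
  exact (dense_compl_singleton 0).prod (dense_compl_singleton 0)

lemma eq_of_eqOn_torus {f g : ℂ × ℂ → ℂ} (hf : Continuous f) (hg : Continuous g)
    (h : EqOn f g torus) : f = g := hf.ext_on dense_torus hg h

lemma dbarDir_inversion {a k : ℂ × ℂ → ℂ} (n : ℤ) (hk : ContDiff ℝ ∞ k)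
    (h : ∀ p v : ℂ, v ≠ 0 → a (p, v) = v ^ n * k (p, v⁻¹)) {p v : ℂ} (hv : v ≠ 0) :
    dbarDir (0, 1) a (p, v) = v ^ n * (conj (-(v ^ 2)⁻¹) * dbarDir (0, 1) k (p, v⁻¹)) := by
  have ho : IsOpen {q : ℂ × ℂ | q.2 ≠ 0} := isOpen_ne_fun continuous_snd continuous_const
  have hev : a =ᶠ[𝓝 (p, v)] fun q => q.2 ^ n * k (q.1, q.2⁻¹) := by
    filter_upwards [ho.mem_nhds hv] with q hq using h q.1 q.2 hq
  have hz : DifferentiableAt ℂ (fun q : ℂ × ℂ => q.2 ^ n) (p, v) :=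
    differentiableAt_snd.zpow (Or.inl hv)
  have hκ' : HasFDerivAt (fun q : ℂ × ℂ => (q.1, q.2⁻¹))
      ((ContinuousLinearMap.fst ℂ ℂ ℂ).prod
        ((-(v ^ 2)⁻¹) • ContinuousLinearMap.snd ℂ ℂ ℂ)) (p, v) := by
    refine hasFDerivAt_fst.prodMk ?_
    exact (hasDerivAt_inv hv).comp_hasFDerivAt (p, v) (f := fun q : ℂ × ℂ => q.2) hasFDerivAt_snd
  have hκ := hκ'.differentiableAt
  have hkd : DifferentiableAt ℝ k ((fun q : ℂ × ℂ => (q.1, q.2⁻¹)) (p, v)) :=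
    hk.differentiable (by simp) _
  have hkκ : DifferentiableAt ℝ (fun q : ℂ × ℂ => k (q.1, q.2⁻¹)) (p, v) :=
    hkd.comp (p, v) (hκ.restrictScalars ℝ)
  rw [dbarDir_congr _ hev, dbarDir_mul _ (hz.restrictScalars ℝ) hkκ, dbarDir_holo _ hz, zero_mul,
    add_zero, dbarDir_comp _ hkd hκ, hκ'.fderiv]
  simp

/-- The Cauchy transform decays like the inverse of the coordinate. In the trivialization of 𝒪(n) at
infinity it is therefore v ^ (n + 1) times a smooth function, without a pole because n ≥ -1. -/
lemma exists_dbar_extension {n : ℤ} (hn : -1 ≤ n) {F : ℂ × ℂ → ℂ} (hF : ContDiff ℝ ∞ F)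
    (hs : ∀ p x, 2 < ‖x‖ → F (p, x) = 0) :
    ∃ k a : ℂ × ℂ → ℂ, ContDiff ℝ ∞ k ∧ ContDiff ℝ ∞ a ∧ dbarDir (0, 1) k = F ∧
      ∀ p v : ℂ, v ≠ 0 → a (p, v) = v ^ n * k (p, v⁻¹) := by
  refine ⟨cauchyTransform F, fun q => q.2 ^ (n + 1).toNat * cauchyInfty F q,
    contDiff_cauchyTransform hF hs, (contDiff_snd.pow _).mul (contDiff_cauchyInfty hF hs),
    dbarDir_cauchyTransform hF hs, fun p v hv => ?_⟩
  have h := cauchyInfty_inv (f := F) (p := p) (inv_ne_zero hv)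
  rw [inv_inv] at h
  simp only [h, ← zpow_natCast, Int.toNat_of_nonneg (show 0 ≤ n + 1 by omega), zpow_add₀ hv,
    zpow_one]
  field_simp

/-- The `∂̄`-equation on `ℂP¹` with values in `𝒪(n)`, `n ≥ -1`, has solutions depending smoothly on
parameters. -/
theorem exists_dbar_eq {n : ℤ} (hn : -1 ≤ n) {f₀ f₁ : ℂ × ℂ → ℂ} (h₀ : ContDiff ℝ ∞ f₀)
    (h₁ : ContDiff ℝ ∞ f₁)
    (h : ∀ p v : ℂ, v ≠ 0 → conj (-(v ^ 2)⁻¹) * f₁ (p, v⁻¹) = v ^ (-n) * f₀ (p, v)) :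
    ∃ g₀ g₁ : ℂ × ℂ → ℂ, ContDiff ℝ ∞ g₀ ∧ ContDiff ℝ ∞ g₁ ∧ dbarDir (0, 1) g₀ = f₀ ∧
      dbarDir (0, 1) g₁ = f₁ ∧ ∀ p v : ℂ, v ≠ 0 → g₁ (p, v⁻¹) = v ^ (-n) * g₀ (p, v) := by
  have hcut : ContDiff ℝ ∞ fun q : ℂ × ℂ => (cutoff q.2 : ℂ) :=
    ofRealCLM.contDiff.comp (contDiff_cutoff.comp contDiff_snd)
  have hsupp : ∀ (f : ℂ × ℂ → ℂ) (p x : ℂ), 2 < ‖x‖ → (cutoff x : ℂ) * f (p, x) = 0 := by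
    intro f p x hx
    rw [cutoff_eq_zero hx]; simp
  -- A partition of unity writes the form as a sum of two pieces, supported near 0 and near ∞. Each
  -- is solved in its own chart, and the solution is continued to the other chart.
  obtain ⟨k₀, a₁, hk₀, ha₁, hd₀, e₀⟩ := exists_dbar_extension hn (hcut.mul h₀) (hsupp f₀)
  obtain ⟨k₁, a₀, hk₁, ha₀, hd₁, e₁⟩ := exists_dbar_extension hn (hcut.mul h₁) (hsupp f₁)
  have hcont : ∀ {g : ℂ × ℂ → ℂ}, ContDiff ℝ ∞ g → Continuous (dbarDir (0, 1) g) := fun hg =>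
    (contDiff_dbarDir hg _).continuous
  have hone : ∀ {v : ℂ}, v ≠ 0 → (cutoff v : ℂ) + cutoff v⁻¹ = 1 := fun hv => by
    rw [← ofReal_add, cutoff_add_inv hv, ofReal_one]
  refine ⟨k₀ + a₀, k₁ + a₁, hk₀.add ha₀, hk₁.add ha₁, ?_, ?_, ?_⟩
  · refine eq_of_eqOn_torus (hcont (hk₀.add ha₀)) h₀.continuous ?_
    rintro ⟨p, v⟩ ⟨-, hv⟩
    simp only at hv
    rw [dbarDir_fun_add hk₀ ha₀, hd₀, Pi.add_apply, dbarDir_inversion n hk₁ e₁ hv, hd₁]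
    have := h p v hv
    have hz : v ^ n * v ^ (-n) = 1 := by rw [← zpow_add₀ hv]; simp
    linear_combination (v ^ n * (cutoff v⁻¹ : ℂ)) * this + f₀ (p, v) * hone hv
      + (cutoff v⁻¹ * f₀ (p, v)) * hz
  · refine eq_of_eqOn_torus (hcont (hk₁.add ha₁)) h₁.continuous ?_
    rintro ⟨p, v⟩ ⟨-, hv⟩
    simp only at hv
    rw [dbarDir_fun_add hk₁ ha₁, hd₁, Pi.add_apply, dbarDir_inversion n hk₀ e₀ hv, hd₀]
    have := h p v⁻¹ (inv_ne_zero hv)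
    rw [inv_inv, inv_zpow, zpow_neg, inv_inv] at this
    have hc : conj (-(v ^ 2)⁻¹) * conj (-((v⁻¹) ^ 2)⁻¹) = 1 := by
      rw [← map_mul]
      have : -(v ^ 2)⁻¹ * -(v⁻¹ ^ 2)⁻¹ = 1 := by field_simp
      rw [this, map_one]
    linear_combination (-(cutoff v⁻¹ : ℂ) * conj (-(v ^ 2)⁻¹)) * this
      + f₁ (p, v) * hone hv + (cutoff v⁻¹ * f₁ (p, v)) * hc
  · intro p v hv
    have h1 := e₀ p v⁻¹ (inv_ne_zero hv)
    have h2 := e₁ p v hv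
    rw [inv_inv, inv_zpow] at h1
    have hz : v ^ n ≠ 0 := zpow_ne_zero _ hv
    simp only [Pi.add_apply, h1, h2, zpow_neg]
    field_simp
    ring

/-! ### Liouville's theorem for sections of `𝒪(n)` -/

lemma differentiable_of_dbarOne {g : ℂ → ℂ} (hg : Differentiable ℝ g) (h : ∀ z, dbarOne g z = 0) :
    Differentiable ℂ g := by
  intro z
  refine differentiableAt_complex_iff_differentiableAt_real.2 ⟨hg z, ?_⟩
  have := h z
  simp only [dbarOne] at this
  rw [smul_eq_mul]
  linear_combination (-2 * I) * this + fderiv ℝ g z I * I_mul_I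

/-- An entire function with growth of order less than `N` is a polynomial. -/
lemma exists_eq_sum_of_growth (N : ℕ) {g k : ℂ → ℂ} (hg : Differentiable ℂ g)
    (hk : ContinuousAt k 0) (h : ∀ v ≠ 0, v * g v = v ^ N * k v⁻¹) :
    ∃ c : ℕ → ℂ, ∀ v, g v = ∑ i ∈ Finset.range N, c i * v ^ i := by
  induction N generalizing g k with
  | zero =>
    refine ⟨0, fun v => ?_⟩
    -- For N = 0 the growth condition reads g v = v⁻¹ * k v⁻¹, so g tends to zero at infinity and
    -- Liouville applies.
    have ht : Tendsto g (cocompact ℂ) (𝓝 0) := by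
      have hi : Tendsto (fun v : ℂ => v⁻¹) (cocompact ℂ) (𝓝 0) := by
        rw [← Metric.cobounded_eq_cocompact]; exact tendsto_inv₀_cobounded
      have := hi.mul (hk.tendsto.comp hi)
      rw [zero_mul] at this
      refine this.congr' ?_
      filter_upwards [(isCompact_singleton (x := (0 : ℂ))).compl_mem_cocompact] with v hv
      have hv' : v ≠ 0 := hv
      have := h v hv'
      simp only [pow_zero, one_mul] at this
      simp only [Function.comp]
      rw [← this]
      field_simp
    simpa using hg.apply_eq_of_tendsto_cocompact v ht
  | succ N ih =>
    -- Splitting off the constant term and dividing by v lowers the growth by one order; `k` loses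
    -- the term g 0 * w ^ N.
    have hd : Differentiable ℂ (dslope g 0) := by
      rw [← differentiableOn_univ]
      exact (differentiableOn_dslope univ_mem).2 hg.differentiableOn
    have hs : ∀ v, g v = g 0 + v * dslope g 0 v := by
      intro v
      have := sub_smul_dslope g 0 v
      simp only [sub_zero, smul_eq_mul] at this
      rw [this]; ring
    obtain ⟨c, hc⟩ := ih (k := fun w => k w - g 0 * w ^ N) hd
      (hk.sub (continuousAt_const.mul (continuousAt_id.pow N))) (by
        intro v hv
        have h1 := h v hv
        have h2 := hs v
        have hvN : v ^ N ≠ 0 := pow_ne_zero _ hv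
        have h3 : g v = v ^ N * k v⁻¹ := by
          apply mul_left_cancel₀ hv
          rw [h1]; ring
        have h4 : v ^ N * (v⁻¹) ^ N = 1 := by rw [← mul_pow, mul_inv_cancel₀ hv, one_pow]
        linear_combination h3 - h2 + g 0 * h4)
    refine ⟨fun i => Nat.casesOn i (g 0) c, fun v => ?_⟩
    rw [Finset.sum_range_succ', hs v, hc v, Finset.mul_sum, add_comm]
    simp only [pow_zero, mul_one]
    congr 1
    exact Finset.sum_congr rfl fun i _ => by ring

lemma exists_eq_sum_of_section {n : ℤ} (hn : -1 ≤ n) {g k : ℂ → ℂ} (hg : Differentiable ℂ g)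
    (hk : ContinuousAt k 0) (h : ∀ v ≠ 0, k v⁻¹ = v ^ (-n) * g v) :
    ∃ c : ℕ → ℂ, ∀ v, g v = ∑ i ∈ Finset.range (n + 1).toNat, c i * v ^ i := by
  refine exists_eq_sum_of_growth _ hg hk fun v hv => ?_
  rw [h v hv, ← zpow_natCast, Int.toNat_of_nonneg (by omega), ← mul_assoc, ← zpow_add₀ hv]
  simp

lemma section_neg_one {g k : ℂ → ℂ} (hg : Differentiable ℂ g) (hk : ContinuousAt k 0)
    (h : ∀ v ≠ 0, k v⁻¹ = v ^ (-(-1) : ℤ) * g v) (v : ℂ) : g v = 0 := by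
  obtain ⟨c, hc⟩ := exists_eq_sum_of_section le_rfl hg hk h
  simpa using hc v

lemma section_zero {g k : ℂ → ℂ} (hg : Differentiable ℂ g) (hk : ContinuousAt k 0)
    (h : ∀ v ≠ 0, k v⁻¹ = v ^ (-0 : ℤ) * g v) (v : ℂ) : g v = g 0 := by
  obtain ⟨c, hc⟩ := exists_eq_sum_of_section (by norm_num) hg hk h
  simp [hc]

/-- The coefficient of v is the value at infinity in the other trivialization, so a section of 𝒪(1)
is read off from its values at two points. -/
lemma section_one {g k : ℂ → ℂ} (hg : Differentiable ℂ g) (hk : ContinuousAt k 0)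
    (h : ∀ v ≠ 0, k v⁻¹ = v ^ (-1 : ℤ) * g v) (v : ℂ) : g v = g 0 + k 0 * v := by
  obtain ⟨c, hc⟩ := exists_eq_sum_of_section (by norm_num) hg hk h
  have hc' : ∀ v, g v = c 0 + c 1 * v := fun v => by
    rw [hc v, show ((1 : ℤ) + 1).toNat = 2 from rfl]; simp [Finset.sum_range_succ]
  have hk0 : k 0 = c 1 := by
    have h1 : Tendsto k (𝓝[≠] 0) (𝓝 (k 0)) := hk.tendsto.mono_left nhdsWithin_le_nhds
    have h2 : Tendsto (fun w : ℂ => c 0 * w + c 1) (𝓝[≠] 0) (𝓝 (c 0 * 0 + c 1)) :=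
      ((continuous_const.mul continuous_id).add continuous_const).continuousAt.tendsto.mono_left
        nhdsWithin_le_nhds
    rw [mul_zero, zero_add] at h2
    refine tendsto_nhds_unique h1 (h2.congr' ?_)
    filter_upwards [self_mem_nhdsWithin] with w hw
    have hw' : w ≠ 0 := hw
    have := h w⁻¹ (inv_ne_zero hw')
    rw [inv_inv] at this
    rw [this, hc']
    simp
    field_simp
  rw [hc' v, hk0, hc' 0]
  simp

/-! ### Sections over the four charts -/

/-- The derivative `∂u'/∂u` of a coordinate change. -/
def Chart.jacU : Chart → ℂ × ℂ → ℂ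
  | .U₁ => fun p => -(p.1 ^ 2)⁻¹
  | .U₂ => fun _ => 1
  | .U₃ => fun p => -(p.1 ^ 2)⁻¹
  | .U₄ => fun _ => 1

/-- The derivative `∂v'/∂u` of a coordinate change. -/
def Chart.jacM : Chart → ℂ × ℂ → ℂ
  | .U₁ => fun p => -(p.1 ^ 2)⁻¹ * p.2
  | .U₂ => fun _ => 0
  | .U₃ => fun p => p.2⁻¹
  | .U₄ => fun _ => 0

/-- The derivative `∂v'/∂v` of a coordinate change. -/
def Chart.jacV : Chart → ℂ × ℂ → ℂ
  | .U₁ => fun p => p.1⁻¹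
  | .U₂ => fun _ => 1
  | .U₃ => fun p => -(p.2 ^ 2)⁻¹ * p.1
  | .U₄ => fun p => -(p.2 ^ 2)⁻¹

lemma Chart.hasFDerivAt_coord (i : Chart) {p : ℂ × ℂ} (hp : p ∈ torus) :
    HasFDerivAt i.coord
      ((i.jacU p • ContinuousLinearMap.fst ℂ ℂ ℂ).prod
        (i.jacM p • ContinuousLinearMap.fst ℂ ℂ ℂ
          + i.jacV p • ContinuousLinearMap.snd ℂ ℂ ℂ)) p := by
  obtain ⟨h1, h2⟩ := hp
  have f1 : HasFDerivAt (fun p : ℂ × ℂ => p.1) (ContinuousLinearMap.fst ℂ ℂ ℂ) p := hasFDerivAt_fst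
  have f2 : HasFDerivAt (fun p : ℂ × ℂ => p.2) (ContinuousLinearMap.snd ℂ ℂ ℂ) p := hasFDerivAt_snd
  have e1 : HasFDerivAt (fun p : ℂ × ℂ => p.1⁻¹)
      (-(p.1 ^ 2)⁻¹ • ContinuousLinearMap.fst ℂ ℂ ℂ) p :=
    (hasDerivAt_inv h1).comp_hasFDerivAt p f1
  have e2 : HasFDerivAt (fun p : ℂ × ℂ => p.2⁻¹)
      (-(p.2 ^ 2)⁻¹ • ContinuousLinearMap.snd ℂ ℂ ℂ) p :=
    (hasDerivAt_inv h2).comp_hasFDerivAt p f2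
  cases i
  · refine (e1.prodMk (f2.mul e1)).congr_fderiv ?_
    ext <;> simp [jacU, jacM, jacV, mul_comm]
  · refine (hasFDerivAt_id p).congr_fderiv ?_
    ext <;> simp [jacU, jacM, jacV]
  · refine (e1.prodMk (f1.mul e2)).congr_fderiv ?_
    ext <;> simp [jacU, jacM, jacV, mul_comm]
  · refine (f1.prodMk e2).congr_fderiv ?_
    ext <;> simp [jacU, jacM, jacV]

/-- All coordinate changes respect the projection to ℂP¹, so their Jacobians are triangular: only
the dū-component receives a mixed term, coming from dv̄. -/
lemma pullback_coord (i : Chart) (ψ : LocalForm) {p : ℂ × ℂ} (hp : p ∈ torus) :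
    ψ.pullback i.coord .one p = ψ .one (i.coord p) ∧
    ψ.pullback i.coord .du p = conj (i.jacU p) * ψ .du (i.coord p)
      + conj (i.jacM p) * ψ .dv (i.coord p) ∧
    ψ.pullback i.coord .dv p = conj (i.jacV p) * ψ .dv (i.coord p) ∧
    ψ.pullback i.coord .dudv p = conj (i.jacU p * i.jacV p) * ψ .dudv (i.coord p) := by
  simp [LocalForm.pullback, (i.hasFDerivAt_coord hp).fderiv]

lemma Chart.jacU_ne_zero (i : Chart) {p : ℂ × ℂ} (hp : p ∈ torus) : i.jacU p ≠ 0 := by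
  obtain ⟨h1, h2⟩ := hp
  cases i <;> simp [jacU, h1]

lemma Chart.jacV_ne_zero (i : Chart) {p : ℂ × ℂ} (hp : p ∈ torus) : i.jacV p ≠ 0 := by
  obtain ⟨h1, h2⟩ := hp
  cases i <;> simp [jacV, h1, h2]

lemma Chart.exists_coord_eq (i : Chart) {q : ℂ × ℂ} (hq : q ∈ torus) :
    ∃ p ∈ torus, i.coord p = q := by
  obtain ⟨a, b⟩ := q
  obtain ⟨h1, h2⟩ := hq
  simp only at h1 h2
  cases i
  · exact ⟨(a⁻¹, b * a⁻¹), ⟨by simp [h1], by simp [h1, h2]⟩, by simp [coord, h1]⟩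
  · exact ⟨(a, b), ⟨h1, h2⟩, rfl⟩
  · exact ⟨(a⁻¹, (a * b)⁻¹), ⟨by simp [h1], by simp [h1, h2]⟩, by simp [coord, h1]⟩
  · exact ⟨(a, b⁻¹), ⟨h1, by simp [h2]⟩, by simp [coord]⟩

/-- On the torus the matching conditions can be solved for the components in any chart, the
triangular Jacobian being invertible; density does the rest. Identities of forms thus need to be
checked in `U₂` only. -/
lemma DGHom.eq_zero_of_torus {D : ℤ × ℤ} (ψ : DGHom D) (h : ∀ k, ∀ p ∈ torus, ψ.1 .U₂ k p = 0) :
    ψ = 0 := by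
  refine DGHom.ext_chart fun i => funext fun k => ?_
  refine eq_of_eqOn_torus (ψ.2.1 i k).continuous continuous_const fun q hq => ?_
  obtain ⟨p, hp, rfl⟩ := i.exists_coord_eq hq
  have hz : ∀ k, (ψ.1 i).pullback i.coord k p = 0 := fun k => by
    rw [ψ.2.2 i k p hp, h k p hp, mul_zero]
  obtain ⟨e1, e2, e3, e4⟩ := pullback_coord i (ψ.1 i) hp
  rw [hz] at e1 e2 e3 e4
  have hU : conj (i.jacU p) ≠ 0 := (map_ne_zero _).2 (i.jacU_ne_zero hp)
  have hV : conj (i.jacV p) ≠ 0 := (map_ne_zero _).2 (i.jacV_ne_zero hp)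
  have hdv : ψ.1 i .dv (i.coord p) = 0 := by simpa [hV] using e3.symm
  cases k
  · exact e1.symm
  · rw [hdv, mul_zero, add_zero] at e2
    simpa [hU] using e2.symm
  · exact hdv
  · rw [map_mul] at e4
    simpa [hU, hV] using e4.symm

lemma DGHom.ext_torus {D : ℤ × ℤ} {ψ χ : DGHom D}
    (h : ∀ k, ∀ p ∈ torus, ψ.1 .U₂ k p = χ.1 .U₂ k p) : ψ = χ := by
  rw [← sub_eq_zero]
  exact DGHom.eq_zero_of_torus _ fun k p hp => sub_eq_zero.2 (h k p hp)

/-- Families of smooth functions on the charts which match as sections of `𝒪(a,b)`, `D = (a, b)`,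
tensored with the line bundle pulled back from `ℂP¹` with transition function `e`. -/
structure IsSection (e : ℂ → ℂ) (D : ℤ × ℤ) (s : Chart → ℂ × ℂ → ℂ) : Prop where
  smooth : ∀ i, ContDiff ℝ ∞ (s i)
  base₂₁ : ∀ {u : ℂ} (v : ℂ), u ≠ 0 →
    e u * s .U₁ (u⁻¹, v * u⁻¹) = u ^ (-D.1) * u ^ (-D.2) * s .U₂ (u, v)
  base₄₃ : ∀ {u : ℂ} (w : ℂ), u ≠ 0 → e u * s .U₃ (u⁻¹, u * w) = u ^ (-D.1) * s .U₄ (u, w)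
  fibre₂₄ : ∀ (u : ℂ) {v : ℂ}, v ≠ 0 → s .U₄ (u, v⁻¹) = v ^ (-D.2) * s .U₂ (u, v)
  fibre₁₃ : ∀ (u : ℂ) {v : ℂ}, v ≠ 0 → s .U₃ (u, v⁻¹) = v ^ (-D.2) * s .U₁ (u, v)

/-- The transition functions of a line bundle pulled back from `ℂP¹`. -/
def baseTwist (e : ℂ → ℂ) : Chart → ℂ × ℂ → ℂ
  | .U₁ => fun p => e p.1
  | .U₂ => fun _ => 1
  | .U₃ => fun p => e p.1
  | .U₄ => fun _ => 1

lemma eq_of_eq_of_ne_zero {f g : ℂ → ℂ} (hf : Continuous f) (hg : Continuous g)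
    (h : ∀ z ≠ 0, f z = g z) (z : ℂ) : f z = g z :=
  congrFun (hf.ext_on (dense_compl_singleton 0) hg fun z hz => h z hz) z

section IsSection

variable {e : ℂ → ℂ} {D : ℤ × ℤ} {s : Chart → ℂ × ℂ → ℂ}

/-- Each relation holds on a dense set and extends by continuity to the full overlap of its two
charts. The relation between `U₁` and `U₃` is found by comparing both with `U₂`, and there the
factor `e` has to be cancelled. -/
lemma IsSection.of_torus (he : ∀ u ≠ 0, e u ≠ 0) (hs : ∀ i, ContDiff ℝ ∞ (s i))
    (h : ∀ i, ∀ p ∈ torus, baseTwist e i p * s i (i.coord p) = i.trans D p * s .U₂ p) :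
    IsSection e D s := by
  have hc : ∀ i, Continuous (s i) := fun i => (hs i).continuous
  refine ⟨hs, fun {u} v hu => ?_, fun {u} w hu => ?_, fun u {v} hv => ?_, fun u {v} hv => ?_⟩
  · refine eq_of_eq_of_ne_zero (f := fun v => e u * s .U₁ (u⁻¹, v * u⁻¹))
      (g := fun v => u ^ (-D.1) * u ^ (-D.2) * s .U₂ (u, v)) ?_ ?_ (fun v hv => ?_) v
    · exact continuous_const.mul ((hc _).comp (by fun_prop))
    · exact continuous_const.mul ((hc _).comp (by fun_prop))
    · exact h .U₁ (u, v) ⟨hu, hv⟩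
  · refine eq_of_eq_of_ne_zero (f := fun w => e u * s .U₃ (u⁻¹, u * w))
      (g := fun w => u ^ (-D.1) * s .U₄ (u, w)) ?_ ?_ (fun w hw => ?_) w
    · exact continuous_const.mul ((hc _).comp (by fun_prop))
    · exact continuous_const.mul ((hc _).comp (by fun_prop))
    · have h3 := h .U₃ (u, w⁻¹) ⟨hu, inv_ne_zero hw⟩
      have h4 := h .U₄ (u, w⁻¹) ⟨hu, inv_ne_zero hw⟩
      simp only [baseTwist, Chart.coord, Chart.trans, inv_inv, one_mul] at h3 h4
      rw [h3, h4]; ring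
  · refine eq_of_eq_of_ne_zero (f := fun u => s .U₄ (u, v⁻¹))
      (g := fun u => v ^ (-D.2) * s .U₂ (u, v)) ?_ ?_ (fun u hu => ?_) u
    · exact (hc _).comp (by fun_prop)
    · exact continuous_const.mul ((hc _).comp (by fun_prop))
    · have h4 := h .U₄ (u, v) ⟨hu, hv⟩
      simpa [baseTwist, Chart.coord, Chart.trans] using h4
  · refine eq_of_eq_of_ne_zero (f := fun u => s .U₃ (u, v⁻¹))
      (g := fun u => v ^ (-D.2) * s .U₁ (u, v)) ?_ ?_ (fun u hu => ?_) u
    · exact (hc _).comp (by fun_prop)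
    · exact continuous_const.mul ((hc _).comp (by fun_prop))
    · have hp : (u⁻¹, v * u⁻¹) ∈ torus := ⟨inv_ne_zero hu, mul_ne_zero hv (inv_ne_zero hu)⟩
      have h1 := h .U₁ _ hp
      have h3 := h .U₃ _ hp
      have e3 : u⁻¹ * (v * u⁻¹)⁻¹ = v⁻¹ := by field_simp
      simp only [baseTwist, Chart.coord, Chart.trans, inv_inv, mul_assoc, inv_mul_cancel₀ hu,
        mul_one] at h1 h3
      rw [← mul_assoc, mul_assoc] at h3
      rw [e3] at h3
      apply mul_left_cancel₀ (he _ (inv_ne_zero hu))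
      rw [h3]
      have : e u⁻¹ * (v ^ (-D.2) * s Chart.U₁ (u, v))
        = v ^ (-D.2) * (e u⁻¹ * s Chart.U₁ (u, v)) := by ring
      rw [this, h1, mul_zpow]
      ring

lemma IsSection.torus (h : IsSection e D s) (i : Chart) (p : ℂ × ℂ) (hp : p ∈ torus) :
    baseTwist e i p * s i (i.coord p) = i.trans D p * s .U₂ p := by
  obtain ⟨u, v⟩ := p
  obtain ⟨hu, hv⟩ := hp
  simp only at hu hv
  cases i
  · exact h.base₂₁ v hu
  · simp [baseTwist, Chart.coord, Chart.trans]
  · have h1 := h.base₄₃ v⁻¹ hu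
    rw [h.fibre₂₄ u hv] at h1
    simp only [baseTwist, Chart.coord, Chart.trans]
    rw [h1]; ring
  · simpa [baseTwist, Chart.coord, Chart.trans] using h.fibre₂₄ u hv

end IsSection

/-- The transition function of the bundle of `(0,1)`-forms on `ℂP¹`. -/
def formTwist (u : ℂ) : ℂ := conj (-(u ^ 2)⁻¹)

lemma formTwist_ne_zero (u : ℂ) (hu : u ≠ 0) : formTwist u ≠ 0 := by
  simp [formTwist, hu]

lemma baseTwist_formTwist (i : Chart) (p : ℂ × ℂ) : baseTwist formTwist i p = conj (i.jacU p) := by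
  cases i <;> simp [baseTwist, formTwist, Chart.jacU]

lemma baseTwist_one (i : Chart) (p : ℂ × ℂ) : baseTwist (fun _ => 1) i p = 1 := by
  cases i <;> rfl

/-- The form of degree `0` with given coefficients. -/
def ofFun {D : ℤ × ℤ} (s : Chart → ℂ × ℂ → ℂ) (h : IsSection (fun _ => 1) D s) : DGHom D :=
  ⟨fun i k => match k with
    | .one => s i
    | _ => 0, by
    refine ⟨fun i k => ?_, fun i k p hp => ?_⟩
    · cases k <;> first | exact h.smooth i | exact contDiff_const
    · have := h.torus i p hp
      rw [baseTwist_one, one_mul] at this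
      cases k <;> simp [LocalForm.pullback, this]⟩

/-- The form `s dū`. -/
def ofDu {D : ℤ × ℤ} (s : Chart → ℂ × ℂ → ℂ) (h : IsSection formTwist D s) : DGHom D :=
  ⟨fun i k => match k with
    | .du => s i
    | _ => 0, by
    refine ⟨fun i k => ?_, fun i k p hp => ?_⟩
    · cases k <;> first | exact h.smooth i | exact contDiff_const
    · have := h.torus i p hp
      rw [baseTwist_formTwist] at this
      obtain ⟨e1, e2, e3, e4⟩ := pullback_coord i (fun k => match k with
        | .du => s i
        | _ => 0) hp
      cases k
      · simp [e1]
      · simp [e2, this]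
      · simp [e3]
      · simp [e4]⟩

lemma ofFun_mem {D : ℤ × ℤ} (s : Chart → ℂ × ℂ → ℂ) (h : IsSection (fun _ => 1) D s) :
    ofFun s h ∈ dgDeg D 0 := by
  intro i k hk
  cases k <;> first | rfl | exact (hk rfl).elim

lemma ofDu_mem {D : ℤ × ℤ} (s : Chart → ℂ × ℂ → ℂ) (h : IsSection formTwist D s) :
    ofDu s h ∈ dgDeg D 1 := by
  intro i k hk
  cases k <;> first | rfl | exact (hk rfl).elim

/-! ### The `∂̄`-equation along the fibres of `𝔽₁ → ℂP¹` -/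

lemma dbarOne_slice {g : ℂ × ℂ → ℂ} (hg : ContDiff ℝ ∞ g) (c k v : ℂ) :
    dbarOne (fun v => g (c, v * k)) v = conj k * dbarDir (0, 1) g (c, v * k) := by
  have hd := (hg.differentiable (by simp) (c, v * k)).hasFDerivAt
  have hm : HasFDerivAt (fun v : ℂ => (c, v * k))
      ((0 : ℂ →L[ℝ] ℂ).prod ((ContinuousLinearMap.mul ℝ ℂ).flip k)) v :=
    (hasFDerivAt_const c v).prodMk ((ContinuousLinearMap.mul ℝ ℂ).flip k).hasFDerivAt
  have h : HasFDerivAt (fun v => g (c, v * k)) _ v := hd.comp v hm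
  have key := clm_conj_smul ((fderiv ℝ g (c, v * k)).comp (ContinuousLinearMap.inr ℝ ℂ ℂ)) k
  simp only [dbarOne, dbarDir, h.fderiv]
  simp at key ⊢
  rw [mul_comm k I, key]
  ring

lemma dbarDir_snd_mul_pow {A : ℂ → ℂ} (hA : ContDiff ℝ ∞ A) (k : ℕ) :
    dbarDir (0, 1) (fun q : ℂ × ℂ => A q.1 * q.2 ^ k) = 0 := by
  funext ⟨p, v⟩
  have hs : ContDiff ℝ ∞ (fun q : ℂ × ℂ => A q.1 * q.2 ^ k) :=
    (hA.comp contDiff_fst).mul (contDiff_snd.pow k)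
  rw [dbarDir_snd (hs.differentiable (by simp) _)]
  have h : DifferentiableAt ℂ (fun z : ℂ => A p * z ^ k) v := by fun_prop
  have := (h.fderiv_restrictScalars ℝ)
  simp only [dbarOne, this, ContinuousLinearMap.coe_restrictScalars']
  have e : (fderiv ℂ (fun z : ℂ => A p * z ^ k) v) I
      = I * (fderiv ℂ (fun z : ℂ => A p * z ^ k) v) 1 := by
    rw [← smul_eq_mul, ← map_smul]; simp
  rw [e]
  simp only [Pi.zero_apply]
  linear_combination ((fderiv ℂ (fun z : ℂ => A p * z ^ k) v) 1 / 2) * I_mul_I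

/-- For `𝒪(b)` with `b ∈ {-1, 0, 1}`, the solution of the `∂̄`-equation can be normalized at
`0` and `∞`. -/
lemma exists_dbar_eq_normalized {b : ℤ} (hb : b = -1 ∨ b = 0 ∨ b = 1) {f₀ f₁ : ℂ × ℂ → ℂ}
    (h₀ : ContDiff ℝ ∞ f₀) (h₁ : ContDiff ℝ ∞ f₁)
    (h : ∀ p v : ℂ, v ≠ 0 → conj (-(v ^ 2)⁻¹) * f₁ (p, v⁻¹) = v ^ (-b) * f₀ (p, v)) :
    ∃ g₀ g₁ : ℂ × ℂ → ℂ, ContDiff ℝ ∞ g₀ ∧ ContDiff ℝ ∞ g₁ ∧ dbarDir (0, 1) g₀ = f₀ ∧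
      dbarDir (0, 1) g₁ = f₁ ∧ (∀ p v : ℂ, v ≠ 0 → g₁ (p, v⁻¹) = v ^ (-b) * g₀ (p, v)) ∧
      (0 ≤ b → ∀ p, g₀ (p, 0) = 0) ∧ (b = 1 → ∀ p, g₁ (p, 0) = 0) := by
  obtain ⟨g₀, g₁, s₀, s₁, d₀, d₁, e⟩ := exists_dbar_eq (by omega) h₀ h₁ h
  set A : ℂ → ℂ := fun p => g₀ (p, 0)
  set B : ℂ → ℂ := fun p => g₁ (p, 0)
  have hA : ContDiff ℝ ∞ A := s₀.comp (contDiff_prodMk_left 0)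
  have hB : ContDiff ℝ ∞ B := s₁.comp (contDiff_prodMk_left 0)
  have hs : ∀ {C : ℂ → ℂ} (k : ℕ), ContDiff ℝ ∞ C →
      ContDiff ℝ ∞ (fun q : ℂ × ℂ => C q.1 * q.2 ^ k) := fun k hC =>
    (hC.comp contDiff_fst).mul (contDiff_snd.pow k)
  rcases hb with rfl | rfl | rfl
  · exact ⟨g₀, g₁, s₀, s₁, d₀, d₁, e, by norm_num, by norm_num⟩
  · refine ⟨g₀ - fun q : ℂ × ℂ => A q.1 * q.2 ^ 0, g₁ - fun q : ℂ × ℂ => A q.1 * q.2 ^ 0,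
      s₀.sub (hs 0 hA), s₁.sub (hs 0 hA), ?_, ?_, ?_, ?_, by norm_num⟩
    · rw [dbarDir_fun_sub s₀ (hs 0 hA), d₀, dbarDir_snd_mul_pow hA, sub_zero]
    · rw [dbarDir_fun_sub s₁ (hs 0 hA), d₁, dbarDir_snd_mul_pow hA, sub_zero]
    · intro p v hv
      simp [e p v hv]
    · intro _ p
      simp [A]
  -- The correction is A + B v, the holomorphic section of 𝒪(1) with the same values at 0 and ∞; in
  -- the chart at infinity it reads B + A w.
  · have s₀' : ContDiff ℝ ∞ (g₀ - fun q : ℂ × ℂ => A q.1 * q.2 ^ 0) := s₀.sub (hs 0 hA)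
    have s₁' : ContDiff ℝ ∞ (g₁ - fun q : ℂ × ℂ => B q.1 * q.2 ^ 0) := s₁.sub (hs 0 hB)
    refine ⟨g₀ - (fun q : ℂ × ℂ => A q.1 * q.2 ^ 0) - fun q : ℂ × ℂ => B q.1 * q.2 ^ 1,
      g₁ - (fun q : ℂ × ℂ => B q.1 * q.2 ^ 0) - fun q : ℂ × ℂ => A q.1 * q.2 ^ 1,
      s₀'.sub (hs 1 hB), s₁'.sub (hs 1 hA), ?_, ?_, ?_, ?_, ?_⟩
    · rw [dbarDir_fun_sub s₀' (hs 1 hB), dbarDir_fun_sub s₀ (hs 0 hA), d₀,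
        dbarDir_snd_mul_pow hA, dbarDir_snd_mul_pow hB, sub_zero, sub_zero]
    · rw [dbarDir_fun_sub s₁' (hs 1 hA), dbarDir_fun_sub s₁ (hs 0 hB), d₁,
        dbarDir_snd_mul_pow hA, dbarDir_snd_mul_pow hB, sub_zero, sub_zero]
    · intro p v hv
      simp only [Pi.sub_apply, e p v hv, zpow_neg, zpow_one]
      field_simp
      ring
    · intro _ p
      simp [A]
    · intro _ p
      simp [B]

/-- The b + 1 normalization conditions match the b + 1 dimensions of the space of sections of 𝒪(b).
This is the uniqueness that makes normalized solutions glue. -/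
lemma section_eq_zero {b : ℤ} (hb : b = -1 ∨ b = 0 ∨ b = 1) {g k : ℂ → ℂ}
    (hg : Differentiable ℂ g) (hk : ContinuousAt k 0) (h : ∀ v ≠ 0, k v⁻¹ = v ^ (-b) * g v)
    (h₀ : 0 ≤ b → g 0 = 0) (h₁ : b = 1 → k 0 = 0) (v : ℂ) : g v = 0 := by
  rcases hb with rfl | rfl | rfl
  · exact section_neg_one hg hk h v
  · rw [section_zero hg hk h v, h₀ le_rfl]
  · rw [section_one hg hk h v, h₀ (by norm_num), h₁ rfl]; simp

/-- The hypothesis `h` says that `f` is a (0,1)-form along the fibres with values in 𝒪(a,b) twisted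
by a bundle from the base. The fibrations `U₂ ∪ U₄` and `U₁ ∪ U₃` are treated separately. The curves
v = 0 and v = ∞ are preserved by the change of base chart, so normalized solutions over both charts
agree. -/
theorem exists_fibre_solution {e : ℂ → ℂ} (he : ∀ u ≠ 0, e u ≠ 0) {D : ℤ × ℤ}
    (hb : D.2 = -1 ∨ D.2 = 0 ∨ D.2 = 1) {f : Chart → ℂ × ℂ → ℂ}
    (hf : ∀ i, ContDiff ℝ ∞ (f i))
    (h : ∀ i, ∀ p ∈ torus,
      baseTwist e i p * conj (i.jacV p) * f i (i.coord p) = i.trans D p * f .U₂ p) :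
    ∃ s, IsSection e D s ∧ ∀ i, dbarDir (0, 1) (s i) = f i := by
  have hc : ∀ i, Continuous (f i) := fun i => (hf i).continuous
  have h24 : ∀ u v : ℂ, v ≠ 0 →
      conj (-(v ^ 2)⁻¹) * f .U₄ (u, v⁻¹) = v ^ (-D.2) * f .U₂ (u, v) := by
    intro u v hv
    refine eq_of_eq_of_ne_zero (f := fun u => conj (-(v ^ 2)⁻¹) * f .U₄ (u, v⁻¹))
      (g := fun u => v ^ (-D.2) * f .U₂ (u, v)) ?_ ?_ (fun u hu => ?_) u
    · exact continuous_const.mul ((hc _).comp (by fun_prop))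
    · exact continuous_const.mul ((hc _).comp (by fun_prop))
    · have h4 := h .U₄ (u, v) ⟨hu, hv⟩
      simpa [baseTwist, Chart.coord, Chart.trans, Chart.jacV] using h4
  have h13 : ∀ u v : ℂ, v ≠ 0 →
      conj (-(v ^ 2)⁻¹) * f .U₃ (u, v⁻¹) = v ^ (-D.2) * f .U₁ (u, v) := by
    intro u v hv
    refine eq_of_eq_of_ne_zero (f := fun u => conj (-(v ^ 2)⁻¹) * f .U₃ (u, v⁻¹))
      (g := fun u => v ^ (-D.2) * f .U₁ (u, v)) ?_ ?_ (fun u hu => ?_) u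
    · exact continuous_const.mul ((hc _).comp (by fun_prop))
    · exact continuous_const.mul ((hc _).comp (by fun_prop))
    · have hp : (u⁻¹, v * u⁻¹) ∈ torus := ⟨inv_ne_zero hu, mul_ne_zero hv (inv_ne_zero hu)⟩
      have h1 := h .U₁ _ hp
      have h3 := h .U₃ _ hp
      have e1 : v * u⁻¹ * u = v := by field_simp
      have e3 : u⁻¹ * (v * u⁻¹)⁻¹ = v⁻¹ := by field_simp
      have e4 : -((v * u⁻¹) ^ 2)⁻¹ * u⁻¹ = -(v ^ 2)⁻¹ * u := by field_simp
      simp only [baseTwist, Chart.coord, Chart.trans, Chart.jacV, inv_inv, e1, e3, e4, map_mul]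
        at h1 h3
      have hcu : conj u ≠ 0 := (map_ne_zero _).2 hu
      apply mul_left_cancel₀ (mul_ne_zero (he _ (inv_ne_zero hu)) hcu)
      rw [mul_zpow] at h3
      linear_combination h3 - v ^ (-D.2) * h1
  obtain ⟨g₂, g₄, s₂, s₄, d₂, d₄, c₂₄, n₂, n₄⟩ := exists_dbar_eq_normalized hb (hf _) (hf _) h24
  obtain ⟨g₁, g₃, s₁, s₃, d₁, d₃, c₁₃, n₁, n₃⟩ := exists_dbar_eq_normalized hb (hf _) (hf _) h13
  -- On the fibre over u the difference of the two solutions is a holomorphic section of 𝒪(b) which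
  -- vanishes at the normalization points.
  have c₂₁ : ∀ u v : ℂ, u ≠ 0 →
      e u * g₁ (u⁻¹, v * u⁻¹) = u ^ (-D.1) * u ^ (-D.2) * g₂ (u, v) := by
    intro u v hu
    rw [← sub_eq_zero]
    have t₁ : ContDiff ℝ ∞ fun v => e u * g₁ (u⁻¹, v * u⁻¹) :=
      contDiff_const.mul (s₁.comp (contDiff_const.prodMk (contDiff_id.mul contDiff_const)))
    -- The factor 1 gives both terms the shape required by `dbarOne_slice`.
    have t₂ : ContDiff ℝ ∞ fun v => u ^ (-D.1) * u ^ (-D.2) * g₂ (u, v * 1) :=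
      contDiff_const.mul (s₂.comp (contDiff_const.prodMk (contDiff_id.mul contDiff_const)))
    have hhol : Differentiable ℂ fun v => e u * g₁ (u⁻¹, v * u⁻¹)
        - u ^ (-D.1) * u ^ (-D.2) * g₂ (u, v * 1) := by
      refine differentiable_of_dbarOne ((t₁.sub t₂).differentiable (by simp)) ?_
      refine eq_of_eq_of_ne_zero ?_ continuous_const ?_
      · have hcf := (t₁.sub t₂).continuous_fderiv (by simp)
        unfold dbarOne
        exact ((hcf.clm_apply continuous_const).add
          (continuous_const.mul (hcf.clm_apply continuous_const))).div_const 2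
      intro v hv
      have w₁ := dbarOne_slice s₁ u⁻¹ u⁻¹ v
      have w₂ := dbarOne_slice s₂ u 1 v
      rw [d₁] at w₁
      rw [d₂, mul_one, map_one, one_mul] at w₂
      have r₁ : DifferentiableAt ℝ (fun v => g₁ (u⁻¹, v * u⁻¹)) v :=
        (s₁.comp (contDiff_const.prodMk (contDiff_id.mul contDiff_const))).differentiable
          (by simp) v
      have r₂ : DifferentiableAt ℝ (fun v => g₂ (u, v * 1)) v :=
        (s₂.comp (contDiff_const.prodMk (contDiff_id.mul contDiff_const))).differentiable
          (by simp) v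
      have h1 := h .U₁ (u, v) ⟨hu, hv⟩
      simp only [baseTwist, Chart.coord, Chart.trans, Chart.jacV] at h1
      simp only [dbarOne] at w₁ w₂ ⊢
      rw [fderiv_fun_sub (r₁.const_mul _) (r₂.const_mul _), fderiv_const_mul r₁,
        fderiv_const_mul r₂]
      simp only [_root_.sub_apply, _root_.smul_apply, smul_eq_mul]
      linear_combination e u * w₁ - u ^ (-D.1) * u ^ (-D.2) * w₂ + h1
    have := section_eq_zero hb hhol
      (k := fun w => e u * (u ^ (-D.2) * g₃ (u⁻¹, u * w)) - u ^ (-D.1) * u ^ (-D.2) * g₄ (u, w))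
      ?_ ?_ ?_ ?_ v
    · simpa using this
    · exact ((continuous_const.mul (continuous_const.mul (s₃.continuous.comp (by fun_prop)))).sub
        (continuous_const.mul (s₄.continuous.comp (by fun_prop)))).continuousAt
    · intro v hv
      have hvu : v * u⁻¹ ≠ 0 := mul_ne_zero hv (inv_ne_zero hu)
      have q₃ := c₁₃ u⁻¹ (v * u⁻¹) hvu
      rw [show (v * u⁻¹)⁻¹ = u * v⁻¹ by field_simp, mul_zpow, inv_zpow, zpow_neg u, inv_inv] at q₃
      have hz : u ^ D.2 ≠ 0 := zpow_ne_zero _ hu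
      rw [q₃, c₂₄ u v hv, mul_one, zpow_neg u D.2]
      field_simp
    · intro hb0
      simp [n₁ hb0, n₂ hb0]
    · intro hb1
      simp [n₃ hb1, n₄ hb1]
  refine ⟨fun i => match i with
    | .U₁ => g₁
    | .U₂ => g₂
    | .U₃ => g₃
    | .U₄ => g₄, ⟨?_, fun {u} v hu => c₂₁ u v hu, ?_, fun u {v} hv => c₂₄ u v hv,
      fun u {v} hv => c₁₃ u v hv⟩, ?_⟩
  · intro i; cases i <;> assumption
  · intro u w hu
    -- Away from w = 0 the relation between the two charts at infinity follows from the other three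
    -- relations.
    refine eq_of_eq_of_ne_zero (f := fun w => e u * g₃ (u⁻¹, u * w))
      (g := fun w => u ^ (-D.1) * g₄ (u, w)) ?_ ?_ (fun w hw => ?_) w
    · exact continuous_const.mul (s₃.continuous.comp (by fun_prop))
    · exact continuous_const.mul (s₄.continuous.comp (by fun_prop))
    · have q₄ := c₂₄ u w⁻¹ (inv_ne_zero hw)
      have q₃ := c₁₃ u⁻¹ (w⁻¹ * u⁻¹) (mul_ne_zero (inv_ne_zero hw) (inv_ne_zero hu))
      have q₁ := c₂₁ u w⁻¹ hu
      rw [inv_inv] at q₄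
      rw [show (w⁻¹ * u⁻¹)⁻¹ = u * w by field_simp, mul_zpow, inv_zpow u] at q₃
      have hz : (u ^ (-D.2))⁻¹ * u ^ (-D.2) = 1 := inv_mul_cancel₀ (zpow_ne_zero _ hu)
      change e u * g₃ (u⁻¹, u * w) = u ^ (-D.1) * g₄ (u, w)
      rw [q₃, q₄]
      linear_combination (w⁻¹ ^ (-D.2) * (u ^ (-D.2))⁻¹) * q₁
        + (w⁻¹ ^ (-D.2) * u ^ (-D.1) * g₂ (u, w⁻¹)) * hz
  · intro i; cases i <;> assumption

/-! ### Dolbeault cohomology of the line bundles -/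

section Cohomology

variable {D : ℤ × ℤ}

lemma dgDiff_smul (c : ℂ) (ψ : DGHom D) : dgDiff (c • ψ) = c • dgDiff ψ :=
  DGHom.ext_chart fun i => by
    rw [dgDiff_apply, DGHom.smul_apply, DGHom.smul_apply, dgDiff_apply,
      LocalForm.dbar_smul c (DGHom.smooth ψ i), smul_comm]

lemma dgDiff_zero : dgDiff (0 : DGHom D) = 0 := by
  simpa using dgDiff_smul (0 : ℂ) (0 : DGHom D)

lemma dgDiff_add (ψ χ : DGHom D) : dgDiff (ψ + χ) = dgDiff ψ + dgDiff χ :=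
  DGHom.ext_chart fun i => by
    rw [dgDiff_apply, DGHom.add_apply, DGHom.add_apply, dgDiff_apply, dgDiff_apply,
      LocalForm.dbar_add (DGHom.smooth ψ i) (DGHom.smooth χ i), smul_add]

lemma dgDiff_dgDiff (ψ : DGHom D) : dgDiff (dgDiff ψ) = 0 :=
  DGHom.ext_chart fun i => by
    have hs : (ψ.1 i).dbar.Smooth := DGHom.smooth ⟨_, dbar_mem ψ.2⟩ i
    rw [dgDiff_apply, dgDiff_apply, LocalForm.dbar_smul _ hs, LocalForm.dbar_dbar (DGHom.smooth ψ i),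
      smul_zero, smul_zero]
    rfl

lemma dbar_eq_zero {ψ : DGHom D} (h : dgDiff ψ = 0) (i : Chart) (k : Comp) :
    (ψ.1 i).dbar k = 0 := by
  have h1 : (dgDiff ψ).1 i k = 0 := by rw [h]; rfl
  rw [dgDiff_apply, Pi.smul_apply] at h1
  exact (smul_eq_zero.1 h1).resolve_left two_ne_zero

lemma IsSection.add {e : ℂ → ℂ} {s t : Chart → ℂ × ℂ → ℂ} (hs : IsSection e D s)
    (ht : IsSection e D t) : IsSection e D (s + t) where
  smooth i := (hs.smooth i).add (ht.smooth i)
  base₂₁ v hu := by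
    simp only [Pi.add_apply, mul_add, hs.base₂₁ v hu, ht.base₂₁ v hu]
  base₄₃ w hu := by
    simp only [Pi.add_apply, mul_add, hs.base₄₃ w hu, ht.base₄₃ w hu]
  fibre₂₄ u _ hv := by
    simp only [Pi.add_apply, mul_add, hs.fibre₂₄ u hv, ht.fibre₂₄ u hv]
  fibre₁₃ u _ hv := by
    simp only [Pi.add_apply, mul_add, hs.fibre₁₃ u hv, ht.fibre₁₃ u hv]

/-- The section of `𝒪(a,b)` given by `v ^ j` times a section of a line bundle on `ℂP¹`. -/
def fibreMonomial (b : ℤ) (j : ℕ) (G₂ G₁ : ℂ → ℂ) : Chart → ℂ × ℂ → ℂ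
  | .U₁ => fun q => G₁ q.1 * q.2 ^ j
  | .U₂ => fun q => G₂ q.1 * q.2 ^ j
  | .U₃ => fun q => G₁ q.1 * q.2 ^ (b - j).toNat
  | .U₄ => fun q => G₂ q.1 * q.2 ^ (b - j).toNat

/-- Since v is multiplied by u⁻¹ in passing from `U₂` to `U₁`, the factor v ^ j uses up j of the
degree a + b, and its coefficient is a section of 𝒪(a + b - j) on the base. -/
lemma isSection_fibreMonomial {e : ℂ → ℂ} {j : ℕ} (hj : j ≤ D.2) {G₂ G₁ : ℂ → ℂ}
    (h₂ : ContDiff ℝ ∞ G₂) (h₁ : ContDiff ℝ ∞ G₁)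
    (h : ∀ u ≠ 0, e u * G₁ u⁻¹ = u ^ (-(D.1 + D.2 - j)) * G₂ u) :
    IsSection e D (fibreMonomial D.2 j G₂ G₁) := by
  have hs : ∀ {G : ℂ → ℂ} (k : ℕ), ContDiff ℝ ∞ G →
      ContDiff ℝ ∞ (fun q : ℂ × ℂ => G q.1 * q.2 ^ k) := fun k hG =>
    (hG.comp contDiff_fst).mul (contDiff_snd.pow k)
  have hf : ∀ {v : ℂ}, v ≠ 0 → v⁻¹ ^ (D.2 - j).toNat = v ^ (-D.2) * v ^ j := by
    intro v hv
    rw [← zpow_natCast, ← zpow_natCast, Int.toNat_of_nonneg (by omega), inv_zpow, ← zpow_neg,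
      ← zpow_add₀ hv]
    congr 1; ring
  refine ⟨fun i => ?_, fun {u} v hu => ?_, fun {u} w hu => ?_, fun u {v} hv => ?_,
    fun u {v} hv => ?_⟩
  · cases i
    exacts [hs _ h₁, hs _ h₂, hs _ h₁, hs _ h₂]
  · simp only [fibreMonomial]
    rw [← mul_assoc, h u hu, mul_pow, inv_pow, ← zpow_natCast u, ← zpow_neg]
    have : u ^ (-(D.1 + D.2 - j)) * u ^ (-(j : ℤ)) = u ^ (-D.1) * u ^ (-D.2) := by
      rw [← zpow_add₀ hu, ← zpow_add₀ hu]; congr 1; ring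
    rw [← this]; ring
  · simp only [fibreMonomial]
    rw [← mul_assoc, h u hu, mul_pow, ← zpow_natCast u, Int.toNat_of_nonneg (by omega)]
    have : u ^ (-(D.1 + D.2 - j)) * u ^ (D.2 - j) = u ^ (-D.1) := by
      rw [← zpow_add₀ hu]; congr 1; ring
    rw [← this]; ring
  · simp only [fibreMonomial, hf hv]; ring
  · simp only [fibreMonomial, hf hv]; ring

lemma dbarDir_fst_mul_pow {A : ℂ → ℂ} (hA : ContDiff ℝ ∞ A) (k : ℕ) (u v : ℂ) :
    dbarDir (1, 0) (fun q : ℂ × ℂ => A q.1 * q.2 ^ k) (u, v) = dbarOne A u * v ^ k := by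
  have hs : ContDiff ℝ ∞ (fun q : ℂ × ℂ => A q.1 * q.2 ^ k) :=
    (hA.comp contDiff_fst).mul (contDiff_snd.pow k)
  rw [dbarDir_fst (hs.differentiable (by simp) _)]
  simp only [dbarOne, fderiv_mul_const (hA.differentiable (by simp) u), _root_.smul_apply,
    smul_eq_mul]
  ring

/-- The case of `exists_dbar_eq` in which the data do not depend on the parameter. -/
lemma exists_base_solution {n : ℤ} (hn : -1 ≤ n) {C₂ C₁ : ℂ → ℂ} (h₂ : ContDiff ℝ ∞ C₂)
    (h₁ : ContDiff ℝ ∞ C₁) (h : ∀ u ≠ 0, formTwist u * C₁ u⁻¹ = u ^ (-n) * C₂ u) :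
    ∃ G₂ G₁ : ℂ → ℂ, ContDiff ℝ ∞ G₂ ∧ ContDiff ℝ ∞ G₁ ∧ (∀ u, dbarOne G₂ u = C₂ u) ∧
      ∀ u ≠ 0, 1 * G₁ u⁻¹ = u ^ (-n) * G₂ u := by
  obtain ⟨g₀, g₁, s₀, s₁, d₀, -, e⟩ := exists_dbar_eq hn (f₀ := fun q => C₂ q.2)
    (f₁ := fun q => C₁ q.2) (h₂.comp contDiff_snd) (h₁.comp contDiff_snd) fun p v hv => h v hv
  refine ⟨fun u => g₀ (0, u), fun u => g₁ (0, u), s₀.comp (contDiff_prodMk_right 0),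
    s₁.comp (contDiff_prodMk_right 0), fun u => ?_, fun u hu => by rw [one_mul]; exact e 0 u hu⟩
  rw [← dbarDir_snd (s₀.differentiable (by simp) _), d₀]

lemma differentiable_fibre {s : ℂ × ℂ → ℂ} (hs : ContDiff ℝ ∞ s) (h : dbarDir (0, 1) s = 0)
    (u : ℂ) : Differentiable ℂ fun v => s (u, v) := by
  refine differentiable_of_dbarOne ((hs.comp (contDiff_prodMk_right u)).differentiable (by simp))
    fun v => ?_
  rw [← dbarDir_snd (hs.differentiable (by simp) _), h]
  rfl

lemma differentiable_base {s : ℂ × ℂ → ℂ} (hs : ContDiff ℝ ∞ s) (h : dbarDir (1, 0) s = 0)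
    (v : ℂ) : Differentiable ℂ fun u => s (u, v) := by
  refine differentiable_of_dbarOne ((hs.comp (contDiff_prodMk_left v)).differentiable (by simp))
    fun u => ?_
  rw [← dbarDir_fst (hs.differentiable (by simp) _), h]
  rfl

section FibreHolomorphic

variable {e : ℂ → ℂ} {t : Chart → ℂ × ℂ → ℂ}

lemma continuousAt_fibre (ht : IsSection e D t) (i : Chart) (u v : ℂ) :
    ContinuousAt (fun w => t i (u, w)) v :=
  ((ht.smooth i).continuous.comp (Continuous.prodMk_right u)).continuousAt

lemma IsSection.eq_neg_one (ht : IsSection e D t) (hb : D.2 = -1)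
    (h : dbarDir (0, 1) (t .U₂) = 0) (u v : ℂ) : t .U₂ (u, v) = 0 :=
  section_neg_one (differentiable_fibre (ht.smooth _) h u) (continuousAt_fibre ht .U₄ u 0)
    (fun v hv => by rw [ht.fibre₂₄ u hv, hb]) v

lemma IsSection.eq_zero (ht : IsSection e D t) (hb : D.2 = 0)
    (h : dbarDir (0, 1) (t .U₂) = 0) (u v : ℂ) : t .U₂ (u, v) = t .U₂ (u, 0) :=
  section_zero (differentiable_fibre (ht.smooth _) h u) (continuousAt_fibre ht .U₄ u 0)
    (fun v hv => by rw [ht.fibre₂₄ u hv, hb]) v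

lemma IsSection.eq_one (ht : IsSection e D t) (hb : D.2 = 1)
    (h : dbarDir (0, 1) (t .U₂) = 0) (u v : ℂ) :
    t .U₂ (u, v) = t .U₂ (u, 0) + t .U₄ (u, 0) * v :=
  section_one (differentiable_fibre (ht.smooth _) h u) (continuousAt_fibre ht .U₄ u 0)
    (fun v hv => by rw [ht.fibre₂₄ u hv, hb]) v

/-- Restriction to the curve v = 0, where 𝒪(a,b) has degree a + b; on v = ∞ the degree is a. The
exponents keep the form a + b - j of `isSection_fibreMonomial`. -/
lemma IsSection.restrict_zero (ht : IsSection e D t) {u : ℂ} (hu : u ≠ 0) :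
    e u * t .U₁ (u⁻¹, 0) = u ^ (-(D.1 + D.2 - (0 : ℕ))) * t .U₂ (u, 0) := by
  have := ht.base₂₁ 0 hu
  rw [zero_mul, ← zpow_add₀ hu] at this
  rw [this]; congr 2; push_cast; ring

lemma IsSection.restrict_infty (ht : IsSection e D t) (hb : D.2 = 1) {u : ℂ} (hu : u ≠ 0) :
    e u * t .U₃ (u⁻¹, 0) = u ^ (-(D.1 + D.2 - (1 : ℕ))) * t .U₄ (u, 0) := by
  have := ht.base₄₃ 0 hu
  rw [mul_zero] at this
  rw [this]; congr 2; rw [hb]; push_cast; ring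

end FibreHolomorphic

/-- The direct image of 𝒪(a,b) on ℂP¹ is the sum of the 𝒪(a + b - j), 0 ≤ j ≤ b. The coefficients of
`t` as a polynomial in v are its restrictions to v = 0 and v = ∞; each is integrated on the base,
where the degree is at least -1. For b = -1 the form `t` is zero on `U₂`. -/
lemma exists_fun_of_fibre_holomorphic (hab : D.2 = -1 ∨ (D.2 = 0 ∨ D.2 = 1) ∧ -1 ≤ D.1)
    {t : Chart → ℂ × ℂ → ℂ} (ht : IsSection formTwist D t) (h : dbarDir (0, 1) (t .U₂) = 0) :
    ∃ s, IsSection (fun _ => 1) D s ∧ dbarDir (1, 0) (s .U₂) = t .U₂ ∧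
      dbarDir (0, 1) (s .U₂) = 0 := by
  have hr : ∀ i, ContDiff ℝ ∞ fun u => t i (u, 0) := fun i =>
    (ht.smooth i).comp (contDiff_prodMk_left 0)
  rcases hab with hb | ⟨hb | hb, ha⟩
  · have z : (0 : Chart → ℂ × ℂ → ℂ) .U₂ = (0 : ℂ × ℂ → ℂ) := rfl
    refine ⟨0, ⟨fun i => contDiff_const, ?_, ?_, ?_, ?_⟩, ?_, ?_⟩
    · intros; simp
    · intros; simp
    · intros; simp
    · intros; simp
    · rw [z, dbarDir_zero]
      funext ⟨u, v⟩
      exact (ht.eq_neg_one hb h u v).symm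
    · rw [z, dbarDir_zero]
  · obtain ⟨G₂, G₁, s₂, s₁, d, c⟩ := exists_base_solution (by rw [hb]; push_cast; omega)
      (hr .U₂) (hr .U₁) fun u hu => ht.restrict_zero hu
    refine ⟨_, isSection_fibreMonomial (j := 0) (by rw [hb]; rfl) s₂ s₁ c, ?_,
      dbarDir_snd_mul_pow s₂ 0⟩
    funext ⟨u, v⟩
    simp only [fibreMonomial]
    rw [dbarDir_fst_mul_pow s₂, d, ht.eq_zero hb h u v, pow_zero, mul_one]
  · obtain ⟨G₂, G₁, s₂, s₁, d, c⟩ := exists_base_solution (by rw [hb]; push_cast; omega)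
      (hr .U₂) (hr .U₁) fun u hu => ht.restrict_zero hu
    obtain ⟨G₂', G₁', s₂', s₁', d', c'⟩ := exists_base_solution (by rw [hb]; push_cast; omega)
      (hr .U₄) (hr .U₃) fun u hu => ht.restrict_infty hb hu
    have i₀ := isSection_fibreMonomial (j := 0) (by rw [hb]; norm_num) s₂ s₁ c
    have i₁ := isSection_fibreMonomial (j := 1) (by rw [hb]; rfl) s₂' s₁' c'
    refine ⟨_, i₀.add i₁, ?_, ?_⟩
    · rw [Pi.add_apply, dbarDir_fun_add (i₀.smooth _) (i₁.smooth _)]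
      funext ⟨u, v⟩
      simp only [fibreMonomial, Pi.add_apply]
      rw [dbarDir_fst_mul_pow s₂, dbarDir_fst_mul_pow s₂', d, d', ht.eq_one hb h u v, pow_zero,
        mul_one, pow_one]
    · rw [Pi.add_apply, dbarDir_fun_add (i₀.smooth _) (i₁.smooth _)]
      simp only [fibreMonomial]
      rw [dbarDir_snd_mul_pow s₂, dbarDir_snd_mul_pow s₂', add_zero]

/-- Vanishing of the second cohomology. -/
theorem exists_dgDiff_eq_of_two (hb : D.2 = -1 ∨ D.2 = 0 ∨ D.2 = 1) {ψ : DGHom D}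
    (hψ : ψ ∈ dgDeg D 2) : ∃ h ∈ dgDeg D 1, dgDiff h = ψ := by
  obtain ⟨s, hs, hd⟩ := exists_fibre_solution formTwist_ne_zero hb
    (f := fun i => ψ.1 i .dudv) (fun i => ψ.2.1 i _) fun i p hp => by
      have h := ψ.2.2 i .dudv p hp
      rw [(pullback_coord i (ψ.1 i) hp).2.2.2] at h
      rw [baseTwist_formTwist, ← map_mul, h]
  -- The differential is 2 ∂̄, and ∂̄ (s dū) = -(∂s/∂v̄) dū ∧ dv̄.
  refine ⟨(-1 / 2 : ℂ) • ofDu s hs, Submodule.smul_mem _ _ (ofDu_mem s hs), ?_⟩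
  rw [dgDiff_smul]
  refine DGHom.ext_chart fun i => ?_
  rw [DGHom.smul_apply, dgDiff_apply]
  funext k p
  cases k
  · simp [LocalForm.dbar, hψ i .one (by decide)]
  · simp [LocalForm.dbar, hψ i .du (by decide), ofDu]
  · simp [LocalForm.dbar, hψ i .dv (by decide), ofDu]
  · simp [LocalForm.dbar, ofDu, hd]
    ring

/-- Vanishing of the first cohomology. -/
theorem exists_dgDiff_eq_of_one (hab : D.2 = -1 ∨ (D.2 = 0 ∨ D.2 = 1) ∧ -1 ≤ D.1) {ψ : DGHom D}
    (hψ : ψ ∈ dgDeg D 1) (hd : dgDiff ψ = 0) : ∃ h ∈ dgDeg D 0, dgDiff h = ψ := by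
  obtain ⟨s, hs, hsd⟩ := exists_fibre_solution (e := fun _ => 1) (fun _ _ => one_ne_zero)
    (by tauto) (f := fun i => ψ.1 i .dv) (fun i => ψ.2.1 i _) fun i p hp => by
      have h := ψ.2.2 i .dv p hp
      rw [(pullback_coord i (ψ.1 i) hp).2.2.1] at h
      rw [baseTwist_one, one_mul, h]
  -- Subtracting ∂̄ s removes the dv̄-component.
  set χ : DGHom D := ψ + (-1 / 2 : ℂ) • dgDiff (ofFun s hs) with hχ
  have hχd : dgDiff χ = 0 := by
    rw [hχ, dgDiff_add, hd, dgDiff_smul, dgDiff_dgDiff, smul_zero, add_zero]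
  have hχm : χ ∈ dgDeg D 1 :=
    Submodule.add_mem _ hψ (Submodule.smul_mem _ _ (dgDiff_mem (ofFun_mem s hs)))
  have hχv : ∀ i, χ.1 i .dv = 0 := by
    intro i
    funext p
    rw [hχ, DGHom.add_apply, DGHom.smul_apply, dgDiff_apply]
    simp [LocalForm.dbar, ofFun, hsd]
    ring
  -- Without a dv̄-component the mixed Jacobian term disappears, and the dū-coefficient is a genuine
  -- section of a line bundle.
  have ht : IsSection formTwist D fun i => χ.1 i .du := by
    refine IsSection.of_torus formTwist_ne_zero (fun i => χ.2.1 i _) fun i p hp => ?_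
    have h := χ.2.2 i .du p hp
    rw [(pullback_coord i (χ.1 i) hp).2.1, hχv] at h
    rw [baseTwist_formTwist, ← h]
    simp
  have htd : dbarDir (0, 1) (χ.1 .U₂ .du) = 0 := by
    have := dbar_eq_zero hχd .U₂ .dudv
    simpa [LocalForm.dbar, hχv] using this
  obtain ⟨r, hr, hr1, hr2⟩ := exists_fun_of_fibre_holomorphic hab ht htd
  have hfin : (1 / 2 : ℂ) • dgDiff (ofFun r hr) = χ := by
    refine DGHom.ext_torus fun k p _ => ?_
    rw [DGHom.smul_apply, dgDiff_apply]
    cases k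
    · simp [LocalForm.dbar, hχm .U₂ .one (by decide)]
    · simp [LocalForm.dbar, ofFun, hr1]
    · simp [LocalForm.dbar, ofFun, hr2, hχv]
    · simp [LocalForm.dbar, hχm .U₂ .dudv (by decide), ofFun]
  refine ⟨(1 / 2 : ℂ) • ofFun r hr + (1 / 2 : ℂ) • ofFun s hs,
    Submodule.add_mem _ (Submodule.smul_mem _ _ (ofFun_mem r hr))
      (Submodule.smul_mem _ _ (ofFun_mem s hs)), ?_⟩
  rw [dgDiff_add, dgDiff_smul, dgDiff_smul, hfin, hχ, add_assoc, ← add_smul]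
  norm_num

/-! ### Closed forms of degree 0 -/

/-- The holomorphic section `u ^ i * v ^ j`. -/
def monomial (D : ℤ × ℤ) (i j : ℕ) (hj : j ≤ D.2) (hi : i ≤ D.1 + D.2 - j) : DGHom D :=
  ofFun (fibreMonomial D.2 j (fun u => u ^ i) fun u => u ^ (D.1 + D.2 - j - i).toNat)
    (isSection_fibreMonomial hj (contDiff_id.pow _) (contDiff_id.pow _) fun u hu => by
      rw [← zpow_natCast, ← zpow_natCast, Int.toNat_of_nonneg (by omega), inv_zpow, ← zpow_neg,
        ← zpow_add₀ hu, one_mul]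
      congr 1; ring)

lemma monomial_apply (i j : ℕ) (hj : j ≤ D.2) (hi : i ≤ D.1 + D.2 - j) (p : ℂ × ℂ) :
    (monomial D i j hj hi).1 .U₂ .one p = p.1 ^ i * p.2 ^ j := rfl

lemma monomial_mem (i j : ℕ) (hj : j ≤ D.2) (hi : i ≤ D.1 + D.2 - j) :
    monomial D i j hj hi ∈ dgDeg D 0 := ofFun_mem _ _

lemma dgDiff_monomial (i j : ℕ) (hj : j ≤ D.2) (hi : i ≤ D.1 + D.2 - j) :
    dgDiff (monomial D i j hj hi) = 0 := by
  refine DGHom.ext_torus fun k p _ => ?_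
  have hh : DifferentiableAt ℂ (fun q : ℂ × ℂ => q.1 ^ i * q.2 ^ j) p := by fun_prop
  have hz : ∀ w, dbarDir w ((monomial D i j hj hi).1 .U₂ .one) p = 0 := fun w => dbarDir_holo w hh
  rw [dgDiff_apply]
  cases k
  · simp [LocalForm.dbar]
  · simp [LocalForm.dbar, hz]
  · simp [LocalForm.dbar, hz]
  · simp [LocalForm.dbar, monomial, ofFun]

/-- Closed forms of degree `0` with values in `𝒪(a,-1)` vanish. -/
lemma eq_zero_of_closed (hb : D.2 = -1) {ψ : DGHom D} (hψ : ψ ∈ dgDeg D 0)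
    (hd : dgDiff ψ = 0) : ψ = 0 := by
  have hs : IsSection (fun _ => 1) D fun i => ψ.1 i .one := by
    refine IsSection.of_torus (fun _ _ => one_ne_zero) (fun i => ψ.2.1 i _) fun i p hp => ?_
    rw [baseTwist_one, one_mul]
    exact ψ.2.2 i .one p hp
  refine DGHom.ext_torus fun k p _ => ?_
  by_cases hk : k.degree = 0
  · cases k <;> first
      | exact hs.eq_neg_one hb (dbar_eq_zero hd .U₂ .dv) p.1 p.2
      | simp [Comp.degree] at hk
  · rw [hψ _ _ hk]; rfl

/-- The holomorphic sections of `𝒪(a,0)` and `𝒪(a,1)`, `a ≥ -1`, are combinations of monomials. -/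
theorem mem_span_monomial (hb : D.2 = 0 ∨ D.2 = 1) (ha : -1 ≤ D.1) {ψ : DGHom D}
    (hψ : ψ ∈ dgDeg D 0) (hd : dgDiff ψ = 0) :
    ψ ∈ Submodule.span ℂ {χ | ∃ i j hj hi, χ = monomial D i j hj hi} := by
  have hs : IsSection (fun _ => 1) D fun i => ψ.1 i .one := by
    refine IsSection.of_torus (fun _ _ => one_ne_zero) (fun i => ψ.2.1 i _) fun i p hp => ?_
    rw [baseTwist_one, one_mul]
    exact ψ.2.2 i .one p hp
  have hv : dbarDir (0, 1) (ψ.1 .U₂ .one) = 0 := dbar_eq_zero hd .U₂ .dv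
  have hu : ∀ i, dbarDir (1, 0) (ψ.1 i .one) = 0 := fun i => dbar_eq_zero hd i .du
  have hc : ∀ i : Chart, ContinuousAt (fun u => ψ.1 i .one (u, 0)) 0 := fun i =>
    ((hs.smooth i).continuous.comp (Continuous.prodMk_left 0)).continuousAt
  obtain ⟨c, hc₀⟩ := exists_eq_sum_of_section (n := D.1 + D.2 - (0 : ℕ))
    (by push_cast; omega) (differentiable_base (hs.smooth .U₂) (hu .U₂) 0) (hc .U₁)
    fun u hu => by rw [← hs.restrict_zero hu, one_mul]
  have hsum : ∀ (j : ℕ) (hj : j ≤ D.2) (c : ℕ → ℂ),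
      ∃ χ ∈ Submodule.span ℂ {χ | ∃ i j hj hi, χ = monomial D i j hj hi}, χ ∈ dgDeg D 0 ∧
      ∀ p : ℂ × ℂ, χ.1 .U₂ .one p
        = (∑ i ∈ Finset.range (D.1 + D.2 - j + 1).toNat, c i * p.1 ^ i) * p.2 ^ j := by
    intro j hj c
    have key : ∀ N : ℕ, N ≤ (D.1 + D.2 - j + 1).toNat →
        ∃ χ ∈ Submodule.span ℂ {χ | ∃ i j hj hi, χ = monomial D i j hj hi}, χ ∈ dgDeg D 0 ∧
        ∀ p : ℂ × ℂ, χ.1 .U₂ .one p = (∑ i ∈ Finset.range N, c i * p.1 ^ i) * p.2 ^ j := by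
      intro N
      induction N with
      | zero => exact fun _ => ⟨0, zero_mem _, zero_mem _, fun p => by simp⟩
      | succ N ih =>
        intro hN
        obtain ⟨χ, h1, h2, h3⟩ := ih (by omega)
        refine ⟨χ + c N • monomial D N j hj (by omega),
          add_mem h1 (Submodule.smul_mem _ _ (Submodule.subset_span ⟨_, _, _, _, rfl⟩)),
          add_mem h2 (Submodule.smul_mem _ _ (monomial_mem _ _ _ _)), fun p => ?_⟩
        rw [DGHom.add_apply, DGHom.smul_apply]
        simp only [Pi.add_apply, Pi.smul_apply, h3, monomial_apply, smul_eq_mul,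
          Finset.sum_range_succ]
        ring
    exact key _ le_rfl
  have hext : ∀ χ : DGHom D, χ ∈ dgDeg D 0 →
      (∀ p, ψ.1 .U₂ .one p = χ.1 .U₂ .one p) → ψ = χ := by
    intro χ hχ h
    refine DGHom.ext_torus fun k p _ => ?_
    by_cases hk : k.degree = 0
    · cases k <;> first | exact h p | simp [Comp.degree] at hk
    · rw [hψ _ _ hk, hχ _ _ hk]
  rcases hb with hb | hb
  · obtain ⟨χ, h1, h2, h3⟩ := hsum 0 (by rw [hb]; rfl) c
    rw [hext χ h2 fun p => ?_]
    · exact h1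
    · rw [h3, ← hc₀ p.1, pow_zero, mul_one]
      exact hs.eq_zero hb hv p.1 p.2
  · obtain ⟨d, hd₀⟩ := exists_eq_sum_of_section (n := D.1 + D.2 - (1 : ℕ))
      (by rw [hb]; push_cast; omega) (differentiable_base (hs.smooth .U₄) (hu .U₄) 0) (hc .U₃)
      fun u hu => by rw [← hs.restrict_infty hb hu, one_mul]
    obtain ⟨χ, h1, h2, h3⟩ := hsum 0 (by rw [hb]; norm_num) c
    obtain ⟨χ', h1', h2', h3'⟩ := hsum 1 (by rw [hb]; norm_num) d
    rw [hext (χ + χ') (add_mem h2 h2') fun p => ?_]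
    · exact add_mem h1 h1'
    · rw [DGHom.add_apply]
      simp only [Pi.add_apply]
      rw [h3, h3', ← hc₀ p.1, ← hd₀ p.1, pow_zero, mul_one, pow_one]
      exact hs.eq_one hb hv p.1 p.2

end Cohomology

/-! ### Generators of the morphism spaces of the Morse homotopy category -/

/-- The differences `(a, b)` of line bundles in the collection which have sections. -/
def Effective (δ : ℤ × ℤ) : Prop := δ.2 = 0 ∧ 0 ≤ δ.1 ∨ δ.2 = 1 ∧ -1 ≤ δ.1

lemma lagDiff_eq (D D' : ℤ × ℤ) (x : ℝ × ℝ) : lagDiff D D' x = lagSection (D' - D) x := by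
  ext
  · simp [lagDiff, lagSection]; ring
  · simp [lagDiff, lagSection]; ring

/-- Once the second equation fixes b x², the first becomes linear in x after clearing the
denominator; this is what makes the level sets convex. -/
lemma lagSection_eq_iff (δ : ℤ × ℤ) {x : ℝ × ℝ} (hx : x.2 < 4) (i j : ℝ) :
    lagSection δ x = (i, j) ↔
      δ.2 * x.2 = 2 * j ∧ (δ.1 + δ.2 - j) * x.1 = i * (4 - x.2) := by
  have h4 : 2 * (4 - x.2) ≠ 0 := by linarith
  simp only [lagSection, Prod.mk.injEq, div_eq_iff h4]
  constructor
  · rintro ⟨h1, h2⟩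
    have h3 : (δ.2 : ℝ) * x.2 = 2 * j := by linarith
    refine ⟨h3, ?_⟩
    linear_combination h1 / 2 + x.1 / 2 * h3
  · rintro ⟨h1, h2⟩
    refine ⟨?_, by linarith⟩
    linear_combination 2 * h2 - x.1 * h1

/-- The points of the polytope where the difference of two sections is `(i, j)`. -/
def fibreSet (δ : ℤ × ℤ) (i j : ℝ) : Set (ℝ × ℝ) := {x ∈ polytope | lagSection δ x = (i, j)}

lemma polytope_lt {x : ℝ × ℝ} (hx : x ∈ polytope) : x.2 < 4 := by
  obtain ⟨-, -, -, h⟩ := hx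
  linarith

lemma mem_fibreSet_iff {δ : ℤ × ℤ} {i j : ℝ} {x : ℝ × ℝ} :
    x ∈ fibreSet δ i j ↔ x ∈ polytope ∧ δ.2 * x.2 = 2 * j ∧
      (δ.1 + δ.2 - j) * x.1 = i * (4 - x.2) := by
  constructor
  · rintro ⟨h1, h2⟩
    exact ⟨h1, (lagSection_eq_iff δ (polytope_lt h1) i j).1 h2⟩
  · rintro ⟨h1, h2⟩
    exact ⟨h1, (lagSection_eq_iff δ (polytope_lt h1) i j).2 h2⟩

lemma convex_polytope : Convex ℝ polytope := by
  rintro x ⟨a1, a2, a3, a4⟩ y ⟨b1, b2, b3, b4⟩ s t hs ht hst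
  have ht' : t = 1 - s := by linarith
  subst ht'
  refine ⟨?_, ?_, ?_, ?_⟩ <;> simp <;> nlinarith

lemma convex_fibreSet (δ : ℤ × ℤ) (i j : ℝ) : Convex ℝ (fibreSet δ i j) := by
  intro x hx y hy s t hs ht hst
  rw [mem_fibreSet_iff] at hx hy ⊢
  obtain ⟨hx, x1, x2⟩ := hx
  obtain ⟨hy, y1, y2⟩ := hy
  refine ⟨convex_polytope hx hy hs ht hst, ?_, ?_⟩
  · simp only [Prod.snd_add, Prod.smul_snd, smul_eq_mul]
    linear_combination s * x1 + t * y1 + 2 * j * hst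
  · simp only [Prod.snd_add, Prod.smul_snd, smul_eq_mul, Prod.fst_add, Prod.smul_fst]
    linear_combination s * x2 + t * y2 + 4 * i * hst

lemma intersection_eq (D D' : ℤ × ℤ) :
    intersection D D' = ⋃ (i : ℤ) (j : ℤ), fibreSet (D' - D) i j := by
  ext x
  simp [intersection, fibreSet, lagDiff_eq]

lemma continuousOn_lagSection (δ : ℤ × ℤ) : ContinuousOn (lagSection δ) polytope := by
  unfold lagSection
  refine ContinuousOn.prodMk (ContinuousOn.div (by fun_prop) (by fun_prop) fun x hx => ?_)
    (by fun_prop)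
  have := polytope_lt hx
  linarith

/-- On the intersection the difference of the sections is continuous with integral values, hence
constant on components; conversely its level sets are convex. -/
lemma component_eq {D D' : ℤ × ℤ} {i j : ℤ} {v : ℝ × ℝ} (hv : v ∈ fibreSet (D' - D) i j) :
    connectedComponentIn (intersection D D') v = fibreSet (D' - D) i j := by
  have hsub : fibreSet (D' - D) i j ⊆ intersection D D' := by
    rw [intersection_eq]
    exact subset_iUnion_of_subset i (subset_iUnion_of_subset j le_rfl)
  have hvI : v ∈ intersection D D' := hsub hv
  apply Subset.antisymm
  · have hpre : IsPreconnected (connectedComponentIn (intersection D D') v) :=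
      isPreconnected_connectedComponentIn
    have hin := connectedComponentIn_subset (intersection D D') v
    have hvm := mem_connectedComponentIn hvI
    have hcont : ContinuousOn (lagSection (D' - D)) (connectedComponentIn (intersection D D') v) :=
      (continuousOn_lagSection _).mono fun x hx => (hin hx).1
    have hdisc : IsDiscrete (range ((↑) : ℤ → ℝ)) :=
      Int.isClosedEmbedding_coe_real.isEmbedding.isInducing.isDiscrete_range
    have hval : ∀ x ∈ connectedComponentIn (intersection D D') v,
        ∃ i j : ℤ, lagSection (D' - D) x = ((i : ℝ), (j : ℝ)) := by
      intro x hx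
      obtain ⟨-, i, j, h⟩ := hin hx
      exact ⟨i, j, by rw [← lagDiff_eq, h]⟩
    have e1 : ∀ x ∈ connectedComponentIn (intersection D D') v,
        (lagSection (D' - D) x).1 = (lagSection (D' - D) v).1 := by
      intro x hx
      obtain ⟨y, -, hy⟩ := hpre.eqOn_const_of_mapsTo (T := range ((↑) : ℤ → ℝ)) hdisc
        (f := fun x => (lagSection (D' - D) x).1) (continuous_fst.comp_continuousOn hcont)
        (fun x hx => by obtain ⟨i, j, h⟩ := hval x hx; exact ⟨i, by simp only [h]⟩) (range_nonempty _)
      exact (hy hx).trans (hy hvm).symm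
    have e2 : ∀ x ∈ connectedComponentIn (intersection D D') v,
        (lagSection (D' - D) x).2 = (lagSection (D' - D) v).2 := by
      intro x hx
      obtain ⟨y, -, hy⟩ := hpre.eqOn_const_of_mapsTo (T := range ((↑) : ℤ → ℝ)) hdisc
        (f := fun x => (lagSection (D' - D) x).2) (continuous_snd.comp_continuousOn hcont)
        (fun x hx => by obtain ⟨i, j, h⟩ := hval x hx; exact ⟨j, by simp only [h]⟩) (range_nonempty _)
      exact (hy hx).trans (hy hvm).symm
    intro x hx
    exact ⟨(hin hx).1, (Prod.ext (e1 x hx) (e2 x hx)).trans hv.2⟩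
  · exact (convex_fibreSet _ _ _).isPreconnected.subset_connectedComponentIn hv hsub

lemma MoGen.exists_fibreSet {D D' : ℤ × ℤ} (V : MoGen D D') :
    ∃ i j : ℤ, V.1 = fibreSet (D' - D) i j ∧
      ∃ v ∈ V.1, stableManifold D D' v ∩ polytope ∈ 𝓝[stableManifold D D' v] v := by
  obtain ⟨V, ⟨v, hv, rfl⟩, h⟩ := V
  have hv' := hv
  rw [intersection_eq] at hv'
  simp only [mem_iUnion] at hv'
  obtain ⟨i, j, hij⟩ := hv'
  exact ⟨i, j, component_eq hij, h⟩

/-- A straight trajectory into `v` which leaves the polytope excludes `v` as an interior point. -/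
lemma not_mem_nhdsWithin_stableManifold {D D' : ℤ × ℤ} {v w : ℝ × ℝ} {lam : ℝ} (hlam : 0 < lam)
    (h : ∀ r ∈ Ico (0 : ℝ) 1, v + r • w ∈ ambient ∧
      gradField D D' v (v + r • w) = (-lam * r) • w)
    (hP : ∀ r ∈ Ioo (0 : ℝ) 1, v + r • w ∉ polytope) :
    stableManifold D D' v ∩ polytope ∉ 𝓝[stableManifold D D' v] v := by
  intro hmem
  have hS : ∀ s ∈ Ioo (0 : ℝ) 1, v + s • w ∈ stableManifold D D' v := by
    intro s hs
    have hr : ∀ t ∈ Ici (0 : ℝ), s * Real.exp (-lam * t) ∈ Ico (0 : ℝ) 1 := by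
      intro t ht
      have ht' : 0 ≤ t := ht
      have h1 : Real.exp (-lam * t) ≤ 1 := Real.exp_le_one_iff.2 (by nlinarith)
      have h2 := Real.exp_pos (-lam * t)
      obtain ⟨hs0, hs1⟩ := hs
      exact ⟨by positivity, by nlinarith⟩
    -- On the segment the field is radial, r' = -lam r, and the solution starting at r = s remains
    -- on it.
    refine ⟨fun t => v + (s * Real.exp (-lam * t)) • w, by simp, fun t ht => ?_, ?_⟩
    · obtain ⟨h1, h2⟩ := h _ (hr t ht)
      refine ⟨h1, ?_⟩
      rw [h2]
      apply HasDerivAt.hasDerivWithinAt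
      have hd : HasDerivAt (fun t => s * Real.exp (-lam * t)) (-lam * (s * Real.exp (-lam * t)))
          t := by
        have := (((hasDerivAt_id t).const_mul (-lam)).exp).const_mul s
        refine this.congr_deriv ?_
        simp; ring
      exact (hd.smul_const w).const_add v
    · have h1 : Tendsto (fun t => Real.exp (-lam * t)) atTop (𝓝 0) := by
        apply Real.tendsto_exp_atBot.comp
        exact tendsto_id.const_mul_atTop_of_neg (by linarith)
      have h2 := ((h1.const_mul s).smul_const w).const_add v
      simpa using h2
  rw [mem_nhdsWithin_iff_exists_mem_nhds_inter] at hmem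
  obtain ⟨U, hU, hUS⟩ := hmem
  have ht : Tendsto (fun r : ℝ => v + r • w) (𝓝[>] 0) (𝓝 v) := by
    have : Tendsto (fun r : ℝ => v + r • w) (𝓝 0) (𝓝 (v + (0 : ℝ) • w)) :=
      (by fun_prop : Continuous fun r : ℝ => v + r • w).tendsto 0
    rw [zero_smul, add_zero] at this
    exact this.mono_left nhdsWithin_le_nhds
  have hev : ∀ᶠ r in 𝓝[>] (0 : ℝ), r ∈ Ioo (0 : ℝ) 1 :=
    Ioo_mem_nhdsGT one_pos
  obtain ⟨r, hr1, hr2⟩ := ((ht.eventually hU).and hev).exists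
  exact hP r hr2 (hUS ⟨hr1, hS r hr2⟩).2

lemma int_mem_zero_one {x : ℝ} {n : ℤ} (hx : x = n) (h0 : 0 ≤ x) (h1 : x ≤ 1) : x = 0 ∨ x = 1 := by
  rw [hx] at h0 h1
  have h0' : (0 : ℤ) ≤ n := by exact_mod_cast h0
  have h1' : n ≤ 1 := by exact_mod_cast h1
  have : n = 0 ∨ n = 1 := by omega
  rcases this with rfl | rfl <;> simp [hx]

/-- There are no morphisms against the order of the collection. -/
lemma MoGen.isEmpty {D D' : ℤ × ℤ} (h : (D' - D).2 = -1 ∨ D' - D = (-1, 0)) :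
    IsEmpty (MoGen D D') := by
  refine ⟨fun V => ?_⟩
  obtain ⟨i, j, hV, v, hv, hn⟩ := V.exists_fibreSet
  rw [hV, mem_fibreSet_iff] at hv
  obtain ⟨hP, h1, h2⟩ := hv
  have h4 := polytope_lt hP
  obtain ⟨p1, p2, p3, p4⟩ := hP
  have h4' : 4 - v.2 ≠ 0 := by linarith
  rcases h with h | h
  · rw [h] at h1
    push_cast at h1
    -- Here v lies on the bottom or top side. The direction is that of the line x¹ / (4 - x²) =
    -- const through v, on which the flow contracts x² at rate 1/2.
    have key : ∀ σ : ℝ, (∀ r ∈ Ioo (0 : ℝ) 1, v.2 + r * σ < 0 ∨ 2 < v.2 + r * σ) →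
        (∀ r ∈ Ico (0 : ℝ) 1, v.2 + r * σ < 4) → False := by
      intro σ hσ hσ'
      refine not_mem_nhdsWithin_stableManifold (D := D) (D' := D') (v := v)
        (w := (-(v.1 / (4 - v.2)) * σ, σ)) (lam := 1 / 2) (by norm_num) ?_ ?_ hn
      · intro r hr
        have h5 := hσ' r hr
        refine ⟨by simpa [ambient] using h5, ?_⟩
        have h5' : 4 - (v.2 + r * σ) ≠ 0 := by linarith
        rw [gradField, lagDiff_eq, lagDiff_eq]
        simp only [lagSection, h]
        ext
        · simp
          field_simp
          ring
        · simp
          ring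
      · rintro r hr ⟨-, -, q3, q4⟩
        simp at q3 q4
        rcases hσ r hr with h6 | h6 <;> linarith
    rcases int_mem_zero_one (x := v.2 / 2) (n := -j) (by push_cast; linarith) (by linarith)
      (by linarith) with h0 | h0
    · refine key (-1) (fun r hr => Or.inl ?_) fun r hr => ?_
      · linarith [hr.1]
      · linarith [hr.1]
    · refine key 1 (fun r hr => Or.inr ?_) fun r hr => ?_
      · linarith [hr.1]
      · linarith [hr.2]
  · have hj : (j : ℝ) = 0 := by rw [h] at h1; push_cast at h1; linarith
    rw [h, hj] at h2
    push_cast at h2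
    -- Here v lies on the left or right side; x² is constant along the flow and x¹ contracts at rate
    -- 1 / (4 - x²).
    have key : ∀ σ : ℝ, (∀ r ∈ Ioo (0 : ℝ) 1, v.1 + r * σ < 0 ∨ 4 - v.2 < v.1 + r * σ) →
        False := by
      intro σ hσ
      refine not_mem_nhdsWithin_stableManifold (D := D) (D' := D') (v := v)
        (w := (σ, 0)) (lam := 1 / (4 - v.2)) (one_div_pos.2 (by linarith)) ?_ ?_ hn
      · intro r hr
        refine ⟨by simpa [ambient] using h4, ?_⟩
        rw [gradField, lagDiff_eq, lagDiff_eq]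
        simp only [lagSection, h]
        ext
        · simp
          field_simp
          ring
        · simp
      · rintro r hr ⟨q1, q2, -, -⟩
        simp at q1 q2
        rcases hσ r hr with h6 | h6 <;> linarith
    rcases int_mem_zero_one (x := v.1 / (4 - v.2)) (n := -i)
      (by push_cast; rw [div_eq_iff h4']; linarith) (div_nonneg p1 (by linarith)) (by
        rw [div_le_one (by linarith)]; linarith) with h0 | h0
    · refine key (-1) (fun r hr => Or.inl ?_)
      have : v.1 = 0 := by simpa [h4'] using h0
      linarith [hr.1]
    · refine key 1 (fun r hr => Or.inr ?_)
      rw [div_eq_one_iff_eq h4'] at h0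
      linarith [hr.1]

/-! ### Trajectories -/

lemma hasDerivWithinAt_prod_fst {γ : ℝ → ℝ × ℝ} {w : ℝ × ℝ} {s : Set ℝ} {t : ℝ}
    (h : HasDerivWithinAt γ w s t) : HasDerivWithinAt (fun t => (γ t).1) w.1 s t := by
  simpa using (HasFDerivWithinAt.fst h).hasDerivWithinAt

lemma hasDerivWithinAt_prod_snd {γ : ℝ → ℝ × ℝ} {w : ℝ × ℝ} {s : Set ℝ} {t : ℝ}
    (h : HasDerivWithinAt γ w s t) : HasDerivWithinAt (fun t => (γ t).2) w.2 s t := by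
  simpa using (HasFDerivWithinAt.snd h).hasDerivWithinAt

/-- Solutions of the equation `y' = τ' (y - c)`. -/
lemma eq_of_linear_ode {s : Set ℝ} (hs : Convex ℝ s) (h0 : (0 : ℝ) ∈ s) {y τ τ' : ℝ → ℝ} {c : ℝ}
    (hy : ∀ t ∈ s, HasDerivWithinAt y (τ' t * (y t - c)) s t)
    (hτ : ∀ t ∈ s, HasDerivWithinAt τ (τ' t) s t) (hτ0 : τ 0 = 0) {t : ℝ} (ht : t ∈ s) :
    y t = c + (y 0 - c) * Real.exp (τ t) := by
  have hd : ∀ t ∈ s, HasDerivWithinAt (fun t => (y t - c) * Real.exp (-τ t)) 0 s t := by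
    intro t ht
    refine (((hy t ht).sub_const c).mul (hτ t ht).neg.exp).congr_deriv ?_
    ring
  have hc := hs.norm_image_sub_le_of_norm_hasDerivWithin_le (C := 0) hd (by simp) h0 ht
  have hc' : (y t - c) * Real.exp (-τ t) = (y 0 - c) * Real.exp (-τ 0) := by
    rw [zero_mul, norm_le_zero_iff, sub_eq_zero] at hc
    exact hc
  rw [hτ0, neg_zero, Real.exp_zero, mul_one] at hc'
  rw [← hc', mul_assoc, ← Real.exp_add]
  simp

/-- The exponential is at least 1, so |d| ≤ |y t - c|, which tends to zero. -/
lemma eq_zero_of_tendsto_exp {c d β : ℝ} (hβ : 0 ≤ β) {y : ℝ → ℝ}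
    (hy : ∀ t ≥ 0, y t = c + d * Real.exp (β * t)) (h : Tendsto y atTop (𝓝 c)) : d = 0 := by
  have h1 : Tendsto (fun t => |y t - c|) atTop (𝓝 0) := by
    have := (h.sub_const c).abs
    simpa using this
  have h2 : |d| ≤ 0 := by
    refine ge_of_tendsto h1 ?_
    filter_upwards [eventually_ge_atTop 0] with t ht
    rw [hy t ht, add_sub_cancel_left, abs_mul, abs_of_pos (Real.exp_pos _)]
    have : 1 ≤ Real.exp (β * t) := Real.one_le_exp (by positivity)
    nlinarith [abs_nonneg d]
  exact abs_eq_zero.1 (le_antisymm h2 (abs_nonneg d))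

lemma gradField_eq {D D' : ℤ × ℤ} {v : ℝ × ℝ} {i j : ℝ} (hv : lagSection (D' - D) v = (i, j))
    (x : ℝ × ℝ) : gradField D D' v x = lagSection (D' - D) x - (i, j) := by
  rw [gradField, lagDiff_eq, lagDiff_eq, hv]

lemma gradField_snd {D D' : ℤ × ℤ} (v x : ℝ × ℝ) :
    (gradField D D' v x).2 = ((D' - D).2 : ℝ) / 2 * (x.2 - v.2) := by
  rw [gradField, lagDiff_eq, lagDiff_eq]
  simp [lagSection]
  ring

/-- Trajectories converging to a generator are constant. -/
lemma eq_of_tendsto_generator {D D' : ℤ × ℤ} {i j : ℝ} {v : ℝ × ℝ}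
    (hv : v ∈ fibreSet (D' - D) i j) (hb : 0 ≤ (D' - D).2)
    (hm : 0 ≤ ((D' - D).1 : ℝ) + (D' - D).2 - j) {γ : ℝ → ℝ × ℝ}
    (hγ : ∀ t ∈ Ici (0 : ℝ), HasDerivWithinAt γ (gradField D D' v (γ t)) (Ici 0) t)
    (hlim : Tendsto γ atTop (𝓝 v)) {t : ℝ} (ht : 0 ≤ t) : γ t = v := by
  obtain ⟨hP, h1, h2⟩ := mem_fibreSet_iff.1 hv
  have hb' : (0 : ℝ) ≤ (D' - D).2 := by exact_mod_cast hb
  have h4 := polytope_lt hP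
  have lin : ∀ (β : ℝ) (t : ℝ), HasDerivWithinAt (fun t => β * t) β (Ici 0) t := fun β t => by
    simpa using ((hasDerivAt_id t).const_mul β).hasDerivWithinAt
  -- The second coordinate obeys an equation of its own, with rate b / 2 ≥ 0, so convergence makes
  -- it constant. The equation for the first coordinate then has constant rate m / (4 - v.2) ≥ 0.
  have hy : ∀ t ≥ 0, (γ t).2 = v.2 + ((γ 0).2 - v.2) * Real.exp (((D' - D).2 : ℝ) / 2 * t) := by
    intro t ht
    refine eq_of_linear_ode (y := fun t => (γ t).2) (τ' := fun _ => ((D' - D).2 : ℝ) / 2)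
      (convex_Ici 0) self_mem_Ici (fun t ht => ?_) (fun t _ => lin _ t) (by simp) ht
    rw [← gradField_snd]
    exact hasDerivWithinAt_prod_snd (hγ t ht)
  have hy0 := eq_zero_of_tendsto_exp (by positivity) hy ((continuous_snd.tendsto v).comp hlim)
  have hyt : ∀ t ≥ 0, (γ t).2 = v.2 := fun t ht => by rw [hy t ht, hy0]; simp
  have hx : ∀ t ≥ 0, (γ t).1 = v.1 + ((γ 0).1 - v.1)
      * Real.exp ((((D' - D).1 : ℝ) + (D' - D).2 - j) / (4 - v.2) * t) := by
    intro t ht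
    refine eq_of_linear_ode (y := fun t => (γ t).1)
      (τ' := fun _ => (((D' - D).1 : ℝ) + (D' - D).2 - j) / (4 - v.2))
      (convex_Ici 0) self_mem_Ici (fun t ht => ?_) (fun t _ => lin _ t) (by simp) ht
    refine (hasDerivWithinAt_prod_fst (hγ t ht)).congr_deriv ?_
    rw [gradField_eq hv.2]
    simp only [lagSection, Prod.fst_sub]
    rw [hyt t ht]
    have h5 : 4 - v.2 ≠ 0 := by linarith
    field_simp
    linear_combination (-(γ t).1) * h1 + 2 * h2
  have hx0 := eq_zero_of_tendsto_exp (div_nonneg hm (by linarith)) hx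
    ((continuous_fst.tendsto v).comp hlim)
  refine Prod.ext ?_ (hyt t ht)
  rw [hx t ht, hx0]; simp

/-- Nothing flows into v but v itself. Hence the interior condition on generators holds
automatically and their degree is 0. -/
lemma stableManifold_eq {D D' : ℤ × ℤ} {i j : ℝ} {v : ℝ × ℝ}
    (hv : v ∈ fibreSet (D' - D) i j) (hb : 0 ≤ (D' - D).2)
    (hm : 0 ≤ ((D' - D).1 : ℝ) + (D' - D).2 - j) : stableManifold D D' v = {v} := by
  ext x
  constructor
  · rintro ⟨γ, rfl, h, hlim⟩
    exact eq_of_tendsto_generator hv hb hm (fun t ht => (h t ht).2) hlim le_rfl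
  · rintro rfl
    refine ⟨fun _ => x, rfl, fun t _ => ⟨polytope_lt hv.1, ?_⟩, tendsto_const_nhds⟩
    have : gradField D D' x x = 0 := by simp [gradField]
    rw [this]
    exact hasDerivWithinAt_const _ _ _

/-! ### Classification of the generators -/

section Classification

variable {D D' : ℤ × ℤ}

lemma Effective.nonneg {δ : ℤ × ℤ} (h : Effective δ) : 0 ≤ δ.2 := by
  rcases h with h | h <;> omega

/-- A generator is the set of points where the difference of the sections has a value `(i, j)`
with `0 ≤ j ≤ b` and `0 ≤ i ≤ a + b - j`. -/
theorem MoGen.exists_nat (h : Effective (D' - D)) (V : MoGen D D') :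
    ∃ i j : ℕ, (j : ℤ) ≤ (D' - D).2 ∧ (i : ℤ) ≤ (D' - D).1 + (D' - D).2 - j ∧
      V.1 = fibreSet (D' - D) i j := by
  obtain ⟨i, j, hV, v, hv, hn⟩ := V.exists_fibreSet
  rw [hV] at hv
  obtain ⟨hP, h1, h2⟩ := mem_fibreSet_iff.1 hv
  have h4 := polytope_lt hP
  obtain ⟨p1, p2, p3, p4⟩ := hP
  have hb' : (0 : ℝ) ≤ (D' - D).2 := by exact_mod_cast h.nonneg
  have hj0 : 0 ≤ j := by
    have : (0 : ℝ) ≤ j := by nlinarith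
    exact_mod_cast this
  have hj1 : j ≤ (D' - D).2 := by
    have : (j : ℝ) ≤ (D' - D).2 := by nlinarith
    exact_mod_cast this
  -- The only exception would be δ = (-1, 1), j = 1. Such points are corners on the top side, where
  -- the line x² = 2 is contracted into v and leaves the polytope.
  have hm : 0 ≤ (D' - D).1 + (D' - D).2 - j := by
    by_contra hneg
    have hb : (D' - D).2 = 1 := by rcases h with h | h <;> omega
    have ha : (D' - D).1 = -1 := by rcases h with h | h <;> omega
    have hj : j = 1 := by omega
    subst hj
    rw [hb] at h1
    rw [ha, hb] at h2
    push_cast at h1 h2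
    have hv2 : v.2 = 2 := by linarith
    rw [hv2] at h2 p2
    have key : ∀ σ : ℝ, (∀ r ∈ Ioo (0 : ℝ) 1, v.1 + r * σ < 0 ∨ 2 < v.1 + r * σ) → False := by
      intro σ hσ
      refine not_mem_nhdsWithin_stableManifold (D := D) (D' := D') (v := v)
        (w := (σ, 0)) (lam := 1 / 2) (by norm_num) ?_ ?_ hn
      · intro r hr
        refine ⟨by simpa [ambient] using h4, ?_⟩
        rw [gradField, lagDiff_eq, lagDiff_eq]
        simp only [lagSection, ha, hb, hv2]
        ext
        · simp [hv2]
          ring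
        · simp [hv2]
      · rintro r hr ⟨q1, q2, -, -⟩
        simp [hv2] at q1 q2
        rcases hσ r hr with h6 | h6 <;> linarith
    rcases int_mem_zero_one (x := v.1 / 2) (n := -i) (by push_cast; linarith) (by linarith)
      (by linarith) with h0 | h0
    · exact key (-1) fun r hr => Or.inl (by linarith [hr.1])
    · exact key 1 fun r hr => Or.inr (by linarith [hr.1])
  have hm' : (0 : ℝ) ≤ ((D' - D).1 : ℝ) + (D' - D).2 - j := by exact_mod_cast hm
  have hi0 : 0 ≤ i := by
    have : (0 : ℝ) ≤ i * (4 - v.2) := by rw [← h2]; positivity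
    have : (0 : ℝ) ≤ i := nonneg_of_mul_nonneg_left this (by linarith)
    exact_mod_cast this
  have hi1 : i ≤ (D' - D).1 + (D' - D).2 - j := by
    have : (i : ℝ) * (4 - v.2) ≤ (((D' - D).1 : ℝ) + (D' - D).2 - j) * (4 - v.2) := by
      rw [← h2]; exact mul_le_mul_of_nonneg_left (by linarith) hm'
    have : (i : ℝ) ≤ ((D' - D).1 : ℝ) + (D' - D).2 - j := le_of_mul_le_mul_right this (by linarith)
    exact_mod_cast this
  refine ⟨i.toNat, j.toNat, by omega, by omega, ?_⟩
  rw [hV]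
  have e : ∀ {n : ℤ}, 0 ≤ n → ((n.toNat : ℕ) : ℝ) = n := fun hn => by
    exact_mod_cast Int.toNat_of_nonneg hn
  rw [e hi0, e hj0]

lemma cast_m_nonneg {δ : ℤ × ℤ} {i j : ℕ} (hi : (i : ℤ) ≤ δ.1 + δ.2 - j) :
    (i : ℝ) ≤ (δ.1 : ℝ) + δ.2 - j := by
  exact_mod_cast hi

lemma MoGen.dim_eq_zero (h : Effective (D' - D)) (V : MoGen D D') : V.dim = 0 := by
  obtain ⟨i, j, hj, hi, hV⟩ := V.exists_nat h
  have hm := (Nat.cast_nonneg i).trans (cast_m_nonneg hi)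
  simp only [MoGen.dim, ENNReal.iSup_eq_zero]
  intro v hv
  rw [hV] at hv
  rw [stableManifold_eq hv h.nonneg hm, dimH_singleton]

/-- The center of a generator. -/
lemma exists_mem_fibreSet {δ : ℤ × ℤ} {i j : ℕ} (hj : (j : ℤ) ≤ δ.2)
    (hi : (i : ℤ) ≤ δ.1 + δ.2 - j) : ∃ v, v ∈ fibreSet δ i j := by
  have hm := cast_m_nonneg hi
  have hj' : (j : ℝ) ≤ δ.2 := by exact_mod_cast hj
  have hi0 : (0 : ℝ) ≤ i := Nat.cast_nonneg i
  have hj0 : (0 : ℝ) ≤ j := Nat.cast_nonneg j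
  set m : ℝ := (δ.1 : ℝ) + δ.2 - j with hmdef
  -- If b = 0 or m = 0, the numerator vanishes as well and the component is not a point; division by
  -- zero then just selects one of its points.
  set y : ℝ := 2 * (j / δ.2)
  set k : ℝ := i / m
  have hy0 : 0 ≤ y := mul_nonneg zero_le_two (div_nonneg hj0 (hj0.trans hj'))
  have hy1 : y ≤ 2 := by
    have : (j : ℝ) / δ.2 ≤ 1 := div_le_one_of_le₀ hj' (hj0.trans hj')
    linarith
  have hk0 : 0 ≤ k := div_nonneg hi0 (hi0.trans hm)
  have hk1 : k ≤ 1 := div_le_one_of_le₀ hm (hi0.trans hm)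
  refine ⟨(k * (4 - y), y), mem_fibreSet_iff.2 ⟨⟨?_, ?_, hy0, hy1⟩, ?_, ?_⟩⟩
  · exact mul_nonneg hk0 (by linarith)
  · change k * (4 - y) ≤ 4 - y
    nlinarith
  · change (δ.2 : ℝ) * (2 * (j / δ.2)) = 2 * j
    by_cases hb : (δ.2 : ℝ) = 0
    · rw [hb] at hj' ⊢
      have : (j : ℝ) = 0 := le_antisymm hj' hj0
      simp [this]
    · field_simp
  · change m * (i / m * (4 - y)) = i * (4 - y)
    by_cases hm0 : m = 0
    · rw [hm0] at hm ⊢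
      have : (i : ℝ) = 0 := le_antisymm hm hi0
      simp [this]
    · field_simp

/-- All admissible values are attained by generators. -/
theorem exists_moGen (h : Effective (D' - D)) {i j : ℕ} (hj : (j : ℤ) ≤ (D' - D).2)
    (hi : (i : ℤ) ≤ (D' - D).1 + (D' - D).2 - j) :
    ∃ V : MoGen D D', V.1 = fibreSet (D' - D) i j := by
  obtain ⟨v, hv⟩ := exists_mem_fibreSet hj hi
  have hm := (Nat.cast_nonneg i).trans (cast_m_nonneg hi)
  have hvI : v ∈ intersection D D' := ⟨hv.1, i, j, by rw [lagDiff_eq, hv.2]; simp⟩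
  have hc : connectedComponentIn (intersection D D') v = fibreSet (D' - D) i j := by
    have := component_eq (D := D) (D' := D') (i := i) (j := j) (v := v) (by exact_mod_cast hv)
    exact_mod_cast this
  refine ⟨⟨_, ⟨v, hvI, rfl⟩, v, mem_connectedComponentIn hvI, ?_⟩, hc⟩
  rw [stableManifold_eq hv h.nonneg hm, inter_eq_left.2 (singleton_subset_iff.2 hv.1)]
  exact self_mem_nhdsWithin

lemma fibreSet_injective {δ : ℤ × ℤ} {i j i' j' : ℕ} (hj : (j : ℤ) ≤ δ.2)
    (hi : (i : ℤ) ≤ δ.1 + δ.2 - j) (h : fibreSet δ i j = fibreSet δ i' j') : i = i' ∧ j = j' := by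
  obtain ⟨v, hv⟩ := exists_mem_fibreSet hj hi
  have h1 := hv.2
  rw [h] at hv
  have h2 := hv.2
  rw [h1, Prod.mk.injEq] at h2
  exact_mod_cast h2

end Classification

/-! ### Relaxation in one variable -/

/-- A zero of `k ↦ m k - i`, equal to `k` if this function vanishes identically. -/
def rest (m i k : ℝ) : ℝ := if m = 0 then k else i / m

/-- The solution of `k' = m k - i` with initial value `k`. -/
def relax (m i k s : ℝ) : ℝ := rest m i k + (k - rest m i k) * Real.exp (m * s)

/-- The points of the unit interval where `k ^ i * (1 - k) ^ (m - i)` does not vanish. -/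
structure Admissible (m i k : ℝ) : Prop where
  nonneg : 0 ≤ i
  le : i ≤ m
  zero_le : 0 ≤ k
  le_one : k ≤ 1
  pos : 0 < i → 0 < k
  lt_one : i < m → k < 1

/-- The potential of the vector field `k ↦ m k - i` for the metric `dk² / (2 k (1 - k))`. -/
def potential (m i k : ℝ) : ℝ := -(i * Real.log k + (m - i) * Real.log (1 - k)) / 2

lemma contDiff_rest (m i : ℝ) : ContDiff ℝ ∞ (rest m i) := by
  by_cases h : m = 0
  · have : rest m i = id := by ext; simp [rest, h]
    rw [this]
    exact contDiff_id
  · have : rest m i = fun _ => i / m := by ext; simp [rest, h]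
    rw [this]
    exact contDiff_const

lemma contDiff_relax (m i : ℝ) : ContDiff ℝ ∞ fun q : ℝ × ℝ => relax m i q.1 q.2 := by
  have h := (contDiff_rest m i).comp (contDiff_fst (𝕜 := ℝ) (E := ℝ) (F := ℝ))
  exact h.add ((contDiff_fst.sub h).mul (contDiff_const.mul contDiff_snd).exp)

lemma relax_zero (m i k : ℝ) : relax m i k 0 = k := by simp [relax]

section Relax

variable {m i k : ℝ}

lemma mul_rest (h : m = 0 → i = 0) : m * rest m i k = i := by
  by_cases hm : m = 0
  · simp [hm, h hm]
  · simp [rest, hm]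
    field_simp

lemma mul_relax_sub (h : m = 0 → i = 0) (s : ℝ) :
    m * relax m i k s - i = m * (relax m i k s - rest m i k) := by
  rw [mul_sub, mul_rest h]

lemma hasDerivAt_relax (h : m = 0 → i = 0) (s : ℝ) :
    HasDerivAt (relax m i k) (m * relax m i k s - i) s := by
  rw [mul_relax_sub h]
  refine (((((hasDerivAt_id s).const_mul m).exp).const_mul (k - rest m i k)).const_add
    (rest m i k)).congr_deriv ?_
  simp [relax]
  ring

lemma tendsto_relax (hm : 0 ≤ m) : Tendsto (relax m i k) atBot (𝓝 (rest m i k)) := by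
  rcases hm.eq_or_lt with rfl | hm
  · have : relax 0 i k = fun _ => rest 0 i k := by ext; simp [relax, rest]
    rw [this]
    exact tendsto_const_nhds
  · have h1 : Tendsto (fun s => Real.exp (m * s)) atBot (𝓝 0) :=
      Real.tendsto_exp_atBot.comp (tendsto_id.const_mul_atBot hm)
    have h2 := (h1.const_mul (k - rest m i k)).const_add (rest m i k)
    rw [mul_zero, add_zero] at h2
    exact h2

namespace Admissible

lemma zero_of_zero (h : Admissible m i k) (hm : m = 0) : i = 0 :=
  le_antisymm (hm ▸ h.le) h.nonneg

/-- At a zero of the field, k = 0 forces i = 0 and k = 1 forces i = m. -/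
lemma of_mul_eq (hm : 0 ≤ m) (hk0 : 0 ≤ k) (hk1 : k ≤ 1) (h : m * k = i) : Admissible m i k where
  nonneg := by rw [← h]; positivity
  le := by rw [← h]; nlinarith
  zero_le := hk0
  le_one := hk1
  pos hi := by
    rcases hk0.eq_or_lt with rfl | hk
    · simp at h; linarith
    · exact hk
  lt_one hi := by
    rcases hk1.eq_or_lt with rfl | hk
    · simp at h; linarith
    · exact hk

lemma rest (h : Admissible m i k) : Admissible m i (rest m i k) := by
  by_cases hm : m = 0
  · simpa [HMS.rest, hm] using hm ▸ h
  · have hm' : 0 < m := lt_of_le_of_ne (h.nonneg.trans h.le) (Ne.symm hm)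
    refine of_mul_eq hm'.le ?_ ?_ (mul_rest fun h0 => absurd h0 hm)
    · simp only [HMS.rest, hm, if_false]
      exact div_nonneg h.nonneg hm'.le
    · simp only [HMS.rest, hm, if_false]
      exact div_le_one_of_le₀ h.le hm'.le

/-- Backward in time the solution is a convex combination of its initial value and the rest point,
with positive weight on the initial value. -/
lemma relax (h : Admissible m i k) {s : ℝ} (hs : s ≤ 0) : Admissible m i (relax m i k s) := by
  have hm : 0 ≤ m := h.nonneg.trans h.le
  have he := Real.exp_pos (m * s)
  have he1 : Real.exp (m * s) ≤ 1 := Real.exp_le_one_iff.2 (by nlinarith)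
  have hr := h.rest
  have e : HMS.relax m i k s
      = (1 - Real.exp (m * s)) * HMS.rest m i k + Real.exp (m * s) * k := by
    simp only [HMS.relax]; ring
  rw [e]
  generalize Real.exp (m * s) = q at *
  refine ⟨h.nonneg, h.le, ?_, ?_, fun hi => ?_, fun hi => ?_⟩
  · nlinarith [hr.zero_le, h.zero_le]
  · nlinarith [hr.le_one, h.le_one]
  · nlinarith [hr.zero_le, h.pos hi]
  · nlinarith [hr.le_one, h.lt_one hi]

/-- If a product of such monomials does not vanish at k, neither does a factor. This lets the end of
a tree serve as the vertex of both leaf edges. -/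
lemma left {m₂ i₂ : ℝ} (h : Admissible (m + m₂) (i + i₂) k) (h1 : 0 ≤ i) (h1' : i ≤ m)
    (h2 : 0 ≤ i₂) (h2' : i₂ ≤ m₂) : Admissible m i k where
  nonneg := h1
  le := h1'
  zero_le := h.zero_le
  le_one := h.le_one
  pos hi := h.pos (by linarith)
  lt_one hi := h.lt_one (by linarith)

lemma eq_zero (h : Admissible m i k) (hk : k = 0) : i = 0 :=
  le_antisymm (not_lt.1 fun hi => (h.pos hi).ne' hk) h.nonneg

lemma eq_of_eq_one (h : Admissible m i k) (hk : k = 1) : i = m :=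
  le_antisymm h.le (not_lt.1 fun hi => (h.lt_one hi).ne hk)

/-- Wherever one of the logarithms is singular, admissibility makes its coefficient zero. -/
lemma tendsto_potential {α : Type*} {l : Filter α} {f : α → ℝ} (h : Admissible m i k)
    (hf : Tendsto f l (𝓝 k)) : Tendsto (fun t => potential m i (f t)) l (𝓝 (potential m i k)) := by
  have h1 : Tendsto (fun t => i * Real.log (f t)) l (𝓝 (i * Real.log k)) := by
    by_cases hi : i = 0
    · simpa [hi] using tendsto_const_nhds
    · exact ((Real.continuousAt_log fun hk => hi (h.eq_zero hk)).tendsto.comp hf).const_mul i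
  have h2 : Tendsto (fun t => (m - i) * Real.log (1 - f t)) l (𝓝 ((m - i) * Real.log (1 - k))) := by
    by_cases hi : i = m
    · simpa [hi] using tendsto_const_nhds
    · exact ((Real.continuousAt_log fun hk => hi (h.eq_of_eq_one (by linarith))).tendsto.comp
        (hf.const_sub 1)).const_mul (m - i)
  exact (h1.add h2).neg.div_const 2

/-- The derivative of the potential along a curve. -/
lemma hasDerivAt_potential (h : Admissible m i k) {f : ℝ → ℝ} {c t : ℝ} (hk : f t = k)
    (hf : HasDerivAt f (c * (m * k - i)) t) :
    HasDerivAt (fun t => potential m i (f t))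
      (c * (m * k - i) ^ 2 * (1 / k + 1 / (1 - k)) / 2) t := by
  subst hk
  set f' := c * (m * f t - i) with hf'
  have h1 : HasDerivAt (fun t => i * Real.log (f t)) (i * (f' / f t)) t := by
    by_cases hi : i = 0
    · simpa [hi] using hasDerivAt_const t (0 : ℝ)
    · exact (hf.log fun hk => hi (h.eq_zero hk)).const_mul i
  have h2 : HasDerivAt (fun t => (m - i) * Real.log (1 - f t)) ((m - i) * (-f' / (1 - f t))) t := by
    by_cases hi : i = m
    · simpa [hi] using hasDerivAt_const t (0 : ℝ)
    · exact ((hf.const_sub 1).log fun hk =>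
        hi (h.eq_of_eq_one (by linarith))).const_mul (m - i)
  refine ((h1.add h2).neg.div_const 2).congr_deriv ?_
  by_cases h0 : f t = 0
  · simp [hf', h0, h.eq_zero h0]
  by_cases h1 : f t = 1
  · simp [hf', h1, h.eq_of_eq_one h1]
  have h1' : 1 - f t ≠ 0 := fun h => h1 (by linarith)
  rw [hf']
  field_simp
  ring

end Admissible

/-- The value of the potential at the zeros of the vector field. -/
lemma potential_of_mul_eq (h : m * k = i) : potential m i k = potential m i (i / m) := by
  by_cases hm : m = 0
  · subst hm
    have hi : i = 0 := by simpa using h.symm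
    simp [potential, hi]
  · rw [← h, mul_div_cancel_left₀ _ hm]

lemma potential_add (m₁ m₂ i₁ i₂ k : ℝ) :
    potential (m₁ + m₂) (i₁ + i₂) k = potential m₁ i₁ k + potential m₂ i₂ k := by
  simp only [potential]; ring

end Relax

/-! ### Coordinates on the polytope -/

/-- The polytope is parametrized by the unit square. -/
def toPolytope (k l : ℝ) : ℝ × ℝ := (k * (4 - 2 * l), 2 * l)

lemma toPolytope_mem {k l : ℝ} (hk0 : 0 ≤ k) (hk1 : k ≤ 1) (hl0 : 0 ≤ l) (hl1 : l ≤ 1) :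
    toPolytope k l ∈ polytope := by
  refine ⟨?_, ?_, ?_, ?_⟩ <;> simp only [toPolytope] <;> nlinarith

lemma exists_toPolytope_eq {x : ℝ × ℝ} (hx : x ∈ polytope) :
    ∃ k l, 0 ≤ k ∧ k ≤ 1 ∧ 0 ≤ l ∧ l ≤ 1 ∧ x = toPolytope k l := by
  have h4 := polytope_lt hx
  obtain ⟨h1, h2, h3, h5⟩ := hx
  have h4' : 4 - x.2 ≠ 0 := by linarith
  refine ⟨x.1 / (4 - x.2), x.2 / 2, div_nonneg h1 (by linarith), div_le_one_of_le₀ h2 (by linarith),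
    by linarith, by linarith, ?_⟩
  ext
  · simp only [toPolytope]
    field_simp
  · simp only [toPolytope]
    ring

/-- On the unit square the two equations separate and have the same shape, that of a rest point of
`relax`. -/
lemma toPolytope_mem_fibreSet_iff {δ : ℤ × ℤ} {i j k l : ℝ} (h : toPolytope k l ∈ polytope) :
    toPolytope k l ∈ fibreSet δ i j ↔ δ.2 * l = j ∧ (δ.1 + δ.2 - j) * k = i := by
  have h4 := polytope_lt h
  simp only [toPolytope] at h4
  have h4' : 4 - 2 * l ≠ 0 := by linarith
  rw [mem_fibreSet_iff, and_iff_right h]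
  simp only [toPolytope]
  refine and_congr ⟨fun h => by linarith, fun h => by linarith⟩ ?_
  rw [← mul_assoc, mul_left_inj' h4']

/-! ### The leaf edges of gradient trees -/

/-- The time change along a leaf edge: a primitive of `t ↦ 1 / (4 - 2 l(t))`. -/
def clock (b j l t : ℝ) : ℝ :=
  (t + 2 / b * (Real.log (4 - 2 * l) - Real.log (4 - 2 * relax b j l (t / 2))))
    / (4 - 2 * rest b j l)

/-- The trajectory which ends in the point with coordinates `k`, `l` at time `0`. -/
def leg (δ : ℤ × ℤ) (i j k l t : ℝ) : ℝ × ℝ :=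
  toPolytope (relax (δ.1 + δ.2 - j) i k (clock δ.2 j l t)) (relax δ.2 j l (t / 2))

lemma clock_zero (b j l : ℝ) : clock b j l 0 = 0 := by simp [clock, relax_zero]

lemma leg_zero (δ : ℤ × ℤ) (i j k l : ℝ) : leg δ i j k l 0 = toPolytope k l := by
  simp [leg, clock_zero, relax_zero]

section Leg

variable {b j l : ℝ}

lemma hasDerivAt_relax_half (h : b = 0 → j = 0) (t : ℝ) :
    HasDerivAt (fun t => relax b j l (t / 2)) (1 / 2 * (b * relax b j l (t / 2) - j)) t := by
  refine ((hasDerivAt_relax h (t / 2)).comp t ((hasDerivAt_id t).div_const 2)).congr_deriv ?_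
  ring

lemma hasDerivAt_clock (h : Admissible b j l) {t : ℝ} (ht : t ≤ 0) :
    HasDerivAt (clock b j l) (1 / (4 - 2 * relax b j l (t / 2))) t := by
  have hz := h.zero_of_zero
  have h1 := (h.relax (s := t / 2) (by linarith)).le_one
  have h2 := h.rest.le_one
  have e1 : 4 - 2 * relax b j l (t / 2) ≠ 0 := by linarith
  have e2 : 4 - 2 * rest b j l ≠ 0 := by linarith
  refine (((hasDerivAt_id t).add (((((hasDerivAt_relax_half (l := l) hz t).const_mul 2).const_sub
    4).log e1).const_sub (Real.log (4 - 2 * l)) |>.const_mul (2 / b))).div_const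
    (4 - 2 * rest b j l)).congr_deriv ?_
  rw [mul_relax_sub hz]
  -- For b = 0 the function l is constant, and the logarithmic term drops out because 2 / 0 = 0.
  by_cases hb : b = 0
  · have : relax b j l (t / 2) = rest b j l := by simp [hb, relax, rest]
    rw [this]
    simp [hb]
  · field_simp
    ring

/-- Since 4 - 2 l ≤ 4, the clock runs at speed at least 1/4; backward in time it reaches -∞, so k
relaxes completely. -/
lemma clock_le (h : Admissible b j l) {t : ℝ} (ht : t ≤ 0) : clock b j l t ≤ t / 4 := by
  have hd : ∀ s ≤ 0, HasDerivAt (fun s => clock b j l s - s / 4)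
      (1 / (4 - 2 * relax b j l (s / 2)) - 1 / 4) s := fun s hs =>
    (hasDerivAt_clock h hs).sub ((hasDerivAt_id s).div_const 4)
  have hmono : MonotoneOn (fun s => clock b j l s - s / 4) (Iic 0) := by
    refine monotoneOn_of_deriv_nonneg (convex_Iic 0)
      (fun s hs => (hd s hs).continuousAt.continuousWithinAt)
      (fun s hs => (hd s (mem_Iic.1 (interior_subset hs))).differentiableAt.differentiableWithinAt)
      fun s hs => ?_
    have hs' : s ≤ 0 := mem_Iic.1 (interior_subset hs)
    have hr := h.relax (s := s / 2) (by linarith)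
    rw [(hd s hs').deriv, sub_nonneg]
    exact one_div_le_one_div_of_le (by linarith [hr.le_one]) (by linarith [hr.zero_le])
  have := hmono ht self_mem_Iic ht
  simp only [clock_zero] at this
  linarith

lemma tendsto_clock (h : Admissible b j l) : Tendsto (clock b j l) atBot atBot := by
  refine tendsto_atBot_mono' atBot ?_ (tendsto_id.atBot_div_const (by norm_num : (0 : ℝ) < 4))
  filter_upwards [eventually_le_atBot 0] with t ht using clock_le h ht

lemma hasDerivAt_toPolytope {f g : ℝ → ℝ} {f' g' t : ℝ} (hf : HasDerivAt f f' t)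
    (hg : HasDerivAt g g' t) : HasDerivAt (fun t => toPolytope (f t) (g t))
      (f' * (4 - 2 * g t) - f t * (2 * g'), 2 * g') t := by
  refine ((hf.mul ((hg.const_mul 2).const_sub 4)).prodMk (hg.const_mul 2)).congr_deriv ?_
  ext
  · simp only []
    ring
  · rfl

lemma continuous_toPolytope : Continuous fun q : ℝ × ℝ => toPolytope q.1 q.2 := by
  unfold toPolytope
  fun_prop

/-- With x¹ = k (4 - 2 l) and x² = 2 l this says (4 - 2 l) k' = m k - i and 2 l' = b l - j. -/
lemma gradField_toPolytope {D D' : ℤ × ℤ} {i j k l : ℝ} {v : ℝ × ℝ}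
    (hv : lagSection (D' - D) v = (i, j)) (hl : 4 - 2 * l ≠ 0) :
    gradField D D' v (toPolytope k l) = ((((D' - D).1 + (D' - D).2 - j) * k - i)
      - k * ((D' - D).2 * l - j), (D' - D).2 * l - j) := by
  rw [gradField_eq hv]
  ext
  · simp only [lagSection, toPolytope, Prod.fst_sub]
    field_simp
    ring
  · simp only [lagSection, toPolytope, Prod.snd_sub]
    ring

variable {D D' : ℤ × ℤ} {i k : ℝ} {v : ℝ × ℝ}
  (hm : Admissible ((D' - D).1 + (D' - D).2 - j) i k) (hb : Admissible (D' - D).2 j l)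
include hm hb

lemma admissible_leg_fst {t : ℝ} (ht : t ≤ 0) : Admissible ((D' - D).1 + (D' - D).2 - j) i
    (relax ((D' - D).1 + (D' - D).2 - j) i k (clock (D' - D).2 j l t)) :=
  hm.relax ((clock_le hb ht).trans (by linarith))

lemma leg_mem {t : ℝ} (ht : t ≤ 0) : leg (D' - D) i j k l t ∈ polytope := by
  have h1 := admissible_leg_fst hm hb ht
  have h2 := hb.relax (s := t / 2) (by linarith)
  exact toPolytope_mem h1.zero_le h1.le_one h2.zero_le h2.le_one

lemma hasDerivAt_leg_fst {t : ℝ} (ht : t ≤ 0) :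
    HasDerivAt (fun t => relax ((D' - D).1 + (D' - D).2 - j) i k (clock (D' - D).2 j l t))
      (1 / (4 - 2 * relax (D' - D).2 j l (t / 2)) * (((D' - D).1 + (D' - D).2 - j) *
        relax ((D' - D).1 + (D' - D).2 - j) i k (clock (D' - D).2 j l t) - i)) t := by
  rw [mul_comm]
  exact (hasDerivAt_relax hm.zero_of_zero _).comp t (hasDerivAt_clock hb ht)

lemma hasDerivAt_leg (hv : lagSection (D' - D) v = (i, j)) {t : ℝ} (ht : t ≤ 0) :
    HasDerivAt (leg (D' - D) i j k l) (gradField D D' v (leg (D' - D) i j k l t)) t := by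
  have h2 := (hb.relax (s := t / 2) (by linarith)).le_one
  have e : 4 - 2 * relax (D' - D).2 j l (t / 2) ≠ 0 := by linarith
  refine (hasDerivAt_toPolytope (hasDerivAt_leg_fst hm hb ht)
    (hasDerivAt_relax_half hb.zero_of_zero t)).congr_deriv ?_
  rw [leg, gradField_toPolytope hv e]
  ext
  · simp only []
    field_simp
  · simp only []
    ring

lemma tendsto_leg : Tendsto (leg (D' - D) i j k l) atBot
    (𝓝 (toPolytope (rest ((D' - D).1 + (D' - D).2 - j) i k) (rest (D' - D).2 j l))) := by
  have h1 := (tendsto_relax (i := i) (k := k) (hm.nonneg.trans hm.le)).comp (tendsto_clock hb)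
  have h2 := (tendsto_relax (i := j) (k := l) (hb.nonneg.trans hb.le)).comp
    (tendsto_id.atBot_div_const (by norm_num : (0 : ℝ) < 2))
  exact (continuous_toPolytope.tendsto _).comp (h1.prodMk_nhds h2)

lemma rest_mem_fibreSet :
    toPolytope (rest ((D' - D).1 + (D' - D).2 - j) i k) (rest (D' - D).2 j l)
      ∈ fibreSet (D' - D) i j := by
  have h1 := hm.rest
  have h2 := hb.rest
  exact (toPolytope_mem_fibreSet_iff (toPolytope_mem h1.zero_le h1.le_one h2.zero_le
    h2.le_one)).2 ⟨mul_rest hb.zero_of_zero, mul_rest hm.zero_of_zero⟩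

/-- A leaf edge is determined by its endpoint. -/
lemma eq_leg (hv : lagSection (D' - D) v = (i, j)) {γ : ℝ → ℝ × ℝ}
    (hγ : ∀ t ∈ Iic (0 : ℝ), γ t ∈ polytope ∧
      HasDerivWithinAt γ (gradField D D' v (γ t)) (Iic 0) t)
    (h0 : γ 0 = toPolytope k l) {t : ℝ} (ht : t ≤ 0) : γ t = leg (D' - D) i j k l t := by
  -- The coordinate l solves its relaxation equation at half speed, independently of k; afterwards k
  -- solves a linear equation whose time is the clock of this l.
  have hl : ∀ t ≤ 0, (γ t).2 / 2 = relax (D' - D).2 j l (t / 2) := by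
    intro t ht
    have h := eq_of_linear_ode (y := fun t => (γ t).2 / 2) (τ := fun t => (D' - D).2 * (t / 2))
      (τ' := fun _ => ((D' - D).2 : ℝ) * (1 / 2)) (c := rest (D' - D).2 j l) (convex_Iic 0)
      self_mem_Iic (fun t ht => ?_) (fun t _ => ?_) (by simp) ht
    · rw [h, h0]
      simp [toPolytope, relax]
    · refine ((hasDerivWithinAt_prod_snd (hγ t ht).2).div_const 2).congr_deriv ?_
      rw [gradField_eq hv]
      simp only [lagSection, Prod.snd_sub]
      linear_combination (1 / 2 : ℝ) * mul_rest (k := l) hb.zero_of_zero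
    · exact (((hasDerivAt_id t).div_const 2).const_mul _).hasDerivWithinAt
  have hk : ∀ t ≤ 0, (γ t).1 / (4 - (γ t).2)
      = relax ((D' - D).1 + (D' - D).2 - j) i k (clock (D' - D).2 j l t) := by
    intro t ht
    have h := eq_of_linear_ode (y := fun t => (γ t).1 / (4 - (γ t).2))
      (τ := fun t => ((D' - D).1 + (D' - D).2 - j) * clock (D' - D).2 j l t)
      (τ' := fun t => (((D' - D).1 : ℝ) + (D' - D).2 - j) *
        (1 / (4 - 2 * relax (D' - D).2 j l (t / 2))))
      (c := rest ((D' - D).1 + (D' - D).2 - j) i k) (convex_Iic 0)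
      self_mem_Iic (fun t ht => ?_) (fun t ht => ?_) (by simp [clock_zero]) ht
    · have h4 := polytope_lt (hγ 0 self_mem_Iic).1
      rw [h0] at h4
      simp only [toPolytope] at h4
      have h4' : 4 - 2 * l ≠ 0 := by linarith
      rw [h, h0]
      simp [toPolytope, relax, h4']
    · have h4 := polytope_lt (hγ t ht).1
      have h4' : 4 - (γ t).2 ≠ 0 := by linarith
      refine ((hasDerivWithinAt_prod_fst (hγ t ht).2).fun_div
        ((hasDerivWithinAt_prod_snd (hγ t ht).2).const_sub 4) h4').congr_deriv ?_
      have e : 2 * relax (D' - D).2 j l (t / 2) = (γ t).2 := by rw [← hl t ht]; ring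
      rw [e, gradField_eq hv]
      simp only [lagSection, Prod.snd_sub, Prod.fst_sub]
      have hr := mul_rest (k := k) hm.zero_of_zero
      field_simp
      linear_combination 2 * (4 - (γ t).2) * hr
    · exact ((hasDerivAt_clock hb ht).const_mul _).hasDerivWithinAt
  have h4 := polytope_lt (hγ t ht).1
  have h4' : 4 - (γ t).2 ≠ 0 := by linarith
  rw [leg, ← hk t ht, ← hl t ht]
  ext
  · simp only [toPolytope]
    field_simp
  · simp only [toPolytope]
    ring

end Leg

/-! ### Symplectic areas of leaf edges -/

/-- The metric in the coordinates `k`, `l`. -/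
lemma baseMetric_toPolytope {k l u w : ℝ} (hl : 4 - 2 * l ≠ 0) (h0 : k = 0 → u = 0)
    (h1 : k = 1 → u = 0) :
    baseMetric (toPolytope k l) (u - k * w, w) (u - k * w, w)
      = 1 / (4 - 2 * l) * u ^ 2 * (1 / k + 1 / (1 - k)) / 2
        + 1 / 2 * w ^ 2 * (1 / l + 1 / (1 - l)) / 2 := by
  -- The mixed terms in u w cancel, and so do the terms in w². The metric is diagonal in k and l. At
  -- k = 0 and k = 1, where a denominator vanishes, u = 0 is used.
  have e1 : (u - k * w) * (u - k * w) / (k * (4 - 2 * l))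
      + (u - k * w + w) * (u - k * w + w) / (4 - k * (4 - 2 * l) - 2 * l) - w * w / (4 - 2 * l)
      = 1 / (4 - 2 * l) * u ^ 2 * (1 / k + 1 / (1 - k)) := by
    have e : 4 - k * (4 - 2 * l) - 2 * l = (1 - k) * (4 - 2 * l) := by ring
    rw [e]
    by_cases hk0 : k = 0
    · simp [hk0, h0 hk0]
    by_cases hk1 : k = 1
    · simp [hk1, h1 hk1]
    have hk1' : 1 - k ≠ 0 := fun h => hk1 (by linarith)
    field_simp
    ring
  have e2 : w * w / (2 * l) + w * w / (2 - 2 * l) = 1 / 2 * w ^ 2 * (1 / l + 1 / (1 - l)) := by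
    have e : 2 - 2 * l = 2 * (1 - l) := by ring
    rw [e]
    simp only [div_eq_mul_inv, mul_inv]
    ring
  simp only [baseMetric, toPolytope]
  rw [← e1, ← e2]
  ring

/-- The fundamental theorem of calculus on a half-line for functions with nonnegative derivative. -/
lemma integral_Iic_of_hasDerivAt_of_nonneg {f f' : ℝ → ℝ} {a : ℝ}
    (hd : ∀ t ≤ 0, HasDerivAt f (f' t) t) (hf' : ∀ t ≤ 0, 0 ≤ f' t)
    (hlim : Tendsto f atBot (𝓝 a)) : ∫ t in Iic (0 : ℝ), f' t = f 0 - a := by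
  have h := integral_Ioi_of_hasDerivAt_of_nonneg' (a := 0) (g := fun t => -f (-t))
    (g' := fun t => f' (-t)) (l := -a) (fun t ht => ?_) (fun t ht => hf' _ ?_) ?_
  · rw [integral_comp_neg_Ioi, neg_zero] at h
    rw [h]
    ring
  · have := ((hd (-t) (by simpa using ht)).comp t (hasDerivAt_neg t)).neg
    refine this.congr_deriv ?_
    ring
  · have : 0 < t := ht
    linarith
  · exact (hlim.comp tendsto_neg_atTop_atBot).neg

/-- The symplectic area over a leaf edge is the difference of the potentials at its ends. -/
lemma leaf_area {D D' : ℤ × ℤ} {i j k l : ℝ} {v : ℝ × ℝ}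
    (hm : Admissible ((D' - D).1 + (D' - D).2 - j) i k) (hb : Admissible (D' - D).2 j l)
    (hv : lagSection (D' - D) v = (i, j)) {γ : ℝ → ℝ × ℝ}
    (hγ : ∀ t ∈ Iic (0 : ℝ), γ t ∈ polytope ∧
      HasDerivWithinAt γ (gradField D D' v (γ t)) (Iic 0) t)
    (h0 : γ 0 = toPolytope k l) :
    ∫ t in Iic (0 : ℝ), baseMetric (γ t) (deriv γ t) (gradField D D' v (γ t))
      = potential ((D' - D).1 + (D' - D).2 - j) i k + potential (D' - D).2 j l
        - (potential ((D' - D).1 + (D' - D).2 - j) i (i / ((D' - D).1 + (D' - D).2 - j))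
          + potential (D' - D).2 j (j / (D' - D).2)) := by
  set m : ℝ := (D' - D).1 + (D' - D).2 - j
  set b : ℝ := (((D' - D).2 : ℤ) : ℝ)
  have hA : ∀ t ≤ 0, Admissible m i (relax m i k (clock b j l t)) :=
    fun t ht => admissible_leg_fst hm hb ht
  have hB : ∀ t ≤ 0, Admissible b j (relax b j l (t / 2)) := fun t ht => hb.relax (by linarith)
  let f' : ℝ → ℝ := fun t =>
    1 / (4 - 2 * relax b j l (t / 2)) * (m * relax m i k (clock b j l t) - i) ^ 2
      * (1 / relax m i k (clock b j l t) + 1 / (1 - relax m i k (clock b j l t))) / 2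
    + 1 / 2 * (b * relax b j l (t / 2) - j) ^ 2
      * (1 / relax b j l (t / 2) + 1 / (1 - relax b j l (t / 2))) / 2
  have hd : ∀ t ≤ 0, HasDerivAt (fun t => potential m i (relax m i k (clock b j l t))
      + potential b j (relax b j l (t / 2))) (f' t) t := fun t ht =>
    ((hA t ht).hasDerivAt_potential (f := fun t => relax m i k (clock b j l t)) rfl
      (hasDerivAt_leg_fst hm hb ht)).add
      ((hB t ht).hasDerivAt_potential (f := fun t => relax b j l (t / 2)) rfl
        (hasDerivAt_relax_half hb.zero_of_zero t))
  have hf' : ∀ t ≤ 0, 0 ≤ f' t := by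
    intro t ht
    have a1 := (hA t ht).zero_le
    have a2 : 0 ≤ 1 - relax m i k (clock b j l t) := by linarith [(hA t ht).le_one]
    have b1 := (hB t ht).zero_le
    have b2 : 0 ≤ 1 - relax b j l (t / 2) := by linarith [(hB t ht).le_one]
    have b3 : 0 ≤ 4 - 2 * relax b j l (t / 2) := by linarith
    positivity
  have hlim : Tendsto (fun t => potential m i (relax m i k (clock b j l t))
      + potential b j (relax b j l (t / 2))) atBot
      (𝓝 (potential m i (rest m i k) + potential b j (rest b j l))) :=
    (hm.rest.tendsto_potential ((tendsto_relax (hm.nonneg.trans hm.le)).comp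
      (tendsto_clock hb))).add (hb.rest.tendsto_potential
        ((tendsto_relax (hb.nonneg.trans hb.le)).comp
          (tendsto_id.atBot_div_const (by norm_num : (0 : ℝ) < 2))))
  have hint := integral_Iic_of_hasDerivAt_of_nonneg hd hf' hlim
  rw [clock_zero, zero_div, relax_zero, relax_zero, potential_of_mul_eq (mul_rest hm.zero_of_zero),
    potential_of_mul_eq (mul_rest hb.zero_of_zero)] at hint
  -- At t = 0 the flow equation is one-sided and says nothing about `deriv`, so the endpoint is
  -- dropped.
  rw [← hint, integral_Iic_eq_integral_Iio, integral_Iic_eq_integral_Iio]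
  refine setIntegral_congr_fun measurableSet_Iio fun t ht => ?_
  have ht0 : t ≤ 0 := le_of_lt ht
  have hder : deriv γ t = gradField D D' v (γ t) :=
    ((hγ t ht0).2.hasDerivAt (Iic_mem_nhds ht)).deriv
  have e : 4 - 2 * relax b j l (t / 2) ≠ 0 := by linarith [(hB t ht0).le_one]
  simp only [hder]
  rw [eq_leg hm hb hv hγ h0 ht0, leg, gradField_toPolytope hv e]
  refine baseMetric_toPolytope e (fun h => ?_) fun h => ?_
  · rw [h, (hA t ht0).eq_zero h, mul_zero, sub_zero]
  · rw [h, mul_one, sub_eq_zero]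
    exact ((hA t ht0).eq_of_eq_one h).symm

/-! ### Gradient trees -/

/-- The sections differ by `(i, j)` along the generator. -/
structure MoGen.HasValue {D D' : ℤ × ℤ} (V : MoGen D D') (i j : ℕ) : Prop where
  snd_le : (j : ℤ) ≤ (D' - D).2
  fst_le : (i : ℤ) ≤ (D' - D).1 + (D' - D).2 - j
  eq : V.1 = fibreSet (D' - D) i j

/-- The normalization factor of a generator. -/
def weight (δ : ℤ × ℤ) (i j : ℕ) : ℝ :=
  Real.exp (-(potential (δ.1 + δ.2 - j) i (i / (δ.1 + δ.2 - j)) + potential δ.2 j (j / δ.2)))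

lemma weight_pos (δ : ℤ × ℤ) (i j : ℕ) : 0 < weight δ i j := Real.exp_pos _

lemma contDiff_toPolytope : ContDiff ℝ ∞ fun q : ℝ × ℝ => toPolytope q.1 q.2 := by
  unfold toPolytope
  fun_prop

lemma contDiffOn_leg {δ : ℤ × ℤ} {i j : ℝ} {K L : ℝ → ℝ} (hK : ContDiff ℝ ∞ K)
    (hL : ContDiff ℝ ∞ L) (hb : ∀ τ ∈ Icc (0 : ℝ) 1, Admissible δ.2 j (L τ)) :
    ContDiffOn ℝ ∞ (fun q : ℝ × ℝ => leg δ i j (K q.1) (L q.1) q.2) (Icc 0 1 ×ˢ Iic 0) := by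
  have hK' : ContDiff ℝ ∞ fun q : ℝ × ℝ => K q.1 := hK.comp contDiff_fst
  have hL' : ContDiff ℝ ∞ fun q : ℝ × ℝ => L q.1 := hL.comp contDiff_fst
  have h1 : ContDiff ℝ ∞ fun q : ℝ × ℝ => relax δ.2 j (L q.1) (q.2 / 2) :=
    (contDiff_relax δ.2 j).comp (hL'.prodMk (contDiff_snd.div_const 2))
  have h2 : ContDiffOn ℝ ∞ (fun q : ℝ × ℝ => clock δ.2 j (L q.1) q.2) (Icc 0 1 ×ˢ Iic 0) := by
    refine ContDiffOn.div (contDiff_snd.contDiffOn.add (contDiffOn_const.mul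
      (ContDiffOn.sub (ContDiffOn.log (contDiff_const.sub (contDiff_const.mul hL')).contDiffOn ?_)
        (ContDiffOn.log (contDiff_const.sub (contDiff_const.mul h1)).contDiffOn ?_))))
      (contDiff_const.sub (contDiff_const.mul ((contDiff_rest δ.2 j).comp hL'))).contDiffOn ?_
    · rintro q ⟨hq, -⟩
      linarith [(hb _ hq).le_one]
    · rintro q ⟨hq, hq'⟩
      have : q.2 ≤ 0 := hq'
      linarith [((hb _ hq).relax (s := q.2 / 2) (by linarith)).le_one]
    · rintro q ⟨hq, -⟩
      have := (hb _ hq).rest.le_one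
      change 4 - 2 * rest δ.2 j (L q.1) ≠ 0
      linarith
  have h3 : ContDiffOn ℝ ∞ (fun q : ℝ × ℝ => relax (δ.1 + δ.2 - j) i (K q.1)
      (clock δ.2 j (L q.1) q.2)) (Icc 0 1 ×ˢ Iic 0) :=
    (contDiff_relax _ i).comp_contDiffOn (hK'.contDiffOn.prodMk h2)
  exact contDiff_toPolytope.comp_contDiffOn (h3.prodMk h1.contDiffOn)

lemma contDiff_toPolytope_rest (m i b j : ℝ) {K L : ℝ → ℝ} (hK : ContDiff ℝ ∞ K)
    (hL : ContDiff ℝ ∞ L) :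
    ContDiff ℝ ∞ fun τ => toPolytope (rest m i (K τ)) (rest b j (L τ)) :=
  contDiff_toPolytope.comp (((contDiff_rest m i).comp hK).prodMk ((contDiff_rest b j).comp hL))

section Trees

variable {D₁ D₂ D₃ : ℤ × ℤ} {V₁₂ : MoGen D₁ D₂} {V₂₃ : MoGen D₂ D₃} {V₁₃ : MoGen D₁ D₃}
  {i₁ j₁ i₂ j₂ : ℕ}

lemma MoGen.HasValue.lagSection_eq {D D' : ℤ × ℤ} {V : MoGen D D'} {i j : ℕ}
    (h : V.HasValue i j) {v : ℝ × ℝ} (hv : v ∈ V.1) : lagSection (D' - D) v = ((i : ℝ), (j : ℝ)) := by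
  rw [h.eq] at hv
  exact hv.2

/-- The values add up along a gradient tree. -/
lemma GradientTree.value_eq (γ : GradientTree V₁₂ V₂₃ V₁₃) {i₃ j₃ : ℕ}
    (h₁ : V₁₂.HasValue i₁ j₁) (h₂ : V₂₃.HasValue i₂ j₂) (h₃ : V₁₃.HasValue i₃ j₃) :
    i₃ = i₁ + i₂ ∧ j₃ = j₁ + j₂ := by
  have h := γ.lift
  rw [lagDiff_eq, lagDiff_eq, lagDiff_eq, h₁.lagSection_eq γ.v₁₂_mem, h₂.lagSection_eq γ.v₂₃_mem,
    h₃.lagSection_eq γ.v₁₃_mem, Prod.mk_add_mk, Prod.mk.injEq] at h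
  exact ⟨by exact_mod_cast h.1.symm, by exact_mod_cast h.2.symm⟩

lemma MoGen.HasValue.exists_coordinates {D D' : ℤ × ℤ} {V : MoGen D D'} {i j : ℕ}
    (h : V.HasValue i j) {v : ℝ × ℝ} (hv : v ∈ V.1) : ∃ k l, v = toPolytope k l ∧
      0 ≤ k ∧ k ≤ 1 ∧ 0 ≤ l ∧ l ≤ 1 ∧ ((D' - D).2 : ℝ) * l = j ∧
      (((D' - D).1 : ℝ) + (D' - D).2 - j) * k = i := by
  rw [h.eq] at hv
  obtain ⟨k, l, hk0, hk1, hl0, hl1, rfl⟩ := exists_toPolytope_eq hv.1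
  exact ⟨k, l, rfl, hk0, hk1, hl0, hl1, (toPolytope_mem_fibreSet_iff hv.1).1 hv⟩

variable (h₁ : V₁₂.HasValue i₁ j₁) (h₂ : V₂₃.HasValue i₂ j₂)
  (h₃ : V₁₃.HasValue (i₁ + i₂) (j₁ + j₂))
include h₁ h₂

/-- All of m, b, i, j are additive. A point of the target is at rest for the sums, hence admissible
for them and for each summand, so that both backward trajectories stay in the polytope. -/
lemma admissible_of_add {k l : ℝ} (hk0 : 0 ≤ k) (hk1 : k ≤ 1) (hl0 : 0 ≤ l) (hl1 : l ≤ 1)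
    (hl : ((D₃ - D₁).2 : ℝ) * l = (j₁ + j₂ : ℕ))
    (hk : (((D₃ - D₁).1 : ℝ) + (D₃ - D₁).2 - (j₁ + j₂ : ℕ)) * k = (i₁ + i₂ : ℕ)) :
    Admissible ((D₂ - D₁).1 + (D₂ - D₁).2 - j₁) i₁ k ∧ Admissible (D₂ - D₁).2 j₁ l ∧
    Admissible ((D₃ - D₂).1 + (D₃ - D₂).2 - j₂) i₂ k ∧ Admissible (D₃ - D₂).2 j₂ l := by
  have a1 := cast_m_nonneg h₁.fst_le
  have a2 := cast_m_nonneg h₂.fst_le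
  have b1 : (j₁ : ℝ) ≤ (D₂ - D₁).2 := by exact_mod_cast h₁.snd_le
  have b2 : (j₂ : ℝ) ≤ (D₃ - D₂).2 := by exact_mod_cast h₂.snd_le
  have em : ((D₃ - D₁).1 : ℝ) + (D₃ - D₁).2 - (j₁ + j₂ : ℕ) = ((D₂ - D₁).1 + (D₂ - D₁).2 - j₁)
      + ((D₃ - D₂).1 + (D₃ - D₂).2 - j₂) := by
    simp only [Prod.fst_sub, Prod.snd_sub]; push_cast; ring
  have eb : ((D₃ - D₁).2 : ℝ) = (D₂ - D₁).2 + (D₃ - D₂).2 := by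
    simp only [Prod.snd_sub]; push_cast; ring
  rw [em, Nat.cast_add] at hk
  rw [eb, Nat.cast_add] at hl
  have n1 := Nat.cast_nonneg (α := ℝ) i₁
  have n2 := Nat.cast_nonneg (α := ℝ) i₂
  have n3 := Nat.cast_nonneg (α := ℝ) j₁
  have n4 := Nat.cast_nonneg (α := ℝ) j₂
  have A := Admissible.of_mul_eq (by linarith) hk0 hk1 hk
  have B := Admissible.of_mul_eq (by linarith) hl0 hl1 hl
  refine ⟨A.left n1 a1 n2 a2, B.left n3 b1 n4 b2, ?_, ?_⟩
  · rw [add_comm, add_comm (i₁ : ℝ)] at A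
    exact A.left n2 a2 n1 a1
  · rw [add_comm, add_comm (j₁ : ℝ)] at B
    exact B.left n4 b2 n3 b1

include h₃

/-- For every point of the target there is a gradient tree ending there. -/
lemma exists_gradientTree {k l : ℝ} (hk0 : 0 ≤ k) (hk1 : k ≤ 1) (hl0 : 0 ≤ l) (hl1 : l ≤ 1)
    (hl : ((D₃ - D₁).2 : ℝ) * l = (j₁ + j₂ : ℕ))
    (hk : (((D₃ - D₁).1 : ℝ) + (D₃ - D₁).2 - (j₁ + j₂ : ℕ)) * k = (i₁ + i₂ : ℕ)) :
    ∃ γ : GradientTree V₁₂ V₂₃ V₁₃,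
      γ.v₁₂ = toPolytope (rest ((D₂ - D₁).1 + (D₂ - D₁).2 - j₁) i₁ k) (rest (D₂ - D₁).2 j₁ l) ∧
      γ.v₂₃ = toPolytope (rest ((D₃ - D₂).1 + (D₃ - D₂).2 - j₂) i₂ k) (rest (D₃ - D₂).2 j₂ l) ∧
      γ.v₁₃ = toPolytope k l ∧ γ.γ₁₂ = leg (D₂ - D₁) i₁ j₁ k l ∧
      γ.γ₂₃ = leg (D₃ - D₂) i₂ j₂ k l ∧ γ.γ₁₃ = fun _ => toPolytope k l := by
  obtain ⟨A1, B1, A2, B2⟩ := admissible_of_add h₁ h₂ hk0 hk1 hl0 hl1 hl hk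
  have hP := toPolytope_mem hk0 hk1 hl0 hl1
  have hv : toPolytope k l ∈ fibreSet (D₃ - D₁) (i₁ + i₂ : ℕ) (j₁ + j₂ : ℕ) :=
    (toPolytope_mem_fibreSet_iff hP).2 ⟨hl, hk⟩
  have m1 := rest_mem_fibreSet A1 B1
  have m2 := rest_mem_fibreSet A2 B2
  refine ⟨⟨_, _, _, _, _, _, h₁.eq ▸ m1, h₂.eq ▸ m2, h₃.eq ▸ hv,
    fun t ht => ⟨leg_mem A1 B1 ht, (hasDerivAt_leg A1 B1 m1.2 ht).hasDerivWithinAt⟩,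
    fun t ht => ⟨leg_mem A2 B2 ht, (hasDerivAt_leg A2 B2 m2.2 ht).hasDerivWithinAt⟩,
    fun t _ => ⟨hP, ?_⟩, tendsto_leg A1 B1, tendsto_leg A2 B2, tendsto_const_nhds,
    leg_zero _ _ _ _ _, leg_zero _ _ _ _ _, ?_⟩, rfl, rfl, rfl, rfl, rfl, rfl⟩
  · have : gradField D₁ D₃ (toPolytope k l) (toPolytope k l) = 0 := by simp [gradField]
    rw [this]
    exact hasDerivWithinAt_const _ _ _
  · rw [lagDiff_eq, lagDiff_eq, lagDiff_eq, m1.2, m2.2, hv.2]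
    simp

/-- The edges of a gradient tree are determined by its end. -/
lemma GradientTree.exists_eq (γ : GradientTree V₁₂ V₂₃ V₁₃) (h : 0 ≤ (D₃ - D₁).2) :
    ∃ k l, 0 ≤ k ∧ k ≤ 1 ∧ 0 ≤ l ∧ l ≤ 1 ∧ ((D₃ - D₁).2 : ℝ) * l = (j₁ + j₂ : ℕ) ∧
      (((D₃ - D₁).1 : ℝ) + (D₃ - D₁).2 - (j₁ + j₂ : ℕ)) * k = (i₁ + i₂ : ℕ) ∧
      (∀ t ≥ 0, γ.γ₁₃ t = γ.v₁₃) ∧ γ.v₁₃ = toPolytope k l ∧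
      EqOn γ.γ₁₂ (leg (D₂ - D₁) i₁ j₁ k l) (Iic 0) ∧
      EqOn γ.γ₂₃ (leg (D₃ - D₂) i₂ j₂ k l) (Iic 0) := by
  obtain ⟨k, l, hv, hk0, hk1, hl0, hl1, hl, hk⟩ := h₃.exists_coordinates γ.v₁₃_mem
  obtain ⟨A1, B1, A2, B2⟩ := admissible_of_add h₁ h₂ hk0 hk1 hl0 hl1 hl hk
  have hc : ∀ t ≥ 0, γ.γ₁₃ t = γ.v₁₃ := fun t ht => eq_of_tendsto_generator
    (h₃.eq ▸ γ.v₁₃_mem) h ((Nat.cast_nonneg _).trans (cast_m_nonneg h₃.fst_le))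
    (fun t ht => (γ.flow₁₃ t ht).2) γ.end₁₃ ht
  refine ⟨k, l, hk0, hk1, hl0, hl1, hl, hk, hc, hv, fun t ht => ?_, fun t ht => ?_⟩
  · exact eq_leg A1 B1 (h₁.lagSection_eq γ.v₁₂_mem) γ.flow₁₂
      (by rw [γ.vertex₁₂, hc 0 le_rfl, hv]) ht
  · exact eq_leg A2 B2 (h₂.lagSection_eq γ.v₂₃_mem) γ.flow₂₃
      (by rw [γ.vertex₂₃, hc 0 le_rfl, hv]) ht

/-- All gradient trees with the same ends are homotopic. -/
lemma GradientTree.homotopic (γ γ' : GradientTree V₁₂ V₂₃ V₁₃) (h : 0 ≤ (D₃ - D₁).2) :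
    γ.Homotopic γ' := by
  obtain ⟨k, l, hk0, hk1, hl0, hl1, hl, hk, hc, hv, e1, e2⟩ := γ.exists_eq h₁ h₂ h₃ h
  obtain ⟨k', l', hk0', hk1', hl0', hl1', hl', hk', hc', hv', e1', e2'⟩ := γ'.exists_eq h₁ h₂ h₃ h
  -- A homotopy is a family over all real τ, while the segment between the ends is available only
  -- over [0, 1]; outside the family is frozen.
  let s : ℝ → ℝ := fun τ => max 0 (min τ 1)
  have hs : ∀ τ, 0 ≤ s τ ∧ s τ ≤ 1 := fun τ =>
    ⟨le_max_left _ _, max_le zero_le_one (min_le_right _ _)⟩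
  have hsI : ∀ τ ∈ Icc (0 : ℝ) 1, s τ = τ := fun τ hτ => by
    simp only [s, min_eq_left hτ.2, max_eq_right hτ.1]
  -- The ends are joined by a segment in (k, l), in which the equations of the target are linear.
  let K : ℝ → ℝ := fun τ => (1 - τ) * k + τ * k'
  let L : ℝ → ℝ := fun τ => (1 - τ) * l + τ * l'
  have hK : ContDiff ℝ ∞ K := by fun_prop
  have hL : ContDiff ℝ ∞ L := by fun_prop
  have hK0 : ∀ τ ∈ Icc (0 : ℝ) 1, 0 ≤ K τ := fun τ hτ => by
    simp only [K]; nlinarith [hτ.1, hτ.2]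
  have hK1 : ∀ τ ∈ Icc (0 : ℝ) 1, K τ ≤ 1 := fun τ hτ => by
    simp only [K]; nlinarith [hτ.1, hτ.2]
  have hL0 : ∀ τ ∈ Icc (0 : ℝ) 1, 0 ≤ L τ := fun τ hτ => by
    simp only [L]; nlinarith [hτ.1, hτ.2]
  have hL1 : ∀ τ ∈ Icc (0 : ℝ) 1, L τ ≤ 1 := fun τ hτ => by
    simp only [L]; nlinarith [hτ.1, hτ.2]
  have hLe : ∀ τ, ((D₃ - D₁).2 : ℝ) * L τ = (j₁ + j₂ : ℕ) := fun τ => by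
    simp only [L]
    linear_combination (1 - τ) * hl + τ * hl'
  have hKe : ∀ τ, (((D₃ - D₁).1 : ℝ) + (D₃ - D₁).2 - (j₁ + j₂ : ℕ)) * K τ = (i₁ + i₂ : ℕ) :=
    fun τ => by
      simp only [K]
      linear_combination (1 - τ) * hk + τ * hk'
  have ex : ∀ τ : ℝ, _ := fun τ => exists_gradientTree h₁ h₂ h₃ (hK0 _ (hs τ)) (hK1 _ (hs τ))
    (hL0 _ (hs τ)) (hL1 _ (hs τ)) (hLe (s τ)) (hKe (s τ))
  choose Γ g1 g2 g3 g4 g5 g6 using ex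
  have hadm : ∀ τ ∈ Icc (0 : ℝ) 1, _ := fun τ hτ => admissible_of_add h₁ h₂ (hK0 τ hτ) (hK1 τ hτ)
    (hL0 τ hτ) (hL1 τ hτ) (hLe τ) (hKe τ)
  have s0 : s 0 = 0 := hsI 0 (by simp)
  have s1 : s 1 = 1 := hsI 1 (by simp)
  have K0 : K 0 = k := by simp [K]
  have L0 : L 0 = l := by simp [L]
  have K1 : K 1 = k' := by simp [K]
  have L1 : L 1 = l' := by simp [L]
  refine ⟨Γ, ⟨?_, ?_, ?_⟩, ⟨?_, ?_, ?_⟩, ?_, ?_, ?_, ?_, ?_, ?_⟩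
  · rw [g4, s0, K0, L0]; exact e1.symm
  · rw [g5, s0, K0, L0]; exact e2.symm
  · intro t ht
    rw [g6, s0, K0, L0, hc t ht, hv]
  · rw [g4, s1, K1, L1]; exact e1'.symm
  · rw [g5, s1, K1, L1]; exact e2'.symm
  · intro t ht
    rw [g6, s1, K1, L1, hc' t ht, hv']
  · refine (contDiff_toPolytope_rest ((D₂ - D₁).1 + (D₂ - D₁).2 - j₁) i₁ (D₂ - D₁).2 j₁ hK
      hL).contDiffOn.congr fun τ hτ => ?_
    rw [g1, hsI τ hτ]
  · refine (contDiff_toPolytope_rest ((D₃ - D₂).1 + (D₃ - D₂).2 - j₂) i₂ (D₃ - D₂).2 j₂ hK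
      hL).contDiffOn.congr fun τ hτ => ?_
    rw [g2, hsI τ hτ]
  · refine (contDiff_toPolytope.comp (hK.prodMk hL)).contDiffOn.congr fun τ hτ => ?_
    rw [g3, hsI τ hτ]
    rfl
  · refine (contDiffOn_leg (i := i₁) hK hL fun τ hτ => (hadm τ hτ).2.1).congr fun q hq => ?_
    rw [g4, hsI _ hq.1]
  · refine (contDiffOn_leg (i := i₂) hK hL fun τ hτ => (hadm τ hτ).2.2.2).congr fun q hq => ?_
    rw [g5, hsI _ hq.1]
  · refine (contDiff_toPolytope.comp ((hK.comp contDiff_fst).prodMk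
      (hL.comp contDiff_fst))).contDiffOn.congr fun q hq => ?_
    rw [g6, hsI _ hq.1]
    rfl

/-- The constant root has no area. The leaves contribute the potentials at the vertex minus those at
the starting points. The potentials at the vertex add up to the potential of the target, which is
constant on the target, so the choice of the end does not matter. -/
lemma GradientTree.exp_neg_area (γ : GradientTree V₁₂ V₂₃ V₁₃) (h : 0 ≤ (D₃ - D₁).2) :
    Real.exp (-γ.area) = weight (D₃ - D₁) (i₁ + i₂) (j₁ + j₂)
      / (weight (D₂ - D₁) i₁ j₁ * weight (D₃ - D₂) i₂ j₂) := by
  obtain ⟨k, l, hk0, hk1, hl0, hl1, hl, hk, hc, hv, -, -⟩ := γ.exists_eq h₁ h₂ h₃ h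
  obtain ⟨A1, B1, A2, B2⟩ := admissible_of_add h₁ h₂ hk0 hk1 hl0 hl1 hl hk
  have hroot : ∫ t in Ici (0 : ℝ),
      baseMetric (γ.γ₁₃ t) (deriv γ.γ₁₃ t) (gradField D₁ D₃ γ.v₁₃ (γ.γ₁₃ t)) = 0 := by
    rw [setIntegral_congr_fun (g := fun _ => (0 : ℝ)) measurableSet_Ici fun t ht => ?_]
    · simp
    · simp [hc t ht, gradField, baseMetric]
  have a1 := leaf_area A1 B1 (h₁.lagSection_eq γ.v₁₂_mem) γ.flow₁₂
    (by rw [γ.vertex₁₂, hc 0 le_rfl, hv])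
  have a2 := leaf_area A2 B2 (h₂.lagSection_eq γ.v₂₃_mem) γ.flow₂₃
    (by rw [γ.vertex₂₃, hc 0 le_rfl, hv])
  have em : ((D₃ - D₁).1 : ℝ) + (D₃ - D₁).2 - (j₁ + j₂ : ℕ) = ((D₂ - D₁).1 + (D₂ - D₁).2 - j₁)
      + ((D₃ - D₂).1 + (D₃ - D₂).2 - j₂) := by
    simp only [Prod.fst_sub, Prod.snd_sub]; push_cast; ring
  have eb : ((D₃ - D₁).2 : ℝ) = (D₂ - D₁).2 + (D₃ - D₂).2 := by
    simp only [Prod.snd_sub]; push_cast; ring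
  have p1 := potential_of_mul_eq hk
  have p2 := potential_of_mul_eq hl
  have q1 : potential (((D₃ - D₁).1 : ℝ) + (D₃ - D₁).2 - (j₁ + j₂ : ℕ)) (i₁ + i₂ : ℕ) k
      = potential ((D₂ - D₁).1 + (D₂ - D₁).2 - j₁) i₁ k
        + potential ((D₃ - D₂).1 + (D₃ - D₂).2 - j₂) i₂ k := by
    rw [em, Nat.cast_add, potential_add]
  have q2 : potential ((D₃ - D₁).2 : ℝ) (j₁ + j₂ : ℕ) l
      = potential (D₂ - D₁).2 j₁ l + potential (D₃ - D₂).2 j₂ l := by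
    rw [eb, Nat.cast_add, potential_add]
  rw [GradientTree.area, hroot, a1, a2, weight, weight, weight, ← Real.exp_add, ← Real.exp_sub,
    ← p1, ← p2, q1, q2]
  congr 1
  ring

theorem treeCount_eq (h : 0 ≤ (D₃ - D₁).2) :
    treeCount V₁₂ V₂₃ V₁₃ = weight (D₃ - D₁) (i₁ + i₂) (j₁ + j₂)
      / (weight (D₂ - D₁) i₁ j₁ * weight (D₃ - D₂) i₂ j₂) := by
  obtain ⟨v, hv⟩ := exists_mem_fibreSet h₃.snd_le h₃.fst_le
  rw [← h₃.eq] at hv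
  obtain ⟨k, l, -, hk0, hk1, hl0, hl1, hl, hk⟩ := h₃.exists_coordinates hv
  obtain ⟨γ, -⟩ := exists_gradientTree h₁ h₂ h₃ hk0 hk1 hl0 hl1 hl hk
  let _ : Unique (Quot (GradientTree.Homotopic (V₁₂ := V₁₂) (V₂₃ := V₂₃) (V₁₃ := V₁₃))) :=
    { default := Quot.mk _ γ
      uniq := fun C => Quot.inductionOn C fun γ' => Quot.sound (γ'.homotopic h₁ h₂ h₃ γ h) }
  rw [treeCount, finsum_unique]
  exact GradientTree.exp_neg_area h₁ h₂ h₃ _ h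

omit h₃ in
lemma treeCount_eq_zero {i₃ j₃ : ℕ} (h₃ : V₁₃.HasValue i₃ j₃)
    (h : ¬ (i₃ = i₁ + i₂ ∧ j₃ = j₁ + j₂)) : treeCount V₁₂ V₂₃ V₁₃ = 0 := by
  have : IsEmpty (Quot (GradientTree.Homotopic (V₁₂ := V₁₂) (V₂₃ := V₂₃) (V₁₃ := V₁₃))) :=
    ⟨fun C => Quot.inductionOn C fun γ => h (γ.value_eq h₁ h₂ h₃)⟩
  exact finsum_of_isEmpty _

end Trees

/-! ### The functor from the Morse homotopy category to the DG category -/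

/-- The differences of the members of a collection are effective in one direction, and without any
cohomology in the other. -/
def IsStrongCollection {ι : Type} (E : ι → ℤ × ℤ) : Prop :=
  ∀ x y, Effective (E y - E x) ∨ (E y - E x).2 = -1 ∨ E y - E x = (-1, 0)

/-- The condition c ≥ 0 is needed for the difference (c - 1, 1) between the second and the third
object. -/
lemma isStrongCollection_collection (c : ℕ) : IsStrongCollection (collection c) := by
  intro x y
  have hc : (0 : ℤ) ≤ c := Int.natCast_nonneg c
  fin_cases x <;> fin_cases y <;> simp [collection, Effective] <;> omega

section Composition

variable {D₁ D₂ D₃ : ℤ × ℤ}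

/-- The composition of two generators. -/
def treeSum (V : MoGen D₁ D₂) (W : MoGen D₂ D₃) : MoHom D₁ D₃ :=
  ∑ᶠ (U : MoGen D₁ D₃) (_ : U.dim = V.dim + W.dim), Finsupp.single U (treeCount V W U : ℂ)

lemma moComp_eq (f : MoHom D₁ D₂) (g : MoHom D₂ D₃) :
    moComp f g = f.sum fun V a => g.sum fun W b => (a * b) • treeSum V W := by
  simp only [moComp, treeSum]
  refine Finsupp.sum_congr fun V _ => Finsupp.sum_congr fun W _ => ?_
  rw [smul_finsum]
  refine finsum_congr fun U => ?_
  rw [smul_finsum]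
  refine finsum_congr fun _ => ?_
  rw [Finsupp.smul_single, smul_eq_mul]

lemma moComp_single (V : MoGen D₁ D₂) (W : MoGen D₂ D₃) (a b : ℂ) :
    moComp (Finsupp.single V a) (Finsupp.single W b) = (a * b) • treeSum V W := by
  rw [moComp_eq, Finsupp.sum_single_index, Finsupp.sum_single_index] <;> simp

lemma add_moComp (f g : MoHom D₁ D₂) (h : MoHom D₂ D₃) :
    moComp (f + g) h = moComp f h + moComp g h := by
  simp only [moComp_eq]
  refine Finsupp.sum_add_index' (fun V => by simp) fun V a b => ?_
  rw [← Finsupp.sum_add]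
  simp only [add_mul, add_smul]

lemma moComp_add (f : MoHom D₁ D₂) (g h : MoHom D₂ D₃) :
    moComp f (g + h) = moComp f g + moComp f h := by
  simp only [moComp_eq]
  rw [← Finsupp.sum_add]
  refine Finsupp.sum_congr fun V _ => Finsupp.sum_add_index' (fun W => by simp) fun W a b => ?_
  rw [mul_add, add_smul]

lemma smul_moComp (c : ℂ) (f : MoHom D₁ D₂) (g : MoHom D₂ D₃) :
    moComp (c • f) g = c • moComp f g := by
  simp only [moComp_eq]
  rw [Finsupp.sum_smul_index' fun V => by simp, Finsupp.smul_sum]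
  refine Finsupp.sum_congr fun V _ => ?_
  rw [Finsupp.smul_sum]
  simp only [smul_eq_mul, mul_assoc, mul_smul]

lemma moComp_smul (c : ℂ) (f : MoHom D₁ D₂) (g : MoHom D₂ D₃) :
    moComp f (c • g) = c • moComp f g := by
  simp only [moComp_eq]
  rw [Finsupp.smul_sum]
  refine Finsupp.sum_congr fun V _ => ?_
  rw [Finsupp.sum_smul_index' fun W => by simp, Finsupp.smul_sum]
  simp only [smul_eq_mul, mul_left_comm _ c, mul_smul]

end Composition

section Generators

variable {D D' : ℤ × ℤ}

lemma MoGen.exists_hasValue (h : Effective (D' - D)) (V : MoGen D D') :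
    ∃ i j, V.HasValue i j := by
  obtain ⟨i, j, hj, hi, hV⟩ := V.exists_nat h
  exact ⟨i, j, hj, hi, hV⟩

lemma MoGen.HasValue.unique {V : MoGen D D'} {i j i' j' : ℕ} (h : V.HasValue i j)
    (h' : V.HasValue i' j') : i = i' ∧ j = j' :=
  fibreSet_injective h.snd_le h.fst_le (h.eq.symm.trans h'.eq)

lemma MoGen.HasValue.ext {V W : MoGen D D'} {i j : ℕ} (h : V.HasValue i j) (h' : W.HasValue i j) :
    V = W := Subtype.ext (h.eq.trans h'.eq.symm)

lemma exists_moGen_hasValue (h : Effective (D' - D)) {i j : ℕ} (hj : (j : ℤ) ≤ (D' - D).2)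
    (hi : (i : ℤ) ≤ (D' - D).1 + (D' - D).2 - j) : ∃ V : MoGen D D', V.HasValue i j := by
  obtain ⟨V, hV⟩ := exists_moGen h hj hi
  exact ⟨V, hj, hi, hV⟩

open Classical in
/-- The holomorphic section which corresponds to a generator. -/
def genSection (V : MoGen D D') : DGHom (D' - D) :=
  if h : ∃ q : ℕ × ℕ, V.HasValue q.1 q.2 then
    ((weight (D' - D) h.choose.1 h.choose.2 : ℂ))⁻¹ •
      monomial (D' - D) h.choose.1 h.choose.2 h.choose_spec.snd_le h.choose_spec.fst_le
  else 0

lemma MoGen.HasValue.genSection_eq {V : MoGen D D'} {i j : ℕ} (h : V.HasValue i j) :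
    genSection V = ((weight (D' - D) i j : ℂ))⁻¹ • monomial (D' - D) i j h.snd_le h.fst_le := by
  have hex : ∃ q : ℕ × ℕ, V.HasValue q.1 q.2 := ⟨(i, j), h⟩
  obtain ⟨h1, h2⟩ := hex.choose_spec.unique h
  rw [genSection, dif_pos hex]
  congr!

lemma genSection_mem (V : MoGen D D') : genSection V ∈ dgDeg (D' - D) 0 := by
  rw [genSection]
  split_ifs
  · exact Submodule.smul_mem _ _ (monomial_mem _ _ _ _)
  · exact zero_mem _

lemma dgDiff_genSection (V : MoGen D D') : dgDiff (genSection V) = 0 := by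
  rw [genSection]
  split_ifs
  · rw [dgDiff_smul, dgDiff_monomial, smul_zero]
  · exact dgDiff_zero

/-- The linear map on morphism spaces of the functor. -/
def moMap (D D' : ℤ × ℤ) : MoHom D D' →ₗ[ℂ] DGHom (D' - D) :=
  Finsupp.linearCombination ℂ genSection

lemma moMap_single (V : MoGen D D') (a : ℂ) : moMap D D' (Finsupp.single V a) = a • genSection V :=
  Finsupp.linearCombination_single _ _ _

lemma moMap_mem (f : MoHom D D') : moMap D D' f ∈ dgDeg (D' - D) 0 := by
  induction f using Finsupp.induction_linear with
  | zero => rw [map_zero]; exact zero_mem _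
  | add f g hf hg => rw [map_add]; exact add_mem hf hg
  | single V a => rw [moMap_single]; exact Submodule.smul_mem _ _ (genSection_mem V)

lemma dgDiff_moMap (f : MoHom D D') : dgDiff (moMap D D' f) = 0 := by
  induction f using Finsupp.induction_linear with
  | zero => rw [map_zero, dgDiff_zero]
  | add f g hf hg => rw [map_add, dgDiff_add, hf, hg, add_zero]
  | single V a => rw [moMap_single, dgDiff_smul, dgDiff_genSection, smul_zero]

/-- The character `(u, v) ↦ u ^ i * v ^ j`. -/
def monomialHom (q : ℕ × ℕ) : ℂ × ℂ →* ℂ where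
  toFun p := p.1 ^ q.1 * p.2 ^ q.2
  map_one' := by simp
  map_mul' p r := by simp [mul_pow]; ring

lemma monomialHom_injective : Function.Injective monomialHom := by
  intro q q' h
  have h1 := DFunLike.congr_fun h (2, 1)
  have h2 := DFunLike.congr_fun h (1, 2)
  simp only [monomialHom, MonoidHom.coe_mk, OneHom.coe_mk, one_pow, mul_one, one_mul] at h1 h2
  exact Prod.ext (Nat.pow_right_injective le_rfl (by exact_mod_cast h1))
    (Nat.pow_right_injective le_rfl (by exact_mod_cast h2))

/-- Distinct generators go to nonzero multiples of distinct characters of the multiplicative monoid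
ℂ × ℂ, which are linearly independent by Dedekind. -/
lemma moMap_injective (h : Effective (D' - D)) : Function.Injective (moMap D D') := by
  choose i j hij using fun V : MoGen D D' => V.exists_hasValue h
  let value : (DGHom (D' - D)) →ₗ[ℂ] (ℂ × ℂ → ℂ) :=
    { toFun := fun ψ => ψ.1 .U₂ .one
      map_add' := fun _ _ => rfl
      map_smul' := fun _ _ => rfl }
  have hinj : Function.Injective fun V : MoGen D D' => monomialHom (i V, j V) := by
    intro V W hVW
    have e := monomialHom_injective hVW
    rw [Prod.mk.injEq] at e
    have hW := hij W
    rw [← e.1, ← e.2] at hW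
    exact (hij V).ext hW
  have hli := ((linearIndependent_monoidHom (ℂ × ℂ) ℂ).comp _ hinj).units_smul fun V =>
    Units.mk0 ((weight (D' - D) (i V) (j V) : ℂ))⁻¹
      (inv_ne_zero (by exact_mod_cast (weight_pos _ _ _).ne'))
  refine LinearIndependent.of_comp value (v := genSection) ?_
  have e : value ∘ genSection = (fun V => Units.mk0 ((weight (D' - D) (i V) (j V) : ℂ))⁻¹
      (inv_ne_zero (by exact_mod_cast (weight_pos _ _ _).ne'))) •
        (fun f : ℂ × ℂ →* ℂ => (f : ℂ × ℂ → ℂ)) ∘ fun V => monomialHom (i V, j V) := by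
    funext V
    simp only [Function.comp, (hij V).genSection_eq]
    rfl
  rw [e]
  exact hli

end Generators

section Functor

variable {ι : Type} {E : ι → ℤ × ℤ} (hE : IsStrongCollection E) {x y z : ι}
include hE

lemma effective_of_moGen (V : MoGen (E x) (E y)) : Effective (E y - E x) := by
  rcases hE x y with h | h
  · exact h
  · exact ((MoGen.isEmpty h).false V).elim

/-- Effective differences are not closed under addition in general, since b = 2 could occur; the
trichotomy for the collection excludes this. -/
lemma effective_trans (h : Effective (E y - E x)) (h' : Effective (E z - E y)) :
    Effective (E z - E x) := by
  rcases hE x z with h'' | h'' | h''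
  · exact h''
  · simp only [Effective, Prod.fst_sub, Prod.snd_sub] at *
    omega
  · rw [Prod.ext_iff] at h''
    simp only [Effective, Prod.fst_sub, Prod.snd_sub] at *
    omega

lemma moMap_injective_of_isStrongCollection :
    Function.Injective (moMap (E x) (E y)) := by
  rcases hE x y with h | h
  · exact moMap_injective h
  · have := MoGen.isEmpty h
    exact Function.injective_of_subsingleton _

/-- The composition of two generators is a multiple of the generator where their values add up. -/
lemma exists_treeSum_eq {V : MoGen (E x) (E y)} {W : MoGen (E y) (E z)} {i₁ j₁ i₂ j₂ : ℕ}
    (hV : V.HasValue i₁ j₁) (hW : W.HasValue i₂ j₂) :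
    ∃ U : MoGen (E x) (E z), U.HasValue (i₁ + i₂) (j₁ + j₂) ∧
      treeSum V W = ((weight (E z - E x) (i₁ + i₂) (j₁ + j₂) : ℂ)
        / (weight (E y - E x) i₁ j₁ * weight (E z - E y) i₂ j₂)) • Finsupp.single U 1 := by
  have hxy := effective_of_moGen hE V
  have hyz := effective_of_moGen hE W
  have hxz := effective_trans hE hxy hyz
  obtain ⟨U, hU⟩ := exists_moGen_hasValue (D := E x) (D' := E z) (i := i₁ + i₂) (j := j₁ + j₂) hxz
    (by
      have h1 := hV.snd_le
      have h2 := hW.snd_le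
      simp only [Prod.snd_sub] at *
      push_cast
      omega)
    (by
      have h1 := hV.fst_le
      have h2 := hW.fst_le
      simp only [Prod.snd_sub, Prod.fst_sub] at *
      push_cast
      omega)
  refine ⟨U, hU, ?_⟩
  rw [treeSum, finsum_eq_single _ U fun U' hU' => ?_]
  · have hd : U.dim = V.dim + W.dim := by
      rw [U.dim_eq_zero hxz, V.dim_eq_zero hxy, W.dim_eq_zero hyz, add_zero]
    rw [finsum_eq_if, if_pos hd, treeCount_eq hV hW hU hxz.nonneg, Finsupp.smul_single, smul_eq_mul,
      mul_one]
    push_cast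
    rfl
  · obtain ⟨i₃, j₃, h3⟩ := U'.exists_hasValue hxz
    have h0 : treeCount V W U' = 0 := treeCount_eq_zero hV hW h3 fun h => hU' <| by
      obtain ⟨rfl, rfl⟩ := h
      exact h3.ext hU
    simp [h0]

omit hE in
lemma dgComp_monomial {D₁ D₂ D₃ : ℤ × ℤ} {i₁ j₁ i₂ j₂ : ℕ} (hj₁ : (j₁ : ℤ) ≤ (D₂ - D₁).2)
    (hi₁ : (i₁ : ℤ) ≤ (D₂ - D₁).1 + (D₂ - D₁).2 - j₁) (hj₂ : (j₂ : ℤ) ≤ (D₃ - D₂).2)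
    (hi₂ : (i₂ : ℤ) ≤ (D₃ - D₂).1 + (D₃ - D₂).2 - j₂) (hj : ((j₁ + j₂ : ℕ) : ℤ) ≤ (D₃ - D₁).2)
    (hi : ((i₁ + i₂ : ℕ) : ℤ) ≤ (D₃ - D₁).1 + (D₃ - D₁).2 - (j₁ + j₂ : ℕ)) :
    dgComp (monomial (D₂ - D₁) i₁ j₁ hj₁ hi₁) (monomial (D₃ - D₂) i₂ j₂ hj₂ hi₂)
      = monomial (D₃ - D₁) (i₁ + i₂) (j₁ + j₂) hj hi := by
  refine DGHom.ext_torus fun k p _ => ?_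
  rw [dgComp_apply]
  cases k
  · simp only [LocalForm.wedge, Pi.mul_apply, monomial_apply]
    ring
  all_goals simp [LocalForm.wedge, monomial, ofFun]

/-- On generators, the factor w₁₃ / (w₁₂ w₂₃) of the tree is exactly the discrepancy between the
normalizations of the monomials. -/
lemma moMap_moComp (f : MoHom (E x) (E y)) (g : MoHom (E y) (E z)) :
    moMap (E x) (E z) (moComp f g) = dgComp (moMap (E x) (E y) f) (moMap (E y) (E z) g) := by
  have hD := DGCat_isDG E
  have smul_comp : ∀ (c : ℂ) (ψ : DGHom (E y - E x)) (χ : DGHom (E z - E y)),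
    dgComp (c • ψ) χ = c • dgComp ψ χ := fun c ψ χ => hD.smul_comp c ψ χ
  have comp_smul : ∀ (c : ℂ) (ψ : DGHom (E y - E x)) (χ : DGHom (E z - E y)),
    dgComp ψ (c • χ) = c • dgComp ψ χ := fun c ψ χ => hD.comp_smul c ψ χ
  have add_comp : ∀ (ψ ψ' : DGHom (E y - E x)) (χ : DGHom (E z - E y)),
    dgComp (ψ + ψ') χ = dgComp ψ χ + dgComp ψ' χ := fun ψ ψ' χ => hD.add_comp ψ ψ' χ
  have comp_add : ∀ (ψ : DGHom (E y - E x)) (χ χ' : DGHom (E z - E y)),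
    dgComp ψ (χ + χ') = dgComp ψ χ + dgComp ψ χ' := fun ψ χ χ' => hD.comp_add ψ χ χ'
  induction f using Finsupp.induction_linear with
  | zero =>
    have h1 := smul_moComp (0 : ℂ) (0 : MoHom (E x) (E y)) g
    have h2 := smul_comp 0 0 (moMap (E y) (E z) g)
    rw [zero_smul, zero_smul] at h1 h2
    rw [h1, map_zero, map_zero, h2]
  | add f f' hf hf' => rw [add_moComp, map_add, map_add, add_comp, hf, hf']
  | single V a =>
    induction g using Finsupp.induction_linear with
    | zero =>
      have h1 := moComp_smul (0 : ℂ) (Finsupp.single V a) (0 : MoHom (E y) (E z))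
      have h2 := comp_smul 0 (moMap (E x) (E y) (Finsupp.single V a)) 0
      rw [zero_smul, zero_smul] at h1 h2
      rw [h1, map_zero, map_zero, h2]
    | add g g' hg hg' => rw [moComp_add, map_add, map_add, comp_add, hg, hg']
    | single W b =>
      obtain ⟨i₁, j₁, hV⟩ := V.exists_hasValue (effective_of_moGen hE V)
      obtain ⟨i₂, j₂, hW⟩ := W.exists_hasValue (effective_of_moGen hE W)
      obtain ⟨U, hU, hsum⟩ := exists_treeSum_eq hE hV hW
      rw [moComp_single, hsum, map_smul, map_smul, moMap_single, moMap_single, moMap_single,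
        hV.genSection_eq, hW.genSection_eq, hU.genSection_eq, smul_comp, smul_comp, comp_smul,
        comp_smul, dgComp_monomial _ _ _ _ hU.snd_le hU.fst_le]
      simp only [smul_smul]
      congr 1
      have hw : (weight (E z - E x) (i₁ + i₂) (j₁ + j₂) : ℂ) ≠ 0 := by
        exact_mod_cast (weight_pos _ _ _).ne'
      have hw1 : (weight (E y - E x) i₁ j₁ : ℂ) ≠ 0 := by exact_mod_cast (weight_pos _ _ _).ne'
      have hw2 : (weight (E z - E y) i₂ j₂ : ℂ) ≠ 0 := by exact_mod_cast (weight_pos _ _ _).ne'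
      field_simp

end Functor

/-! ### The Morse homotopy category -/

lemma isInternal_of_eq_top {M : Type} [AddCommGroup M] [Module ℂ M] {A : ℤ → Submodule ℂ M}
    (h0 : A 0 = ⊤) (h : ∀ r ≠ 0, A r = ⊥) : DirectSum.IsInternal A := by
  rw [DirectSum.isInternal_submodule_iff_iSupIndep_and_iSup_eq_top]
  refine ⟨fun r => ?_, eq_top_iff.2 (h0 ▸ le_iSup A 0)⟩
  by_cases hr : r = 0
  · subst hr
    have : ⨆ j, ⨆ (_ : j ≠ 0), A j = ⊥ := by
      simp only [iSup_eq_bot]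
      exact h
    rw [this]
    exact disjoint_bot_right
  · rw [h r hr]
    exact disjoint_bot_left

section Category

variable {ι : Type} {E : ι → ℤ × ℤ} (hE : IsStrongCollection E) {x y z : ι}
include hE

lemma moDeg_zero : moDeg (E x) (E y) 0 = ⊤ := by
  rw [eq_top_iff]
  intro f _
  rw [moDeg, Finsupp.mem_supported]
  intro V _
  exact ⟨0, rfl, by rw [V.dim_eq_zero (effective_of_moGen hE V), Nat.cast_zero]⟩

lemma moDeg_of_ne_zero {r : ℤ} (hr : r ≠ 0) : moDeg (E x) (E y) r = ⊥ := by
  rw [eq_bot_iff]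
  intro f hf
  rw [moDeg, Finsupp.mem_supported] at hf
  rw [Submodule.mem_bot]
  ext V
  by_contra hV
  obtain ⟨n, hn, hd⟩ := hf (Finsupp.mem_support_iff.2 hV)
  rw [V.dim_eq_zero (effective_of_moGen hE V)] at hd
  have : n = 0 := by exact_mod_cast hd.symm
  exact hr (by rw [← hn, this]; rfl)

omit hE in
lemma dgComp_one_left {D D' : ℤ × ℤ} (h1 : ((0 : ℕ) : ℤ) ≤ (D - D).2)
    (h2 : ((0 : ℕ) : ℤ) ≤ (D - D).1 + (D - D).2 - (0 : ℕ)) (ψ : DGHom (D' - D)) :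
    dgComp (monomial (D - D) 0 0 h1 h2) ψ = ψ := by
  refine DGHom.ext_torus fun k p _ => ?_
  rw [dgComp_apply]
  cases k <;> simp [LocalForm.wedge, monomial, ofFun, fibreMonomial]

omit hE in
lemma dgComp_one_right {D D' : ℤ × ℤ} (h1 : ((0 : ℕ) : ℤ) ≤ (D' - D').2)
    (h2 : ((0 : ℕ) : ℤ) ≤ (D' - D').1 + (D' - D').2 - (0 : ℕ)) (ψ : DGHom (D' - D)) :
    dgComp ψ (monomial (D' - D') 0 0 h1 h2) = ψ := by
  refine DGHom.ext_torus fun k p _ => ?_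
  rw [dgComp_apply]
  cases k <;> simp [LocalForm.wedge, monomial, ofFun, fibreMonomial]

omit hE in
/-- The generator which is the identity of an object. -/
lemma exists_moGen_unit (D : ℤ × ℤ) : ∃ V : MoGen D D, V.HasValue 0 0 :=
  exists_moGen_hasValue (Or.inl (by simp)) (by simp) (by simp)

omit hE in
lemma MoGen.HasValue.genSection_zero {D : ℤ × ℤ} {V : MoGen D D} (hV : V.HasValue 0 0) :
    genSection V = monomial (D - D) 0 0 hV.snd_le hV.fst_le := by
  rw [hV.genSection_eq]
  simp [weight, potential]

lemma mem_moDeg_zero (f : MoHom (E x) (E y)) : f ∈ moDeg (E x) (E y) 0 := by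
  rw [moDeg_zero hE]
  trivial

lemma eq_zero_of_mem_moDeg {r : ℤ} (hr : r ≠ 0) {f : MoHom (E x) (E y)}
    (hf : f ∈ moDeg (E x) (E y) r) : f = 0 := by
  rwa [moDeg_of_ne_zero hE hr, Submodule.mem_bot] at hf

omit hE in
lemma zero_moComp {D₁ D₂ D₃ : ℤ × ℤ} (g : MoHom D₂ D₃) : moComp (0 : MoHom D₁ D₂) g = 0 := by
  simpa using smul_moComp (0 : ℂ) (0 : MoHom D₁ D₂) g

omit hE in
lemma moComp_zero {D₁ D₂ D₃ : ℤ × ℤ} (f : MoHom D₁ D₂) : moComp f (0 : MoHom D₂ D₃) = 0 := by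
  simpa using moComp_smul (0 : ℂ) f (0 : MoHom D₂ D₃)

lemma moComp_mem {r s : ℤ} {f : MoHom (E x) (E y)} {g : MoHom (E y) (E z)}
    (hf : f ∈ moDeg (E x) (E y) r) (hg : g ∈ moDeg (E y) (E z) s) :
    moComp f g ∈ moDeg (E x) (E z) (r + s) := by
  by_cases hr : r = 0
  · by_cases hs : s = 0
    · rw [hr, hs, add_zero]
      exact mem_moDeg_zero hE _
    · rw [eq_zero_of_mem_moDeg hE hs hg, moComp_zero]
      exact zero_mem _
  · rw [eq_zero_of_mem_moDeg hE hr hf, zero_moComp]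
    exact zero_mem _

/-- Transported from the wedge product along the injective map `moMap`; no gluing of gradient trees
is involved. -/
lemma moComp_assoc {w : ι} (f : MoHom (E x) (E y)) (g : MoHom (E y) (E z)) (h : MoHom (E z) (E w)) :
    moComp (moComp f g) h = moComp f (moComp g h) := by
  apply moMap_injective_of_isStrongCollection hE
  rw [moMap_moComp hE, moMap_moComp hE, moMap_moComp hE, moMap_moComp hE]
  exact (DGCat_isDG E).assoc (moMap (E x) (E y) f) (moMap (E y) (E z) g) (moMap (E z) (E w) h)

lemma unit_moComp {V : MoGen (E x) (E x)} (hV : V.HasValue 0 0) (f : MoHom (E x) (E y)) :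
    moComp (Finsupp.single V 1) f = f := by
  apply moMap_injective_of_isStrongCollection hE
  rw [moMap_moComp hE, moMap_single, one_smul, hV.genSection_zero, dgComp_one_left]

lemma moComp_unit {V : MoGen (E y) (E y)} (hV : V.HasValue 0 0) (f : MoHom (E x) (E y)) :
    moComp f (Finsupp.single V 1) = f := by
  apply moMap_injective_of_isStrongCollection hE
  rw [moMap_moComp hE, moMap_single, one_smul, hV.genSection_zero, dgComp_one_right]

lemma MoCat_isDG : (MoCat E).IsDG where
  grading x y := isInternal_of_eq_top (moDeg_zero hE) fun _ hr => moDeg_of_ne_zero hE hr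
  m_nil _ := rfl
  m_three _ _ _ _ := rfl
  d_add _ _ := (add_zero (0 : MoHom _ _)).symm
  d_smul c _ := (smul_zero (A := MoHom _ _) c).symm
  add_comp f g h := add_moComp f g h
  smul_comp c f h := smul_moComp c f h
  comp_add f g h := moComp_add f g h
  comp_smul c f h := moComp_smul c f h
  d_deg _ _ _ := zero_mem _
  comp_deg _ _ _ _ hf hg := moComp_mem hE hf hg
  d_d _ := rfl
  leibniz {x y z} r f g _ := by
    have h : ∀ (f : MoHom (E x) (E y)) (g : MoHom (E y) (E z)),
        (0 : MoHom (E x) (E z)) = moComp 0 g + (-1 : ℂ) ^ r • moComp f 0 := fun f g => by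
      rw [zero_moComp, moComp_zero, smul_zero, add_zero]
    exact h f g
  assoc f g h := moComp_assoc hE f g h
  unit x := by
    obtain ⟨V, hV⟩ := exists_moGen_unit (E x)
    exact ⟨(Finsupp.single V 1 : MoHom (E x) (E x)), mem_moDeg_zero hE _, rfl,
      fun y f => unit_moComp hE hV f, fun y f => moComp_unit hE hV f⟩

/-- All entries of a composable sequence have degree `0`. -/
lemma isHomog_replicate (p : Chain (MoCat E).Hom x y) :
    p.IsHomog (fun x y r => ((MoCat E).deg x y r : Set ((MoCat E).Hom x y)))
      (List.replicate p.length 0) := by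
  induction p with
  | nil => trivial
  | cons f p ih =>
    refine ⟨?_, ih⟩
    exact mem_moDeg_zero hE _

/-- All morphisms have degree 0 and m_k has degree 2 - k, so only m₂ can be nonzero. -/
lemma MoCat_m_unique (m' : ∀ x y, Chain (MoCat E).Hom x y → (MoCat E).Hom x y)
    (h : ((MoCat E).withOp m').IsAInfCategory)
    (h₂ : ∀ {x y z} (f : (MoCat E).Hom x y) (g : (MoCat E).Hom y z),
      ((MoCat E).withOp m').m₂ f g = (MoCat E).m₂ f g)
    (p : Chain (MoCat E).Hom x y) : m' x y p = (MoCat E).m p := by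
  have key : ∀ {x y} (p : Chain (MoCat E).Hom x y), p.length ≠ 2 → m' x y p = 0 := by
    intro x y p hp
    have hd := h.m_deg p _ (isHomog_replicate hE p)
    have hd' : m' x y p ∈ moDeg (E x) (E y) ((List.replicate p.length (0 : ℤ)).sum + 2
      - (List.replicate p.length (0 : ℤ)).length) := hd
    refine eq_zero_of_mem_moDeg hE ?_ hd'
    rw [List.sum_replicate, List.length_replicate, smul_zero]
    omega
  cases p with
  | nil => exact key _ (by simp [Chain.length])
  | cons f p => cases p with
    | nil => exact key _ (by simp [Chain.length])
    | cons g p => cases p with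
      | nil => exact h₂ f g
      | cons h p => exact key _ (by simp [Chain.length])

/-! ### The functor and its action on cohomology -/

/-- The functor from the Morse homotopy category to the DG category. -/
def moFunctor : (MoCat E).LinearFunctor (DGCat E) where
  obj := id
  map x y := moMap (E x) (E y)
  map_deg x y r f hf := by
    by_cases hr : r = 0
    · subst hr
      exact moMap_mem f
    · have h : ∀ f ∈ moDeg (E x) (E y) r, moMap (E x) (E y) f ∈ dgDeg (E y - E x) r :=
        fun f hf => by
          rw [eq_zero_of_mem_moDeg hE hr hf, map_zero]
          exact zero_mem _
      exact h f hf
  map_m p := by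
    cases p with
    | nil => exact (map_zero _).symm
    | cons f p => cases p with
      | nil => exact (dgDiff_moMap f).trans (map_zero _).symm
      | cons g p => cases p with
        | nil => exact (moMap_moComp hE f g).symm
        | cons h p => exact (map_zero _).symm
  map_unit {x} e he := by
    obtain ⟨V, hV⟩ := exists_moGen_unit (E x)
    -- Strict units are unique: the product of e with the unit generator equals both.
    have e_eq : e = (Finsupp.single V 1 : MoHom (E x) (E x)) :=
      (moComp_unit hE hV e).symm.trans (he.m₂_left (Finsupp.single V 1 : MoHom (E x) (E x)))
    have hm : moMap (E x) (E x) e = monomial (E x - E x) 0 0 hV.snd_le hV.fst_le := by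
      rw [e_eq, moMap_single, one_smul, hV.genSection_zero]
    exact
      { mem_deg := moMap_mem e
        m₁_eq := dgDiff_moMap e
        m₂_left := fun {y} f =>
          (congrArg (fun u => dgComp u f) hm).trans (dgComp_one_left _ _ f)
        m₂_right := fun {y} f =>
          (congrArg (fun u => dgComp f u) hm).trans (dgComp_one_right _ _ f)
        m_eq := fun p q hpq => (DGCat_isDG E).m_eq_zero_of_length _ (by
          rw [Chain.length_append]
          simp only [Chain.length]
          omega) }

omit hE in
lemma eq_zero_of_mem_dgDeg {D : ℤ × ℤ} {r : ℤ} {ψ : DGHom D} (h : ψ ∈ dgDeg D r)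
    (hr : r < 0 ∨ 2 < r) : ψ = 0 := by
  refine DGHom.ext_chart fun i => ?_
  funext k
  refine h i k ?_
  cases k <;> simp only [Comp.degree] <;> omega

/-- The holomorphic sections come from the Morse homotopy category. -/
lemma exists_moMap_eq {ψ : DGHom (E y - E x)} (hψ : ψ ∈ dgDeg (E y - E x) 0)
    (hd : dgDiff ψ = 0) : ∃ f, moMap (E x) (E y) f = ψ := by
  have hspan : ∀ hb : (E y - E x).2 = 0 ∨ (E y - E x).2 = 1, -1 ≤ (E y - E x).1 →
      ψ ∈ LinearMap.range (moMap (E x) (E y)) := by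
    intro hb ha
    refine (Submodule.span_le.2 ?_) (mem_span_monomial hb ha hψ hd)
    rintro χ ⟨i, j, hj, hi, rfl⟩
    have he : Effective (E y - E x) := by
      rcases hE x y with h | h | h
      · exact h
      · omega
      -- For δ = (-1, 0) the spanning set is empty, as no exponents are allowed.
      · rw [h] at hj hi
        simp only at hj hi
        omega
    obtain ⟨V, hV⟩ := exists_moGen_hasValue he hj hi
    refine ⟨Finsupp.single V (weight (E y - E x) i j : ℂ), ?_⟩
    rw [moMap_single, hV.genSection_eq, smul_smul, mul_inv_cancel₀, one_smul]
    exact_mod_cast (weight_pos _ _ _).ne'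
  rcases hE x y with h | h | h
  · rcases h with h | h
    · exact hspan (Or.inl h.1) (by omega)
    · exact hspan (Or.inr h.1) h.2
  · exact ⟨0, by rw [map_zero, eq_zero_of_closed h hψ hd]⟩
  · exact hspan (Or.inl (by rw [h])) (by rw [h])

/-- Every closed form is cohomologous to the image of a morphism of the Morse homotopy category. -/
lemma exists_moMap_sub_eq {r : ℤ} {g : DGHom (E y - E x)} (hg : g ∈ dgDeg (E y - E x) r)
    (hd : dgDiff g = 0) : ∃ f ∈ moDeg (E x) (E y) r, ∃ h ∈ dgDeg (E y - E x) (r - 1),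
      moMap (E x) (E y) f - g = dgDiff h := by
  have hab : (E y - E x).2 = -1 ∨ ((E y - E x).2 = 0 ∨ (E y - E x).2 = 1) ∧
      -1 ≤ (E y - E x).1 := by
    rcases hE x y with h | h | h
    · rcases h with h | h <;> omega
    · exact Or.inl h
    · rw [h]
      simp
  by_cases h0 : r = 0
  · subst h0
    obtain ⟨f, hf⟩ := exists_moMap_eq hE hg hd
    exact ⟨f, mem_moDeg_zero hE f, 0, zero_mem _, by rw [hf, sub_self, dgDiff_zero]⟩
  · have hexact : ∃ h ∈ dgDeg (E y - E x) (r - 1), dgDiff h = g := by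
      by_cases h1 : r = 1
      · subst h1
        exact exists_dgDiff_eq_of_one hab hg hd
      · by_cases h2 : r = 2
        · subst h2
          exact exists_dgDiff_eq_of_two (by tauto) hg
        · exact ⟨0, zero_mem _, dgDiff_zero.trans (eq_zero_of_mem_dgDeg hg (by omega)).symm⟩
    obtain ⟨h, hh, rfl⟩ := hexact
    -- Outside degree 0 every closed form is exact, so the zero morphism represents its class.
    refine ⟨0, zero_mem _, (-1 : ℂ) • h, Submodule.smul_mem _ _ hh, ?_⟩
    rw [dgDiff_smul, map_zero, zero_sub]
    exact (neg_one_smul ℂ (dgDiff h)).symm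

lemma moFunctor_isEquivalence : (moFunctor hE).IsEquivalence where
  obj_bijective := Function.bijective_id
  cohomology_injective x y r f hf _ := by
    rintro ⟨h, hh, he⟩
    have hz : f = (0 : MoHom (E x) (E y)) := by
      by_cases hr : r = 0
      · subst hr
        -- A primitive of a form of degree 0 would have degree -1, so exactness means vanishing and
        -- injectivity of `moMap` suffices.
        have hh' : h = (0 : DGHom (E y - E x)) := eq_zero_of_mem_dgDeg hh (by omega)
        apply moMap_injective_of_isStrongCollection hE
        rw [map_zero]
        exact he.trans ((congrArg (dgDiff (D := E y - E x)) hh').trans dgDiff_zero)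
      · exact eq_zero_of_mem_moDeg hE hr hf
    exact ⟨0, zero_mem _, hz⟩
  cohomology_surjective x y r g hg hd := by
    obtain ⟨f, hf, h⟩ := exists_moMap_sub_eq hE hg hd
    exact ⟨f, hf, rfl, h⟩

end Category

end HMS

end

/-- For every `c ≥ 0`, there is a linear A∞-equivalence from the Morse homotopy category
`Mo_ℰ(P)` to the Dolbeault DG category `DG_ℰ(𝔽₁)`, sending `L(a,b)` to `𝒪(a,b)`. Both are
A∞-categories, and on the graded morphism spaces of `Mo_ℰ(P)` the composition `m₂` given by gradient
trees is part of only one A∞-structure. -/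
theorem corollary3p2 (c : ℕ) :
    (HMS.MoCat (HMS.collection c)).IsAInfCategory ∧
    (∀ m' : ∀ x y, HMS.Chain (HMS.MoCat (HMS.collection c)).Hom x y →
        (HMS.MoCat (HMS.collection c)).Hom x y,
      ((HMS.MoCat (HMS.collection c)).withOp m').IsAInfCategory →
      (∀ {x y z} (f : (HMS.MoCat (HMS.collection c)).Hom x y)
        (g : (HMS.MoCat (HMS.collection c)).Hom y z),
        ((HMS.MoCat (HMS.collection c)).withOp m').m₂ f g
          = (HMS.MoCat (HMS.collection c)).m₂ f g) →
      ∀ {x y} (p : HMS.Chain (HMS.MoCat (HMS.collection c)).Hom x y),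
        m' x y p = (HMS.MoCat (HMS.collection c)).m p) ∧
    (HMS.DGCat (HMS.collection c)).IsAInfCategory ∧
    ∃ F : (HMS.MoCat (HMS.collection c)).LinearFunctor (HMS.DGCat (HMS.collection c)),
      F.obj = id ∧ F.IsEquivalence := by
  have hE := HMS.isStrongCollection_collection c
  exact ⟨(HMS.MoCat_isDG hE).isAInfCategory, fun m' h h₂ _ _ p => HMS.MoCat_m_unique hE m' h h₂ p,
    (HMS.DGCat_isDG _).isAInfCategory, HMS.moFunctor hE, rfl, HMS.moFunctor_isEquivalence hE⟩
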